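/- Let $N\ge 1$, let $\lambda=(\lambda_1,\dots,\lambda_N)$ be pairwise distinct real numbers, and let $\mathcal O=\{g^{-1}\mathrm{diag}(\lambda)g:\ g\in GL(N,\mathbb R)\}$ be the corresponding coadjoint orbit, where $\mathfrak{gl}(N,\mathbb R)$ is identified with its dual by the trace form. Let $\Omega$ be the Kirillov–Kostant form, $\Omega_u([u,X],[u,Y])=\mathrm{Tr}\,(u[X,Y])$ on $T_u\mathcal O=\{[u,X]: X\in\mathfrak{gl}(N,\mathbb R)\}$; equivalently $\Omega=\mathrm{Tr}\,\mathrm{diag}(\lambda)(dg\,g^{-1})^2$. For $u\in\mathcal O$ let $a_k(x)$ be the $k$-th leading principal minor of $xI-u$ ($a_0=1$), and for $1\le n\le N-1$ let $b_n(x)$ and $c_n(x)$ be the leading $n\times n$ minors of the matrix obtained from $xI-u$ by interchanging the columns, respectively the rows, $n$ and $n+1$. Let $\mathcal O^{(0)}\subset\mathcal O$ be the set of those $u$ all of whose leading $n\times n$ blocks are diagonalizable over $\mathbb R$ with pairwise distinct eigenvalues and for which $a_n$ and $a_{n+1}$ have no common root, $1\le n\le N-1$. Let $\widetilde{\mathcal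 O}^{(0)}$ be the set of pairs $(u,(\gamma_{nj})_{1\le j\le n\le N})$ with $u\in\mathcal O^{(0)}$ and $a_n(x)=\prod_{j=1}^n(x-\gamma_{nj})$ for all $n$ (an ordering of the roots of each minor), with the topology induced from the space of matrices and arrays; let $\pi(u,\gamma)=u$. The group $S=\prod_{n=1}^N S_n=\prod_{n=2}^N S_n$ acts on $\widetilde{\mathcal O}^{(0)}$ by permuting the entries of each row of $\gamma$. For real $\gamma=(\gamma_{nj})_{1\le j\le n\le N}$ and $Q=(Q_{nj})_{1\le j\le n\le N-1}$, such that entries of $\gamma$ of the same level are distinct, entries of consecutive levels are distinct ($\gamma_{nj}\ne\gamma_{n-1,k}$), and all $Q_{nj}\neq0$, put $g=g_Ng_{N-1}\cdots g_2$, where $g_n$ is the unit matrix with its upper-left $n\times n$ block replaced by $f_n$, $$(f_n)_{jk}=\frac{Q_{n-1,k}}{\gamma_{nj}-\gamma_{n-1,k}}\,\frac{\prod_{r=1}^{n-1}(\gamma_{nj}-\gamma_{n-1,r})}{\prod_{s\ne j}(\gamma_{nj}-\gamma_{ns})}\quad(k<n),\qquad (f_n)_{jn}=\frac{\prod_{r=1}^{n-1}(\gamma_{nj}-\gamma_{n-1,r})}{\prod_{s\ne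 j}(\gamma_{nj}-\gamma_{ns})},$$ and $u(\gamma,Q)=g^{-1}\mathrm{diag}(\gamma_{N1},\dots,\gamma_{NN})\,g$. **Proposition 3.1.** 1. $\mathcal O^{(0)}$ is a nonempty open subset of $\mathcal O$. The group $S$ acts freely on $\widetilde{\mathcal O}^{(0)}$, its orbits are exactly the fibres of $\pi$, and $\pi$ is a covering map with $\widetilde{\mathcal O}^{(0)}/S=\mathcal O^{(0)}$. The matrices $g$ above are invertible, and $(\gamma,Q)\mapsto(u(\gamma,Q),\gamma)$ is an $S$-equivariant homeomorphism from the set of the above $(\gamma,Q)$ in which $(\gamma_{N1},\dots,\gamma_{NN})$ is an ordering of $\lambda$ onto $\widetilde{\mathcal O}^{(0)}$ (where $S$ permutes $\gamma_{nj}$ and $Q_{nj}$ of each level simultaneously). The inverse is given by $Q_{nj}=b_n(\gamma_{nj})^{-1}a_{n+1}(\gamma_{nj})=-c_n(\gamma_{nj})a_{n-1}(\gamma_{nj})^{-1}$, where $b_n(\gamma_{nj})\neq0$ and $a_{n-1}(\gamma_{nj})\ne0$. For every fixed ordering $(\gamma_{N1},\dots,\gamma_{NN})$ of $\lambda$, let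 $\mathbb R^{N(N-1)}\setminus\Delta$ be the set of the remaining coordinates $(\gamma_{nj},Q_{nj})_{1\le j\le n\le N-1}$ that satisfy the conditions above. The map $(\gamma,Q)\mapsto u(\gamma,Q)$ is a covering map from $\mathbb R^{N(N-1)}\setminus\Delta$ onto $\mathcal O^{(0)}$, and it is the quotient map for the free action of $\prod_{n=1}^{N-1}S_n$. 2. For every fixed ordering $(\gamma_{N1},\dots,\gamma_{NN})$ of $\lambda$, the set $\mathbb R^{N(N-1)}\setminus\Delta$ is open, the map $(\gamma,Q)\mapsto u(\gamma,Q)$ is smooth on it, its differential at each point is an isomorphism onto $T_u\mathcal O$, and $$\pi^*\Omega=\sum_{n=1}^{N-1}\sum_{j=1}^n d\gamma_{nj}\wedge Q_{nj}^{-1}dQ_{nj},$$ so that $(\gamma_{nj},Q_{nj})$ are Darboux coordinates on $\widetilde{\mathcal O}^{(0)}$ (here $(\alpha\wedge\beta)(v,w)=\alpha(v)\beta(w)-\alpha(w)\beta(v)$). -/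

import Mathlib

/-! Throughout `N = m + 1`.  Levels are numbered from `0`: level `n : Fin N` of a triangular array
stands for the row `γ_{n+1} = (γ_{n+1,1}, …, γ_{n+1,n+1})`. -/

attribute [local instance] Matrix.normedAddCommGroup Matrix.normedSpace

noncomputable section

/-! ### Triangular arrays and permutations of their rows -/

/-- Triangular real arrays with `k` rows of lengths `1, …, k`. -/
abbrev GZArray (k : ℕ) : Type := ∀ n : Fin k, Fin (n.1 + 1) → ℝ

/-- The group `S_1 × S_2 × ⋯ × S_k` (the factor `S_1` is trivial). -/
def LevelPerm (k : ℕ) : Type := ∀ n : Fin k, Equiv.Perm (Fin (n.1 + 1))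

instance LevelPerm.instGroup (k : ℕ) : Group (LevelPerm k) :=
  inferInstanceAs (Group (∀ n : Fin k, Equiv.Perm (Fin (n.1 + 1))))

theorem LevelPerm.one_apply {k : ℕ} (n : Fin k) : (1 : LevelPerm k) n = 1 := rfl

theorem LevelPerm.mul_apply {k : ℕ} (σ τ : LevelPerm k) (n : Fin k) :
    (σ * τ) n = σ n * τ n := rfl

/-- Permutation of the entries of each row: `(σ · Γ)_{n, j} = Γ_{n, σ_n⁻¹ j}`. -/
def GZArray.permute {k : ℕ} (σ : LevelPerm k) (Γ : GZArray k) : GZArray k :=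
  fun n j => Γ n ((σ n)⁻¹ j)

theorem GZArray.permute_one {k : ℕ} (Γ : GZArray k) : GZArray.permute 1 Γ = Γ := rfl

theorem GZArray.permute_mul {k : ℕ} (σ τ : LevelPerm k) (Γ : GZArray k) :
    GZArray.permute (σ * τ) Γ = GZArray.permute σ (GZArray.permute τ Γ) := by
  funext n j
  simp [GZArray.permute, LevelPerm.mul_apply, mul_inv_rev]

/-- The array with `m` rows `γ`, completed by the last row `L` of length `m + 1`. -/
def GZArray.complete {m : ℕ} (L : Fin (m + 1) → ℝ) (γ : GZArray m) : GZArray (m + 1) :=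
  Fin.snoc (α := fun n : Fin (m + 1) => Fin (n.1 + 1) → ℝ) γ L

/-- Omit the factor of the last row. -/
def LevelPerm.init {m : ℕ} (σ : LevelPerm (m + 1)) : LevelPerm m := fun i => σ i.castSucc

/-- Extend by the identity permutation of the last row. -/
def LevelPerm.extend {m : ℕ} (σ : LevelPerm m) : LevelPerm (m + 1) :=
  Fin.snoc (α := fun n : Fin (m + 1) => Equiv.Perm (Fin (n.1 + 1))) σ 1

theorem LevelPerm.extend_last {m : ℕ} (σ : LevelPerm m) : σ.extend (Fin.last m) = 1 :=
  Fin.snoc_last (α := fun n : Fin (m + 1) => Equiv.Perm (Fin (n.1 + 1))) _ _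

theorem LevelPerm.extend_castSucc {m : ℕ} (σ : LevelPerm m) (i : Fin m) :
    σ.extend i.castSucc = σ i :=
  Fin.snoc_castSucc (α := fun n : Fin (m + 1) => Equiv.Perm (Fin (n.1 + 1))) _ _ _

theorem LevelPerm.init_extend {m : ℕ} (σ : LevelPerm m) : σ.extend.init = σ :=
  funext fun i => σ.extend_castSucc i

/-- `(Γ, Q)` lies outside `Δ = D₁ ∪ D₂ ∪ D₃`. -/
structure GZNondeg {m : ℕ} (Γ : GZArray (m + 1)) (Q : GZArray m) : Prop where
  /-- outside `D₁`: entries of the same level are distinct -/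
  same_level : ∀ n, Function.Injective (Γ n)
  /-- outside `D₂`: entries of consecutive levels are distinct -/
  consecutive : ∀ (i : Fin m) (j : Fin (i.succ.1 + 1)) (k : Fin (i.castSucc.1 + 1)),
    Γ i.succ j ≠ Γ i.castSucc k
  /-- outside `D₃`: all `Q` are nonzero -/
  Q_ne : ∀ i j, Q i j ≠ 0

theorem GZNondeg.permute {m : ℕ} {Γ : GZArray (m + 1)} {Q : GZArray m} (h : GZNondeg Γ Q)
    (σ : LevelPerm (m + 1)) : GZNondeg (GZArray.permute σ Γ) (GZArray.permute σ.init Q) where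
  same_level n := (h.same_level n).comp (Equiv.injective _)
  consecutive i _ _ := h.consecutive i _ _
  Q_ne i _ := h.Q_ne i _

/-! ### The explicit parametrization -/

/-- The factor `∏_r (a_j - b_r) / ∏_{s ≠ j} (a_j - a_s)`. -/
def gzFactor {k : ℕ} (a : Fin (k + 1) → ℝ) (b : Fin k → ℝ) (j : Fin (k + 1)) : ℝ :=
  (∏ r, (a j - b r)) / ∏ s ∈ Finset.univ.erase j, (a j - a s)

/-- The matrix `f_{k+1}` built from the rows `a = γ_{k+1}`, `b = γ_k`, `q = Q_k`. -/
def gzF {k : ℕ} (a : Fin (k + 1) → ℝ) (b q : Fin k → ℝ) :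
    Matrix (Fin (k + 1)) (Fin (k + 1)) ℝ :=
  Matrix.of fun j =>
    Fin.snoc (α := fun _ => ℝ) (fun c : Fin k => q c / (a j - b c) * gzFactor a b j)
      (gzFactor a b j)

/-- The `N × N` matrix with upper-left `k × k` block `f`, and equal to the unit matrix
outside of this block. -/
def embedCorner {N k : ℕ} (f : Matrix (Fin k) (Fin k) ℝ) : Matrix (Fin N) (Fin N) ℝ :=
  Matrix.of fun i j =>
    if h : i.1 < k ∧ j.1 < k then f ⟨i.1, h.1⟩ ⟨j.1, h.2⟩ else (1 : Matrix _ _ ℝ) i j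

/-- The product `g = g_N g_{N-1} ⋯ g_2`. -/
def gzG {m : ℕ} (Γ : GZArray (m + 1)) (Q : GZArray m) : Matrix (Fin (m + 1)) (Fin (m + 1)) ℝ :=
  (List.ofFn fun i : Fin m =>
    (embedCorner (gzF (Γ i.succ) (Γ i.castSucc) (Q i)) :
      Matrix (Fin (m + 1)) (Fin (m + 1)) ℝ)).reverse.prod

/-- The point `u = g⁻¹ diag(γ_N) g`. -/
def gzPoint {m : ℕ} (Γ : GZArray (m + 1)) (Q : GZArray m) :
    Matrix (Fin (m + 1)) (Fin (m + 1)) ℝ :=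
  (gzG Γ Q)⁻¹ * (Matrix.diagonal (Γ (Fin.last m)) : Matrix (Fin (m + 1)) (Fin (m + 1)) ℝ) * gzG Γ Q

/-! ### Minors of `T(x) = x I - u` -/

/-- The upper-left `k × k` block. -/
def corner {N : ℕ} (k : ℕ) (hk : k ≤ N) (A : Matrix (Fin N) (Fin N) ℝ) :
    Matrix (Fin k) (Fin k) ℝ :=
  A.submatrix (Fin.castLE hk) (Fin.castLE hk)

/-- `T(x) = x I - u`. -/
def lax {N : ℕ} (u : Matrix (Fin N) (Fin N) ℝ) (x : ℝ) : Matrix (Fin N) (Fin N) ℝ :=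
  x • (1 : Matrix (Fin N) (Fin N) ℝ) - u

/-- The `k`-th principal minor `a_k(x)` of `T(x)`; `a_0 = 1`. -/
def minorA {N : ℕ} (u : Matrix (Fin N) (Fin N) ℝ) (k : ℕ) (hk : k ≤ N) (x : ℝ) : ℝ :=
  (corner k hk (lax u x)).det

/-- `b_n(x)`, `n = i + 1`: the upper-left `n × n` minor of `T(x)` with columns `n`, `n + 1`
interchanged. -/
def minorB {m : ℕ} (u : Matrix (Fin (m + 1)) (Fin (m + 1)) ℝ) (i : Fin m) (x : ℝ) : ℝ :=
  (corner (i.1 + 1) (by omega)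
    ((lax u x).submatrix id (Equiv.swap i.castSucc i.succ))).det

/-- `c_n(x)`, `n = i + 1`: the upper-left `n × n` minor of `T(x)` with rows `n`, `n + 1`
interchanged. -/
def minorC {m : ℕ} (u : Matrix (Fin (m + 1)) (Fin (m + 1)) ℝ) (i : Fin m) (x : ℝ) : ℝ :=
  (corner (i.1 + 1) (by omega)
    ((lax u x).submatrix (Equiv.swap i.castSucc i.succ) id)).det

/-! ### The orbit, its open part, and the finite cover -/

/-- The (co)adjoint orbit of `diag(lam)` under `GL(N, ℝ)`, where `𝔤𝔩(N, ℝ)` is identified with its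
dual by the trace form. -/
def coadjointOrbit {N : ℕ} (lam : Fin N → ℝ) : Set (Matrix (Fin N) (Fin N) ℝ) :=
  {u | ∃ g : GL (Fin N) ℝ,
    u = (g⁻¹ : GL (Fin N) ℝ).1 * Matrix.diagonal lam * g.1}

/-- `A` is diagonalizable over `ℝ` with pairwise distinct (real) eigenvalues. -/
def DiagonalizableSimple {k : ℕ} (A : Matrix (Fin k) (Fin k) ℝ) : Prop :=
  ∃ (P : GL (Fin k) ℝ) (d : Fin k → ℝ), Function.Injective d ∧
    A = (P⁻¹ : GL (Fin k) ℝ).1 * Matrix.diagonal d * P.1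

/-- The open part `O⁽⁰⁾` of the orbit: all upper-left blocks are diagonalizable with distinct real
eigenvalues, and principal minors of `x I - u` of consecutive ranks have no common root. -/
def openPart {m : ℕ} (lam : Fin (m + 1) → ℝ) : Set (Matrix (Fin (m + 1)) (Fin (m + 1)) ℝ) :=
  {u | u ∈ coadjointOrbit lam ∧
    (∀ n : Fin (m + 1), DiagonalizableSimple (corner (n.1 + 1) n.isLt u)) ∧
    ∀ (i : Fin m) (x : ℝ),
      ¬ (minorA u (i.1 + 1) (by omega) x = 0 ∧ minorA u (i.1 + 2) (by omega) x = 0)}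

/-- The finite cover `Õ⁽⁰⁾`: points `u` of the open part together with an ordering
`γ_{n1}, …, γ_{nn}` of the roots of every principal minor, `a_n(x) = ∏_j (x - γ_{nj})`. -/
def gzCover {m : ℕ} (lam : Fin (m + 1) → ℝ) :
    Set (Matrix (Fin (m + 1)) (Fin (m + 1)) ℝ × GZArray (m + 1)) :=
  {p | p.1 ∈ openPart lam ∧
    ∀ (n : Fin (m + 1)) (x : ℝ), minorA p.1 (n.1 + 1) n.isLt x = ∏ j, (x - p.2 n j)}

/-- The projection `π : Õ⁽⁰⁾ → O⁽⁰⁾`. -/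
def gzCover.proj {m : ℕ} (lam : Fin (m + 1) → ℝ) (p : gzCover lam) : openPart lam :=
  ⟨p.1.1, p.2.1⟩

/-- The product of symmetric groups acts on the cover by reordering the roots. -/
instance gzCover.instMulAction {m : ℕ} (lam : Fin (m + 1) → ℝ) :
    MulAction (LevelPerm (m + 1)) (gzCover lam) where
  smul σ p := ⟨(p.1.1, GZArray.permute σ p.1.2), p.2.1, fun n x => by
    rw [p.2.2 n x]
    exact (Equiv.prod_comp (σ n)⁻¹ (fun j => x - p.1.2 n j)).symm⟩
  one_smul _ := rfl
  mul_smul σ τ p := Subtype.ext (Prod.ext rfl (GZArray.permute_mul σ τ p.1.2))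

/-! ### Coordinate spaces -/

/-- The space of coordinates `(γ, Q)` outside `Δ`, where the last row `γ_N` runs through all
orderings of the eigenvalues of the orbit. -/
def gzCoord {m : ℕ} (lam : Fin (m + 1) → ℝ) : Set (GZArray (m + 1) × GZArray m) :=
  {x | (∃ τ : Equiv.Perm (Fin (m + 1)), x.1 (Fin.last m) = lam ∘ τ) ∧ GZNondeg x.1 x.2}

instance gzCoord.instMulAction {m : ℕ} (lam : Fin (m + 1) → ℝ) :
    MulAction (LevelPerm (m + 1)) (gzCoord lam) where
  smul σ x := ⟨(GZArray.permute σ x.1.1, GZArray.permute σ.init x.1.2), by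
    obtain ⟨τ, hτ⟩ := x.2.1
    refine ⟨τ * ((σ (Fin.last m))⁻¹ : Equiv.Perm (Fin (m + 1))), ?_⟩
    funext j
    exact congrFun hτ ((σ (Fin.last m))⁻¹ j), x.2.2.permute σ⟩
  one_smul _ := rfl
  mul_smul σ τ x := Subtype.ext (Prod.ext (GZArray.permute_mul σ τ x.1.1)
    (GZArray.permute_mul σ.init τ.init x.1.2))

/-- `ℝ^{N(N-1)} ∖ Δ` for a fixed last row `γ_N = L`; the coordinates are
`(γ_{nj}, Q_{nj})`, `1 ≤ j ≤ n ≤ N - 1`. -/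
def gzDomain {m : ℕ} (L : Fin (m + 1) → ℝ) : Set (GZArray m × GZArray m) :=
  {y | GZNondeg (GZArray.complete L y.1) y.2}

/-- The projection `π` in the coordinates `(γ_{nj}, Q_{nj})`, `n ≤ N - 1`, for a fixed ordering `L`
of the eigenvalues. -/
def gzChart {m : ℕ} (L : Fin (m + 1) → ℝ) (y : GZArray m × GZArray m) :
    Matrix (Fin (m + 1)) (Fin (m + 1)) ℝ :=
  gzPoint (GZArray.complete L y.1) y.2

theorem GZArray.complete_permute {m : ℕ} (L : Fin (m + 1) → ℝ) (σ : LevelPerm m) (γ : GZArray m) :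
    GZArray.complete L (GZArray.permute σ γ) =
      GZArray.permute σ.extend (GZArray.complete L γ) := by
  funext n
  refine Fin.lastCases ?_ (fun i => ?_) n
  · funext j
    simp only [GZArray.complete, GZArray.permute, LevelPerm.extend_last, Fin.snoc_last]
    rfl
  · funext j
    simp only [GZArray.complete, GZArray.permute, LevelPerm.extend_castSucc, Fin.snoc_castSucc]

theorem gzDomain_permute {m : ℕ} {L : Fin (m + 1) → ℝ} {y : GZArray m × GZArray m}
    (hy : y ∈ gzDomain L) (σ : LevelPerm m) :
    (GZArray.permute σ y.1, GZArray.permute σ y.2) ∈ gzDomain L := by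
  have h := GZNondeg.permute hy σ.extend
  rw [← GZArray.complete_permute, LevelPerm.init_extend] at h
  exact h

/-- `S_1 × ⋯ × S_{N-1}` permutes the coordinates `(γ_{nj}, Q_{nj})` of each level `n`
simultaneously. -/
instance gzDomain.instMulAction {m : ℕ} (L : Fin (m + 1) → ℝ) :
    MulAction (LevelPerm m) (gzDomain L) where
  smul σ y := ⟨(GZArray.permute σ y.1.1, GZArray.permute σ y.1.2), gzDomain_permute y.2 σ⟩
  one_smul _ := rfl
  mul_smul σ τ y := Subtype.ext (Prod.ext (GZArray.permute_mul σ τ y.1.1)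
    (GZArray.permute_mul σ τ y.1.2))

/-! ### The Kirillov–Kostant form -/

/-- The linear map `X ↦ [u, X] = u X - X u`. -/
def commutatorMap {N : ℕ} (u : Matrix (Fin N) (Fin N) ℝ) :
    Matrix (Fin N) (Fin N) ℝ →ₗ[ℝ] Matrix (Fin N) (Fin N) ℝ :=
  LinearMap.mulLeft ℝ u - LinearMap.mulRight ℝ u

theorem commutatorMap_apply {N : ℕ} (u X : Matrix (Fin N) (Fin N) ℝ) :
    commutatorMap u X = u * X - X * u := rfl

/-- The tangent space `{[u, X] | X ∈ 𝔤𝔩(N, ℝ)}` at `u` of the orbit `{g⁻¹ u g}`. -/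
def orbitTangent {N : ℕ} (u : Matrix (Fin N) (Fin N) ℝ) :
    Submodule ℝ (Matrix (Fin N) (Fin N) ℝ) :=
  LinearMap.range (commutatorMap u)

theorem exists_of_orbitTangent {N : ℕ} {u : Matrix (Fin N) (Fin N) ℝ} (ξ : orbitTangent u) :
    ∃ X, commutatorMap u X = ξ := ξ.2

/-- The Kirillov–Kostant form at `u`: `Ω_u([u, X], [u, Y]) = Tr (u [X, Y])`. -/
def kirillovKostant {N : ℕ} (u : Matrix (Fin N) (Fin N) ℝ) (ξ η : orbitTangent u) : ℝ :=
  Matrix.trace (u * commutatorMap (exists_of_orbitTangent ξ).choose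
    (exists_of_orbitTangent η).choose)

theorem trace_mul_commutator {N : ℕ} (u X Y : Matrix (Fin N) (Fin N) ℝ) :
    Matrix.trace (u * commutatorMap X Y) = Matrix.trace (commutatorMap u X * Y) := by
  rw [commutatorMap_apply, commutatorMap_apply, mul_sub, sub_mul, Matrix.trace_sub,
    Matrix.trace_sub, ← mul_assoc u X Y, ← mul_assoc u Y X, mul_assoc X u Y,
    Matrix.trace_mul_comm X (u * Y)]

theorem commutatorMap_swap {N : ℕ} (X Y : Matrix (Fin N) (Fin N) ℝ) :
    commutatorMap X Y = -commutatorMap Y X := by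
  rw [commutatorMap_apply, commutatorMap_apply, neg_sub]

/-- The Kirillov–Kostant form does not depend on the choice of `X` and `Y`. -/
theorem kirillovKostant_eq {N : ℕ} (u X Y : Matrix (Fin N) (Fin N) ℝ) (ξ η : orbitTangent u)
    (hX : commutatorMap u X = ξ) (hY : commutatorMap u Y = η) :
    kirillovKostant u ξ η = Matrix.trace (u * commutatorMap X Y) := by
  unfold kirillovKostant
  rw [trace_mul_commutator, (exists_of_orbitTangent ξ).choose_spec, ← hX, ← trace_mul_commutator,
    commutatorMap_swap, mul_neg, Matrix.trace_neg, trace_mul_commutator,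
    (exists_of_orbitTangent η).choose_spec, ← hY, ← trace_mul_commutator,
    commutatorMap_swap X Y, mul_neg, Matrix.trace_neg]

/-- In the parametrization `u = g⁻¹ U g`, the form is `Tr U (dg g⁻¹)²`: a variation `g' = θ g`
of `g` gives the variation `[u, g⁻¹ θ g]` of `u`. -/
theorem kirillovKostant_conj {N : ℕ} (U θ θ' : Matrix (Fin N) (Fin N) ℝ) (g : GL (Fin N) ℝ)
    (ξ η : orbitTangent ((g⁻¹ : GL (Fin N) ℝ).1 * U * g.1))
    (hξ : commutatorMap ((g⁻¹ : GL (Fin N) ℝ).1 * U * g.1)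
      ((g⁻¹ : GL (Fin N) ℝ).1 * θ * g.1) = ξ)
    (hη : commutatorMap ((g⁻¹ : GL (Fin N) ℝ).1 * U * g.1)
      ((g⁻¹ : GL (Fin N) ℝ).1 * θ' * g.1) = η) :
    kirillovKostant _ ξ η = Matrix.trace (U * (θ * θ' - θ' * θ)) := by
  rw [kirillovKostant_eq _ _ _ ξ η hξ hη, commutatorMap_apply]
  have e : g.1 * (g⁻¹ : GL (Fin N) ℝ).1 = 1 := g.mul_inv
  have key : ∀ A B : Matrix (Fin N) (Fin N) ℝ,
      ((g⁻¹ : GL (Fin N) ℝ).1 * A * g.1) * ((g⁻¹ : GL (Fin N) ℝ).1 * B * g.1) =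
        (g⁻¹ : GL (Fin N) ℝ).1 * (A * B) * g.1 := fun A B => by
    calc _ = (g⁻¹ : GL (Fin N) ℝ).1 * A * (g.1 * (g⁻¹ : GL (Fin N) ℝ).1) * B * g.1 := by
            noncomm_ring
      _ = _ := by rw [e, mul_one]; noncomm_ring
  rw [key, key, ← sub_mul, ← mul_sub, key, Matrix.trace_mul_comm, ← mul_assoc, e, one_mul]

/-- The value of `∑_{n=1}^{N-1} ∑_{j=1}^{n} dγ_{nj} ∧ Q_{nj}⁻¹ dQ_{nj}` at the point `y = (γ, Q)`
on a pair of tangent vectors. -/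
def darbouxForm {m : ℕ} (y v w : GZArray m × GZArray m) : ℝ :=
  ∑ n : Fin m, ∑ j : Fin (n.1 + 1),
    (v.1 n j * ((y.2 n j)⁻¹ * w.2 n j) - w.1 n j * ((y.2 n j)⁻¹ * v.2 n j))

end

noncomputable section

/-! ### Partial fractions -/

/-! Everything rests on peeling off one level. Let `a` be the last row of eigenvalues, `b` the row
before it, `q` the last row of `Q`, and `f = gzF a b q`. Then `g = f (g' ⊕ 1)`, where `g'` belongs
to the truncated data (`gzG_succ`). Partial fractions in the roots `a` and `b` invert `f` explicitly
and show that `f⁻¹ diag(a) f` is `diag(b)` bordered by one row and one column, the bottom row being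
`q` up to its corner entry. Hence the leading block of `u` of one size less is `g'⁻¹ diag(b) g'`,
the same construction one level down (`GZNondeg.dropLast_gzPoint`), and by induction the rows of `Γ`
are the spectra of the leading blocks.

Conversely, the left eigenvectors of a bordered diagonal matrix can be written down, so such a
matrix is determined by its spectrum and its bottom row (`GZRows.eq_gzBorder`). Diagonalizing the
blocks one after another recovers `u` from the separated roots of its minors and some `Q`
(`GZSeparated.exists_gzPoint_eq`). The columns of `g'⁻¹` are eigenvectors of a block with last
coordinate 1, and `Q` is their pairing with the next row of `u`; cofactor expansion turns this into
the two formulas with minors. These are continuous in `(u, γ)`, which gives the homeomorphism.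

The topology of the projection comes from stability of simple real roots: every point of the orbit
close to `u` has ordered roots close to those of `u` (`eventually_exists_mem_gzCover`). So the open
part is open and the projection is an open map; its fibres are orbits of a finite group acting
freely on a Hausdorff space, so it is a covering.

For the symplectic form, `Tr diag(a) df f⁻¹` equals `∑ (b dq/q - db)` plus a difference of the same
expression `rowForm` at `a` and at `b` (`GZRows.exists_hasDerivAt_gzF`). Along `g` these differences
telescope, and for a fixed last row `L` there remains `Tr diag(L) dg g⁻¹ = ∑ (γ dQ/Q - dγ)`. Its
exterior derivative is, by Maurer–Cartan, `Tr diag(L) (dg g⁻¹)²`, and this is the pullback of the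
Kirillov–Kostant form because `du = [u, g⁻¹ dg]`. Nondegeneracy of the result makes the differential
injective, and counting dimensions makes it onto the tangent space. -/

theorem Polynomial.eval_div_prod_sub_eq_sum {n : ℕ} {v : Fin n → ℝ} (hv : Function.Injective v)
    {p : Polynomial ℝ} (hp : p.degree < n) {x : ℝ} (hx : ∀ i, x ≠ v i) :
    p.eval x / ∏ r, (x - v r) =
      ∑ i, p.eval (v i) / ((∏ r ∈ Finset.univ.erase i, (v i - v r)) * (x - v i)) := by
  have h1 : p = Lagrange.interpolate Finset.univ v fun i => p.eval (v i) :=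
    Lagrange.eq_interpolate hv.injOn (by simpa using hp)
  have h2 := Lagrange.eval_interpolate_not_at_node (s := Finset.univ) (v := v)
    (fun i => p.eval (v i)) (x := x) fun i _ => hx i
  rw [← h1, Lagrange.eval_nodal] at h2
  have h3 : ∏ r, (x - v r) ≠ 0 := Finset.prod_ne_zero_iff.2 fun r _ => sub_ne_zero.2 (hx r)
  rw [h2, mul_div_cancel_left₀ _ h3]
  refine Finset.sum_congr rfl fun i _ => ?_
  rw [Lagrange.nodalWeight_eq_eval_nodal_erase_inv, Lagrange.eval_nodal, div_eq_mul_inv, mul_inv]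
  ring

/-- The residue `-∏_s (b_c - a_s) / ∏_{r ≠ c} (b_c - b_r)`. -/
def gzResidue {k : ℕ} (a : Fin (k + 1) → ℝ) (b : Fin k → ℝ) (c : Fin k) : ℝ :=
  -(∏ s, (b c - a s)) / ∏ r ∈ Finset.univ.erase c, (b c - b r)

/-- The rows `a = γ_{k+1}` and `b = γ_k` are outside of `D₁` and `D₂`. -/
structure GZRows {k : ℕ} (a : Fin (k + 1) → ℝ) (b : Fin k → ℝ) : Prop where
  inj_a : Function.Injective a
  inj_b : Function.Injective b
  ne : ∀ j c, a j ≠ b c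

section Rows

variable {k : ℕ} {a : Fin (k + 1) → ℝ} {b : Fin k → ℝ}

theorem prod_erase_sub_ne_zero {n : ℕ} {v : Fin n → ℝ} (hv : Function.Injective v) (i : Fin n) :
    ∏ r ∈ Finset.univ.erase i, (v i - v r) ≠ 0 :=
  Finset.prod_ne_zero_iff.2 fun _ hr => sub_ne_zero.2 fun h => (Finset.mem_erase.1 hr).1 (hv h).symm

theorem GZRows.sub_ne (h : GZRows a b) (j : Fin (k + 1)) (c : Fin k) : a j - b c ≠ 0 :=
  sub_ne_zero.2 (h.ne j c)

/-- Numerator and denominator on the right are monic of degree `k`, so subtracting 1 leaves a proper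
fraction whose residue at `b c` is `gzResidue a b c / (a j - b c)`. The values at `x = a i` give `f
f⁻¹ = 1`; the derivative at `x = a j` enters the one-form. -/
theorem GZRows.one_add_sum_residue (h : GZRows a b) (j : Fin (k + 1)) {x : ℝ}
    (hx : ∀ c, x ≠ b c) :
    1 + ∑ c, gzResidue a b c / ((a j - b c) * (x - b c)) =
      (∏ s ∈ Finset.univ.erase j, (x - a s)) / ∏ r, (x - b r) := by
  have hdeg : (Lagrange.nodal (Finset.univ.erase j) a - Lagrange.nodal Finset.univ b).degree
      < (k : WithBot ℕ) := by
    have h1 : (Lagrange.nodal (Finset.univ.erase j) a).degree = k := by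
      rw [Lagrange.degree_nodal]; simp
    have h2 : (Lagrange.nodal Finset.univ b).degree = k := by
      rw [Lagrange.degree_nodal]; simp
    rw [← h1]
    exact Polynomial.degree_sub_lt_left (h1.trans h2.symm) Lagrange.nodal_ne_zero
      (Lagrange.nodal_monic.leadingCoeff.trans Lagrange.nodal_monic.leadingCoeff.symm)
  have key := Polynomial.eval_div_prod_sub_eq_sum h.inj_b hdeg hx
  have h3 : ∏ r, (x - b r) ≠ 0 := Finset.prod_ne_zero_iff.2 fun r _ => sub_ne_zero.2 (hx r)
  simp only [Polynomial.eval_sub, Lagrange.eval_nodal, sub_div, div_self h3] at key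
  rw [sub_eq_iff_eq_add'] at key
  rw [key]
  congr 1
  refine Finset.sum_congr rfl fun c _ => ?_
  have h4 : ∏ r, (b c - b r) = 0 := Finset.prod_eq_zero (Finset.mem_univ c) (sub_self _)
  have h5 : ∏ s, (b c - a s) = (b c - a j) * ∏ s ∈ Finset.univ.erase j, (b c - a s) :=
    (Finset.mul_prod_erase _ _ (Finset.mem_univ j)).symm
  have h6 := h.sub_ne j c
  have h7 : x - b c ≠ 0 := sub_ne_zero.2 (hx c)
  have h8 := prod_erase_sub_ne_zero h.inj_b c
  rw [gzResidue, h5, h4, zero_div, sub_zero]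
  field_simp
  ring

/-- The companion expansion with poles at `a`. It is used at `y = b c`, together with its derivative
there. -/
theorem GZRows.sum_factor (h : GZRows a b) (c : Fin k) {y : ℝ} (hy : ∀ j, y ≠ a j) :
    ∑ j, gzFactor a b j / ((a j - b c) * (y - a j)) =
      (∏ r ∈ Finset.univ.erase c, (y - b r)) / ∏ j, (y - a j) := by
  have hdeg : (Lagrange.nodal (Finset.univ.erase c) b).degree < ((k + 1 : ℕ) : WithBot ℕ) := by
    rw [Lagrange.degree_nodal, Finset.card_erase_of_mem (Finset.mem_univ _), Finset.card_univ,
      Fintype.card_fin]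
    exact_mod_cast (by omega)
  have key := Polynomial.eval_div_prod_sub_eq_sum h.inj_a hdeg hy
  rw [Lagrange.eval_nodal] at key
  rw [key]
  refine Finset.sum_congr rfl fun j _ => ?_
  have h5 : ∏ r, (a j - b r) = (a j - b c) * ∏ r ∈ Finset.univ.erase c, (a j - b r) :=
    (Finset.mul_prod_erase _ _ (Finset.mem_univ c)).symm
  have h6 := h.sub_ne j c
  have h7 : y - a j ≠ 0 := sub_ne_zero.2 (hy j)
  have h8 := prod_erase_sub_ne_zero h.inj_a j
  rw [gzFactor, h5, Lagrange.eval_nodal]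
  field_simp

/-! ### The matrix `gzF` and its inverse -/

/-- The inverse of `gzF a b q`. -/
def gzFInv (a : Fin (k + 1) → ℝ) (b q : Fin k → ℝ) : Matrix (Fin (k + 1)) (Fin (k + 1)) ℝ :=
  Matrix.of fun i j =>
    Fin.snoc (α := fun _ => ℝ) (fun c : Fin k => gzResidue a b c / q c / (a j - b c)) 1 i

@[simp] theorem gzF_castSucc (a : Fin (k + 1) → ℝ) (b q : Fin k → ℝ) (j : Fin (k + 1))
    (c : Fin k) : gzF a b q j c.castSucc = q c / (a j - b c) * gzFactor a b j := by
  simp [gzF]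

@[simp] theorem gzF_last (a : Fin (k + 1) → ℝ) (b q : Fin k → ℝ) (j : Fin (k + 1)) :
    gzF a b q j (Fin.last k) = gzFactor a b j := by
  simp [gzF]

@[simp] theorem gzFInv_castSucc (a : Fin (k + 1) → ℝ) (b q : Fin k → ℝ) (c : Fin k)
    (j : Fin (k + 1)) :
    gzFInv a b q c.castSucc j = gzResidue a b c / q c / (a j - b c) := by
  simp [gzFInv]

@[simp] theorem gzFInv_last (a : Fin (k + 1) → ℝ) (b q : Fin k → ℝ) (j : Fin (k + 1)) :
    gzFInv a b q (Fin.last k) j = 1 := by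
  simp [gzFInv]

variable {q : Fin k → ℝ}

theorem GZRows.gzF_mul_gzFInv (h : GZRows a b) (hq : ∀ c, q c ≠ 0) :
    gzF a b q * gzFInv a b q = 1 := by
  ext i j
  -- The parameters `q` cancel, and the entry becomes the expansion above at `x = a i`. Its
  -- numerator vanishes there unless `i = j`.
  have e : (gzF a b q * gzFInv a b q) i j = gzFactor a b i *
      (1 + ∑ c, gzResidue a b c / ((a j - b c) * (a i - b c))) := by
    rw [Matrix.mul_apply, Fin.sum_univ_castSucc]
    simp only [gzF_castSucc, gzFInv_castSucc, gzF_last, gzFInv_last]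
    rw [mul_add, mul_one, add_comm, Finset.mul_sum]
    congr 1
    refine Finset.sum_congr rfl fun c _ => ?_
    have := hq c
    have := h.sub_ne i c
    have := h.sub_ne j c
    field_simp
  rw [e, h.one_add_sum_residue j (h.ne i)]
  by_cases hij : i = j
  · subst hij
    have h1 : ∏ r, (a i - b r) ≠ 0 := Finset.prod_ne_zero_iff.2 fun r _ => h.sub_ne i r
    have h2 := prod_erase_sub_ne_zero h.inj_a i
    rw [gzFactor, Matrix.one_apply_eq]
    field_simp
  · rw [Finset.prod_eq_zero (Finset.mem_erase.2 ⟨hij, Finset.mem_univ i⟩) (sub_self _),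
      Matrix.one_apply_ne hij]
    simp

theorem GZRows.gzFInv_mul_gzF (h : GZRows a b) (hq : ∀ c, q c ≠ 0) :
    gzFInv a b q * gzF a b q = 1 :=
  mul_eq_one_comm.1 (h.gzF_mul_gzFInv hq)

/-- The last row of `f⁻¹` consists of ones, so this and the next identity are entries of the last
row of `f⁻¹ f = 1`. They do not involve `q`, which may be set to 1. -/
theorem GZRows.sum_factor_eq_one (h : GZRows a b) : ∑ j, gzFactor a b j = 1 := by
  have := congrFun (congrFun (h.gzFInv_mul_gzF (q := fun _ => 1) fun _ => one_ne_zero)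
    (Fin.last k)) (Fin.last k)
  simpa [Matrix.mul_apply] using this

theorem GZRows.sum_factor_div (h : GZRows a b) (c : Fin k) :
    ∑ j, gzFactor a b j / (a j - b c) = 0 := by
  have := congrFun (congrFun (h.gzFInv_mul_gzF (q := fun _ => 1) fun _ => one_ne_zero)
    (Fin.last k)) c.castSucc
  rw [Matrix.one_apply_ne (Fin.castSucc_lt_last c).ne', Matrix.mul_apply] at this
  rw [← this]
  refine Finset.sum_congr rfl fun j _ => ?_
  simp only [gzF_castSucc, gzFInv_last]
  ring

/-- The bordered matrix `f⁻¹ diag(a) f`. -/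
def gzBorder (a : Fin (k + 1) → ℝ) (b q : Fin k → ℝ) : Matrix (Fin (k + 1)) (Fin (k + 1)) ℝ :=
  gzFInv a b q * Matrix.diagonal a * gzF a b q

theorem GZRows.gzBorder_castSucc_castSucc (h : GZRows a b) (hq : ∀ c, q c ≠ 0) (c c' : Fin k) :
    gzBorder a b q c.castSucc c'.castSucc = Matrix.diagonal b c c' := by
  have h1 := congrFun (congrFun (h.gzFInv_mul_gzF hq) c.castSucc) c'.castSucc
  -- Write `a j = (a j - b c) + b c`: the first summand cancels the denominator of `f⁻¹`, the second
  -- reproduces `b c` times `f⁻¹ f`.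
  have e : gzBorder a b q c.castSucc c'.castSucc = gzResidue a b c / q c * q c' *
      ∑ j, gzFactor a b j / (a j - b c') +
        b c * (gzFInv a b q * gzF a b q) c.castSucc c'.castSucc := by
    rw [gzBorder, Matrix.mul_apply, Matrix.mul_apply, Finset.mul_sum, Finset.mul_sum,
      ← Finset.sum_add_distrib]
    refine Finset.sum_congr rfl fun j _ => ?_
    have := hq c
    have := h.sub_ne j c
    have := h.sub_ne j c'
    rw [Matrix.mul_diagonal, gzFInv_castSucc, gzF_castSucc]
    field_simp
    ring
  rw [e, h1, h.sum_factor_div, mul_zero, zero_add, Matrix.diagonal_apply, Matrix.one_apply]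
  simp

theorem GZRows.gzBorder_last_castSucc (h : GZRows a b) (c : Fin k) :
    gzBorder a b q (Fin.last k) c.castSucc = q c := by
  have e : gzBorder a b q (Fin.last k) c.castSucc = q c * ∑ j, gzFactor a b j +
      b c * (q c * ∑ j, gzFactor a b j / (a j - b c)) := by
    rw [gzBorder, Matrix.mul_apply, Finset.mul_sum, Finset.mul_sum, Finset.mul_sum,
      ← Finset.sum_add_distrib]
    refine Finset.sum_congr rfl fun j _ => ?_
    have := h.sub_ne j c
    rw [Matrix.mul_diagonal, gzFInv_last, gzF_castSucc]
    field_simp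
    ring
  rw [e, h.sum_factor_div, h.sum_factor_eq_one]
  ring

end Rows

/-! ### Extension of a matrix by a unit row and column -/

section EmbedCorner

variable {k : ℕ}

@[simp] theorem embedCorner_castSucc_castSucc (A : Matrix (Fin k) (Fin k) ℝ) (i j : Fin k) :
    (embedCorner A : Matrix (Fin (k + 1)) (Fin (k + 1)) ℝ) i.castSucc j.castSucc = A i j := by
  simp [embedCorner]

@[simp] theorem embedCorner_castSucc_last (A : Matrix (Fin k) (Fin k) ℝ) (i : Fin k) :
    (embedCorner A : Matrix (Fin (k + 1)) (Fin (k + 1)) ℝ) i.castSucc (Fin.last k) = 0 := by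
  simp [embedCorner, Matrix.one_apply]

@[simp] theorem embedCorner_last_castSucc (A : Matrix (Fin k) (Fin k) ℝ) (i : Fin k) :
    (embedCorner A : Matrix (Fin (k + 1)) (Fin (k + 1)) ℝ) (Fin.last k) i.castSucc = 0 := by
  simp [embedCorner, Matrix.one_apply, (Fin.castSucc_lt_last i).ne']

@[simp] theorem embedCorner_last_last (A : Matrix (Fin k) (Fin k) ℝ) :
    (embedCorner A : Matrix (Fin (k + 1)) (Fin (k + 1)) ℝ) (Fin.last k) (Fin.last k) = 1 := by
  simp [embedCorner]

theorem Matrix.ext_castSucc_last {M M' : Matrix (Fin (k + 1)) (Fin (k + 1)) ℝ}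
    (h1 : ∀ i j : Fin k, M i.castSucc j.castSucc = M' i.castSucc j.castSucc)
    (h2 : ∀ i : Fin k, M i.castSucc (Fin.last k) = M' i.castSucc (Fin.last k))
    (h3 : ∀ i : Fin k, M (Fin.last k) i.castSucc = M' (Fin.last k) i.castSucc)
    (h4 : M (Fin.last k) (Fin.last k) = M' (Fin.last k) (Fin.last k)) : M = M' := by
  ext i j
  refine Fin.lastCases ?_ (fun i => ?_) i <;> refine Fin.lastCases ?_ (fun j => ?_) j
  exacts [h4, h3 j, h2 i, h1 i j]

theorem embedCorner_one :
    (embedCorner (1 : Matrix (Fin k) (Fin k) ℝ) : Matrix (Fin (k + 1)) (Fin (k + 1)) ℝ) = 1 :=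
  Matrix.ext_castSucc_last (by simp [Matrix.one_apply])
    (by simp) (fun i => by simp [(Fin.castSucc_lt_last i).ne']) (by simp)

theorem embedCorner_mul (A B : Matrix (Fin k) (Fin k) ℝ) :
    (embedCorner (A * B) : Matrix (Fin (k + 1)) (Fin (k + 1)) ℝ) = embedCorner A * embedCorner B :=
  Matrix.ext_castSucc_last (by simp [Matrix.mul_apply, Fin.sum_univ_castSucc])
    (by simp [Matrix.mul_apply, Fin.sum_univ_castSucc])
    (by simp [Matrix.mul_apply, Fin.sum_univ_castSucc])
    (by simp [Matrix.mul_apply, Fin.sum_univ_castSucc])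

theorem embedCorner_list_prod (l : List (Matrix (Fin k) (Fin k) ℝ)) :
    (embedCorner l.prod : Matrix (Fin (k + 1)) (Fin (k + 1)) ℝ) = (l.map embedCorner).prod := by
  induction l with
  | nil => simpa using embedCorner_one
  | cons A l ih => rw [List.prod_cons, embedCorner_mul, ih, List.map_cons, List.prod_cons]

theorem embedCorner_self (A : Matrix (Fin k) (Fin k) ℝ) :
    (embedCorner A : Matrix (Fin k) (Fin k) ℝ) = A := by
  ext i j
  simp [embedCorner]

theorem embedCorner_embedCorner {l : ℕ} (hl : l ≤ k) (A : Matrix (Fin l) (Fin l) ℝ) :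
    (embedCorner (embedCorner A : Matrix (Fin k) (Fin k) ℝ) :
      Matrix (Fin (k + 1)) (Fin (k + 1)) ℝ) = embedCorner A := by
  refine Matrix.ext_castSucc_last (fun i j => ?_) (fun i => ?_) (fun i => ?_) ?_
  · rw [embedCorner_castSucc_castSucc]
    simp [embedCorner, Matrix.one_apply]
  · rw [embedCorner_castSucc_last]
    simp [embedCorner, hl]
  · rw [embedCorner_last_castSucc]
    simp [embedCorner, hl, (Fin.castSucc_lt_last i).ne']
  · rw [embedCorner_last_last]
    simp [embedCorner, hl]

theorem isUnit_embedCorner {A : Matrix (Fin k) (Fin k) ℝ} (hA : IsUnit A) :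
    IsUnit (embedCorner A : Matrix (Fin (k + 1)) (Fin (k + 1)) ℝ) := by
  obtain ⟨B, hB, hB'⟩ := isUnit_iff_exists.1 hA
  exact isUnit_iff_exists.2 ⟨embedCorner B, by rw [← embedCorner_mul, hB, embedCorner_one],
    by rw [← embedCorner_mul, hB', embedCorner_one]⟩

theorem embedCorner_inv {A : Matrix (Fin k) (Fin k) ℝ} (hA : IsUnit A) :
    (embedCorner A⁻¹ : Matrix (Fin (k + 1)) (Fin (k + 1)) ℝ) = (embedCorner A)⁻¹ := by
  refine (Matrix.inv_eq_left_inv ?_).symm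
  rw [← embedCorner_mul, Matrix.nonsing_inv_mul _ ((Matrix.isUnit_iff_isUnit_det _).1 hA),
    embedCorner_one]

/-- The upper-left corner of one size less. -/
def Matrix.dropLast (A : Matrix (Fin (k + 1)) (Fin (k + 1)) ℝ) : Matrix (Fin k) (Fin k) ℝ :=
  A.submatrix Fin.castSucc Fin.castSucc

theorem Matrix.dropLast_apply (A : Matrix (Fin (k + 1)) (Fin (k + 1)) ℝ) (i j : Fin k) :
    A.dropLast i j = A i.castSucc j.castSucc := rfl

theorem Matrix.dropLast_embedCorner_mul (A : Matrix (Fin k) (Fin k) ℝ)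
    (B : Matrix (Fin (k + 1)) (Fin (k + 1)) ℝ) :
    (embedCorner A * B).dropLast = A * B.dropLast := by
  ext i j
  simp [Matrix.dropLast_apply, Matrix.mul_apply, Fin.sum_univ_castSucc]

theorem Matrix.dropLast_mul_embedCorner (A : Matrix (Fin k) (Fin k) ℝ)
    (B : Matrix (Fin (k + 1)) (Fin (k + 1)) ℝ) :
    (B * embedCorner A).dropLast = B.dropLast * A := by
  ext i j
  simp [Matrix.dropLast_apply, Matrix.mul_apply, Fin.sum_univ_castSucc]

end EmbedCorner

/-! ### Recursive structure of the parametrization -/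

/-- Omit the last row. -/
def GZArray.init {k : ℕ} (Γ : GZArray (k + 1)) : GZArray k := fun n => Γ n.castSucc

section Recursion

variable {m : ℕ}

theorem GZNondeg.init {Γ : GZArray (m + 2)} {Q : GZArray (m + 1)} (h : GZNondeg Γ Q) :
    GZNondeg Γ.init Q.init where
  same_level n := h.same_level n.castSucc
  consecutive i := h.consecutive i.castSucc
  Q_ne i := h.Q_ne i.castSucc

theorem GZNondeg.rows {Γ : GZArray (m + 1)} {Q : GZArray m} (h : GZNondeg Γ Q) (i : Fin m) :
    GZRows (k := i.1 + 1) (Γ i.succ) (Γ i.castSucc) where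
  inj_a := h.same_level i.succ
  inj_b := h.same_level i.castSucc
  ne := h.consecutive i

/-- The last two rows. -/
theorem GZNondeg.rows_last {Γ : GZArray (m + 2)} {Q : GZArray (m + 1)} (h : GZNondeg Γ Q) :
    GZRows (k := m + 1) (Γ (Fin.last (m + 1))) (Γ (Fin.last m).castSucc) :=
  h.rows (Fin.last m)

theorem gzG_zero (Γ : GZArray 1) (Q : GZArray 0) : gzG Γ Q = 1 := rfl

/-- The leftmost factor has full size, and all others live in the corner of one size less. Every
later induction on the number of levels goes through this splitting. -/
theorem gzG_succ (Γ : GZArray (m + 2)) (Q : GZArray (m + 1)) :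
    gzG Γ Q = gzF (k := m + 1) (Γ (Fin.last (m + 1))) (Γ (Fin.last m).castSucc) (Q (Fin.last m)) *
      embedCorner (gzG Γ.init Q.init) := by
  unfold gzG
  rw [List.ofFn_succ_last, List.reverse_append, List.reverse_singleton, List.singleton_append,
    List.prod_cons, embedCorner_list_prod, List.map_reverse, List.map_ofFn]
  congr 1
  · exact embedCorner_self (k := m + 2) _
  · congr 3
    funext i
    exact (embedCorner_embedCorner (k := m + 1) (l := i.1 + 1 + 1) (by omega) _).symm

theorem GZNondeg.isUnit_gzG {m : ℕ} {Γ : GZArray (m + 1)} {Q : GZArray m} (h : GZNondeg Γ Q) :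
    IsUnit (gzG Γ Q) := by
  induction m with
  | zero => exact isUnit_one
  | succ m ih =>
    rw [gzG_succ]
    exact (isUnit_iff_exists.2 ⟨_, h.rows_last.gzF_mul_gzFInv (h.Q_ne (Fin.last m)),
      h.rows_last.gzFInv_mul_gzF (h.Q_ne (Fin.last m))⟩).mul (isUnit_embedCorner (ih h.init))

theorem GZNondeg.isUnit_det_gzG {Γ : GZArray (m + 1)} {Q : GZArray m} (h : GZNondeg Γ Q) :
    IsUnit (gzG Γ Q).det :=
  (Matrix.isUnit_iff_isUnit_det _).1 h.isUnit_gzG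

theorem GZNondeg.inv_gzG_succ {Γ : GZArray (m + 2)} {Q : GZArray (m + 1)} (h : GZNondeg Γ Q) :
    (gzG Γ Q)⁻¹ = embedCorner (gzG Γ.init Q.init)⁻¹ *
      gzFInv (k := m + 1) (Γ (Fin.last (m + 1))) (Γ (Fin.last m).castSucc) (Q (Fin.last m)) := by
  rw [gzG_succ, Matrix.mul_inv_rev, ← embedCorner_inv h.init.isUnit_gzG,
    Matrix.inv_eq_right_inv (h.rows_last.gzF_mul_gzFInv (h.Q_ne (Fin.last m)))]

/-- The last row of `f⁻¹` consists of ones, and multiplication by `g'⁻¹ ⊕ 1` on the left does not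
touch it. This is the normalization of the eigenvectors of `gzPoint Γ Q`. -/
theorem GZNondeg.inv_gzG_last {m : ℕ} {Γ : GZArray (m + 1)} {Q : GZArray m} (h : GZNondeg Γ Q)
    (j : Fin (m + 1)) : (gzG Γ Q)⁻¹ (Fin.last m) j = 1 := by
  cases m with
  | zero =>
    obtain rfl : j = Fin.last 0 := Subsingleton.elim (α := Fin 1) _ _
    rw [gzG_zero, inv_one, Matrix.one_apply_eq]
  | succ m =>
    rw [h.inv_gzG_succ, Matrix.mul_apply, Fin.sum_univ_castSucc]
    simp

theorem GZNondeg.gzPoint_succ {Γ : GZArray (m + 2)} {Q : GZArray (m + 1)} (h : GZNondeg Γ Q) :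
    gzPoint Γ Q = embedCorner (gzG Γ.init Q.init)⁻¹ *
      gzBorder (k := m + 1) (Γ (Fin.last (m + 1))) (Γ (Fin.last m).castSucc) (Q (Fin.last m)) *
      embedCorner (gzG Γ.init Q.init) := by
  rw [gzPoint, h.inv_gzG_succ, gzG_succ, gzBorder]
  simp only [Matrix.mul_assoc]

/-- Conjugation by `g' ⊕ 1` acts on the corner by `g'`, and the corner of the bordered matrix is
`diag(b)`. -/
theorem GZNondeg.dropLast_gzPoint {Γ : GZArray (m + 2)} {Q : GZArray (m + 1)} (h : GZNondeg Γ Q) :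
    (gzPoint Γ Q).dropLast = gzPoint Γ.init Q.init := by
  rw [h.gzPoint_succ, Matrix.dropLast_mul_embedCorner, Matrix.dropLast_embedCorner_mul, gzPoint]
  congr 2
  ext i j
  exact h.rows_last.gzBorder_castSucc_castSucc (h.Q_ne (Fin.last m)) i j

theorem GZNondeg.gzPoint_last_castSucc {Γ : GZArray (m + 2)} {Q : GZArray (m + 1)}
    (h : GZNondeg Γ Q) (s : Fin (m + 1)) :
    gzPoint Γ Q (Fin.last (m + 1)) s.castSucc =
      ∑ c, Q (Fin.last m) c * gzG Γ.init Q.init c s := by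
  rw [h.gzPoint_succ, Matrix.mul_apply, Fin.sum_univ_castSucc, embedCorner_last_castSucc, mul_zero,
    add_zero]
  refine Finset.sum_congr rfl fun c _ => ?_
  rw [embedCorner_castSucc_castSucc, Matrix.mul_apply, Fin.sum_univ_castSucc]
  simp only [embedCorner_last_castSucc, zero_mul, Finset.sum_const_zero, embedCorner_last_last,
    zero_add, one_mul]
  congr 1
  exact h.rows_last.gzBorder_last_castSucc c

end Recursion

/-! ### Minors of `x I - u` -/

section Minors

variable {m : ℕ}

theorem corner_dropLast {N k : ℕ} (hk : k ≤ N) (A : Matrix (Fin (N + 1)) (Fin (N + 1)) ℝ) :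
    corner k hk A.dropLast = corner k (hk.trans N.le_succ) A := rfl

theorem dropLast_lax {N : ℕ} (u : Matrix (Fin (N + 1)) (Fin (N + 1)) ℝ) (x : ℝ) :
    (lax u x).dropLast = lax u.dropLast x := by
  ext i j
  simp [Matrix.dropLast_apply, lax, Matrix.one_apply]

theorem corner_lax {N k : ℕ} (hk : k ≤ N) (u : Matrix (Fin N) (Fin N) ℝ) (x : ℝ) :
    corner k hk (lax u x) = lax (corner k hk u) x := by
  ext i j
  simp [corner, lax, Matrix.one_apply]

theorem minorA_eq_det_lax_corner {N k : ℕ} (hk : k ≤ N) (u : Matrix (Fin N) (Fin N) ℝ) (x : ℝ) :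
    minorA u k hk x = (lax (corner k hk u) x).det := by
  rw [minorA, corner_lax]

theorem minorA_dropLast {N k : ℕ} (hk : k ≤ N) (u : Matrix (Fin (N + 1)) (Fin (N + 1)) ℝ) (x : ℝ) :
    minorA u.dropLast k hk x = minorA u k (hk.trans N.le_succ) x := by
  rw [minorA, ← dropLast_lax, corner_dropLast, minorA]

theorem det_lax_conj {N : ℕ} {g : Matrix (Fin N) (Fin N) ℝ} (hg : IsUnit g.det) (d : Fin N → ℝ)
    (x : ℝ) : (lax (g⁻¹ * Matrix.diagonal d * g) x).det = ∏ j, (x - d j) := by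
  have e : lax (g⁻¹ * Matrix.diagonal d * g) x = g⁻¹ * Matrix.diagonal (fun j => x - d j) * g := by
    have h1 : Matrix.diagonal (fun j => x - d j) = x • (1 : Matrix (Fin N) (Fin N) ℝ) -
        Matrix.diagonal d := by
      ext i j
      by_cases h : i = j <;> simp [h]
    rw [h1, Matrix.mul_sub, Matrix.sub_mul, Matrix.mul_smul, Matrix.mul_one, Matrix.smul_mul,
      Matrix.nonsing_inv_mul _ hg, lax]
  rw [e, Matrix.det_mul, Matrix.det_mul, Matrix.det_diagonal, mul_right_comm, ← Matrix.det_mul,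
    Matrix.nonsing_inv_mul _ hg, Matrix.det_one, one_mul]

theorem GZNondeg.minorA_gzPoint {m : ℕ} {Γ : GZArray (m + 1)} {Q : GZArray m} (h : GZNondeg Γ Q)
    (n : Fin (m + 1)) (x : ℝ) : minorA (gzPoint Γ Q) (n.1 + 1) n.isLt x = ∏ j, (x - Γ n j) := by
  induction m with
  | zero =>
    obtain rfl : n = Fin.last 0 := Subsingleton.elim (α := Fin 1) _ _
    exact det_lax_conj h.isUnit_det_gzG _ x
  | succ m ih =>
    refine Fin.lastCases ?_ (fun n => ?_) n
    · exact det_lax_conj h.isUnit_det_gzG _ x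
    · have := ih h.init n
      rw [← h.dropLast_gzPoint, minorA_dropLast] at this
      exact this

theorem GZNondeg.diagonalizableSimple_corner {m : ℕ} {Γ : GZArray (m + 1)} {Q : GZArray m}
    (h : GZNondeg Γ Q) (n : Fin (m + 1)) :
    DiagonalizableSimple (corner (n.1 + 1) n.isLt (gzPoint Γ Q)) := by
  have key : ∀ {m : ℕ} {Γ : GZArray (m + 1)} {Q : GZArray m} (_ : GZNondeg Γ Q),
      DiagonalizableSimple (gzPoint Γ Q) := fun {m Γ Q} h =>
    ⟨h.isUnit_gzG.unit, Γ (Fin.last m), h.same_level _, by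
      rw [Matrix.coe_units_inv, IsUnit.unit_spec, gzPoint]⟩
  induction m with
  | zero =>
    obtain rfl : n = Fin.last 0 := Subsingleton.elim (α := Fin 1) _ _
    exact key h
  | succ m ih =>
    refine Fin.lastCases (key h) (fun n => ?_) n
    have := ih h.init n
    rwa [← h.dropLast_gzPoint, corner_dropLast] at this

/-- The eigenvectors of the blocks of `u`, normalized by the last coordinate. -/
theorem GZNondeg.exists_eigenvector {m : ℕ} {Γ : GZArray (m + 1)} {Q : GZArray m}
    (h : GZNondeg Γ Q) (i : Fin m) (j : Fin (i.1 + 1)) :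
    ∃ w : Fin (i.1 + 1) → ℝ, w (Fin.last i.1) = 1 ∧
      (corner (i.1 + 1) (by omega) (gzPoint Γ Q)).mulVec w = Γ i.castSucc j • w ∧
      ∑ s, gzPoint Γ Q i.succ (Fin.castLE (by omega) s) * w s = Q i j := by
  induction m with
  | zero => exact i.elim0
  | succ m ih =>
    induction i using Fin.lastCases with
    | cast i =>
      have := ih h.init i j
      rw [← h.dropLast_gzPoint] at this
      exact this
    | last =>
      have hu := h.init.isUnit_det_gzG
      -- The block is `g'⁻¹ diag(b) g'`, so the columns of `g'⁻¹` are its eigenvectors. The next row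
      -- of `u` is `q g'` up to the diagonal, and pairing it with column `j` returns `q j`.
      refine ⟨fun s => (gzG Γ.init Q.init)⁻¹ s j, h.init.inv_gzG_last j, ?_, ?_⟩
      · have e : corner (m + 1) (by omega) (gzPoint Γ Q) = gzPoint Γ.init Q.init :=
          h.dropLast_gzPoint
        change (corner (m + 1) (by omega) (gzPoint Γ Q)).mulVec _ = _
        rw [e]
        have e2 : gzPoint Γ.init Q.init * (gzG Γ.init Q.init)⁻¹ =
            (gzG Γ.init Q.init)⁻¹ *
              (Matrix.diagonal (Γ.init (Fin.last m)) : Matrix (Fin (m + 1)) (Fin (m + 1)) ℝ) := by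
          rw [gzPoint, Matrix.mul_assoc, Matrix.mul_nonsing_inv _ hu, Matrix.mul_one]
        funext s
        have := congrFun (congrFun e2 s) j
        rw [Matrix.mul_diagonal, mul_comm] at this
        exact this
      · have e : ∀ s : Fin (m + 1), gzPoint Γ Q (Fin.last m).succ (Fin.castLE (by simp) s) =
            ∑ c, Q (Fin.last m) c * gzG Γ.init Q.init c s := h.gzPoint_last_castSucc
        change ∑ s : Fin (m + 1), gzPoint Γ Q (Fin.last m).succ (Fin.castLE (by simp) s) *
          (gzG Γ.init Q.init)⁻¹ s j = _
        simp only [e, Finset.sum_mul]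
        rw [Finset.sum_comm]
        have e3 : ∀ c, ∑ s, Q (Fin.last m) c * gzG Γ.init Q.init c s *
            (gzG Γ.init Q.init)⁻¹ s j = Q (Fin.last m) c * (1 : Matrix _ _ ℝ) c j := fun c => by
          rw [← Matrix.mul_nonsing_inv _ hu, Matrix.mul_apply, Finset.mul_sum]
          simp only [mul_assoc]
        refine (Finset.sum_congr rfl fun c _ => e3 c).trans ?_
        simp [Matrix.one_apply]

end Minors

/-! ### The minors `b_n` and `c_n` -/

section MinorsBC

theorem Fin.val_le_succ {m : ℕ} (i : Fin m) : i.1 ≤ m + 1 := i.isLt.le.trans m.le_succ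

/-- Replacing column `p` by `M w` preserves the determinant because `w p = 1`. The new column has a
single nonzero entry at most, so the expansion along it has one term. -/
theorem Matrix.det_of_mulVec_eq_single {n : ℕ} (M : Matrix (Fin (n + 1)) (Fin (n + 1)) ℝ)
    {w : Fin (n + 1) → ℝ} {p r : Fin (n + 1)} {c : ℝ} (hw : w p = 1)
    (h : M.mulVec w = Pi.single r c) :
    M.det = (-1) ^ (r + p : ℕ) * c * (M.submatrix r.succAbove p.succAbove).det := by
  have h1 := Matrix.det_updateCol_sum M p w
  rw [hw, one_smul] at h1
  have h2 : (fun k => ∑ i, w i • M k i) = Pi.single r c := by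
    rw [← h]
    funext k
    simp [Matrix.mulVec, dotProduct, mul_comm]
  rw [h2] at h1
  rw [← h1, Matrix.det_succ_column _ p, Finset.sum_eq_single r]
  · rw [Matrix.submatrix_updateCol_succAbove]
    simp
  · intro i _ hi
    simp [hi]
  · simp

variable {m : ℕ} (u : Matrix (Fin (m + 1)) (Fin (m + 1)) ℝ) (i : Fin m) {x : ℝ}
  {w : Fin (i.1 + 1) → ℝ}

theorem lax_corner_mulVec {k N : ℕ} (hk : k ≤ N) (u : Matrix (Fin N) (Fin N) ℝ) {w : Fin k → ℝ}
    (hw : (corner k hk u).mulVec w = x • w) (r : Fin k) :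
    ∑ s, lax u x (Fin.castLE hk r) (Fin.castLE hk s) * w s = 0 := by
  have h1 := congrFun hw r
  have h2 : ∀ s, lax u x (Fin.castLE hk r) (Fin.castLE hk s) * w s =
      (if r = s then x * w s else 0) - corner k hk u r s * w s := fun s => by
    rw [lax, Matrix.sub_apply, sub_mul, Matrix.smul_apply, Matrix.one_apply, smul_eq_mul]
    congr 1
    by_cases h : r = s <;> simp [h]
  simp only [h2]
  rw [Finset.sum_sub_distrib]
  simp only [Finset.sum_ite_eq, Finset.mem_univ, if_true]
  rw [sub_eq_zero]
  exact h1.symm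

/-- The matrix whose determinant is `c_n` differs from the leading block of `x I - u` only in its
last row, which is taken from row `n + 1`. It therefore sends the eigenvector `w` to a multiple of
the last basis vector, and the complementary minor is `a_{n-1}`. -/
theorem minorC_eq (hw1 : w (Fin.last i.1) = 1)
    (hw : (corner (i.1 + 1) (by omega) u).mulVec w = x • w) :
    minorC u i x =
      -((∑ s, u i.succ (Fin.castLE (by omega) s) * w s) * minorA u i.1 (Fin.val_le_succ i) x) := by
  set M := corner (i.1 + 1) (by omega) ((lax u x).submatrix (Equiv.swap i.castSucc i.succ) id)
    with hM
  have hlast : ∀ s, M (Fin.last i.1) s = -u i.succ (Fin.castLE (by omega) s) := fun s => by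
    have e : (Fin.castLE (by omega) (Fin.last i.1) : Fin (m + 1)) = i.castSucc := rfl
    have hne : i.succ ≠ Fin.castLE (by omega) s := by
      rw [Ne, Fin.ext_iff]
      simp
      omega
    simp only [hM, corner, Matrix.submatrix_apply, e, Equiv.swap_apply_left, id]
    simp [lax, Matrix.one_apply_ne hne]
  have hcs : ∀ (r : Fin i.1) s, M r.castSucc s =
      lax u x (Fin.castLE (by omega) r.castSucc) (Fin.castLE (by omega) s) := fun r s => by
    simp only [hM, corner, Matrix.submatrix_apply, id]
    rw [Equiv.swap_apply_of_ne_of_ne] <;> rw [Ne, Fin.ext_iff] <;> simp <;> omega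
  have hmul : M.mulVec w = Pi.single (Fin.last i.1)
      (-∑ s, u i.succ (Fin.castLE (by omega) s) * w s) := by
    funext r
    refine Fin.lastCases ?_ (fun r => ?_) r
    · simp only [Matrix.mulVec, dotProduct, hlast, neg_mul, Finset.sum_neg_distrib,
        Pi.single_eq_same]
    · rw [Pi.single_eq_of_ne (Fin.castSucc_lt_last r).ne]
      simp only [Matrix.mulVec, dotProduct, hcs]
      exact lax_corner_mulVec _ u hw _
  have := Matrix.det_of_mulVec_eq_single M hw1 hmul
  have e2 : M.submatrix (Fin.last i.1).succAbove (Fin.last i.1).succAbove =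
      corner i.1 (Fin.val_le_succ i) (lax u x) := by
    ext r s
    rw [Matrix.submatrix_apply, Fin.succAbove_last, hcs]
    rfl
  rw [minorC, this, e2, minorA, Even.neg_one_pow ⟨_, rfl⟩]
  ring

/-- Extended by zero, `w` is annihilated by all rows but the last of the block of size `n + 1`.
Deleting the last row and column `n`, where `w` equals 1, leaves exactly the matrix whose
determinant is `b_n`. -/
theorem minorA_eq_mul_minorB (hw1 : w (Fin.last i.1) = 1)
    (hw : (corner (i.1 + 1) (by omega) u).mulVec w = x • w) :
    minorA u (i.1 + 2) (by omega) x =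
      (∑ s, u i.succ (Fin.castLE (by omega) s) * w s) * minorB u i x := by
  set T := corner (i.1 + 2) (by omega) (lax u x) with hT
  have hmul : T.mulVec (Fin.snoc (α := fun _ => ℝ) w 0) = Pi.single (Fin.last (i.1 + 1))
      (-∑ s, u i.succ (Fin.castLE (by omega) s) * w s) := by
    funext r
    simp only [Matrix.mulVec, dotProduct]
    rw [Fin.sum_univ_castSucc]
    simp only [Fin.snoc_castSucc, Fin.snoc_last, mul_zero, add_zero]
    refine Fin.lastCases ?_ (fun r => ?_) r
    · rw [Pi.single_eq_same, ← Finset.sum_neg_distrib]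
      refine Finset.sum_congr rfl fun s _ => ?_
      have e : (Fin.castLE (by omega) (Fin.last (i.1 + 1)) : Fin (m + 1)) = i.succ := rfl
      have hne : i.succ ≠ Fin.castLE (by omega) s.castSucc := by
        rw [Ne, Fin.ext_iff]
        simp
        omega
      rw [← neg_mul]
      congr 1
      simp only [hT, corner, Matrix.submatrix_apply, e]
      simp only [lax, Matrix.sub_apply, Matrix.smul_apply, Matrix.one_apply_ne hne, smul_zero,
        zero_sub]
      rfl
    · rw [Pi.single_eq_of_ne (Fin.castSucc_lt_last r).ne]
      exact lax_corner_mulVec (x := x) (by omega) u hw r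
  have hw2 : Fin.snoc (α := fun _ => ℝ) w 0 (Fin.last i.1).castSucc = 1 := by
    rw [Fin.snoc_castSucc, hw1]
  have := Matrix.det_of_mulVec_eq_single T hw2 hmul
  have e2 : T.submatrix (Fin.last (i.1 + 1)).succAbove (Fin.last i.1).castSucc.succAbove =
      corner (i.1 + 1) (by omega) ((lax u x).submatrix id (Equiv.swap i.castSucc i.succ)) := by
    ext r s
    rw [Matrix.submatrix_apply, Fin.succAbove_last]
    simp only [hT, corner, Matrix.submatrix_apply, id]
    congr 1
    refine Fin.lastCases ?_ (fun s => ?_) s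
    · have e : (Fin.castLE (by omega) (Fin.last i.1) : Fin (m + 1)) = i.castSucc := rfl
      rw [e, Equiv.swap_apply_left, Fin.succAbove_castSucc_self]
      rfl
    · rw [Fin.succAbove_of_castSucc_lt _ _ (by simp [Fin.lt_def]), Equiv.swap_apply_of_ne_of_ne]
      · rfl
      all_goals rw [Ne, Fin.ext_iff]; simp; omega
  rw [minorA, ← hT, this, e2, minorB]
  have : (-1 : ℝ) ^ ((Fin.last (i.1 + 1) : ℕ) + ((Fin.last i.1).castSucc : ℕ)) = -1 :=
    Odd.neg_one_pow ⟨i.1, by simp; ring⟩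
  rw [this]
  ring

end MinorsBC

theorem GZNondeg.minorC_gzPoint {m : ℕ} {Γ : GZArray (m + 1)} {Q : GZArray m}
    (h : GZNondeg Γ Q) (i : Fin m) (j : Fin (i.1 + 1)) :
    minorC (gzPoint Γ Q) i (Γ i.castSucc j) =
      -(Q i j * minorA (gzPoint Γ Q) i.1 (Fin.val_le_succ i) (Γ i.castSucc j)) := by
  obtain ⟨w, h1, h2, h3⟩ := h.exists_eigenvector i j
  rw [minorC_eq _ _ h1 h2, h3]

theorem GZNondeg.minorA_gzPoint_eq_mul_minorB {m : ℕ} {Γ : GZArray (m + 1)} {Q : GZArray m}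
    (h : GZNondeg Γ Q) (i : Fin m) (j : Fin (i.1 + 1)) :
    minorA (gzPoint Γ Q) (i.1 + 2) (by omega) (Γ i.castSucc j) =
      Q i j * minorB (gzPoint Γ Q) i (Γ i.castSucc j) := by
  obtain ⟨w, h1, h2, h3⟩ := h.exists_eigenvector i j
  rw [minorA_eq_mul_minorB _ _ h1 h2, h3]

/-! ### Reconstruction of `Q` from `u` and the roots -/

/-- `Γ` lies outside `D₁ ∪ D₂`. -/
structure GZSeparated {m : ℕ} (Γ : GZArray (m + 1)) : Prop where
  same_level : ∀ n, Function.Injective (Γ n)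
  consecutive : ∀ (i : Fin m) (j : Fin (i.succ.1 + 1)) (k : Fin (i.castSucc.1 + 1)),
    Γ i.succ j ≠ Γ i.castSucc k

theorem GZNondeg.separated {m : ℕ} {Γ : GZArray (m + 1)} {Q : GZArray m} (h : GZNondeg Γ Q) :
    GZSeparated Γ := ⟨h.same_level, h.consecutive⟩

theorem lax_conj {N : ℕ} {H : Matrix (Fin N) (Fin N) ℝ} (hH : IsUnit H.det)
    (u : Matrix (Fin N) (Fin N) ℝ) (x : ℝ) : lax (H * u * H⁻¹) x = H * lax u x * H⁻¹ := by
  rw [lax, lax, Matrix.mul_sub, Matrix.sub_mul, Matrix.mul_smul, Matrix.mul_one, Matrix.smul_mul,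
    Matrix.mul_nonsing_inv _ hH]

/-- A bordered diagonal matrix with spectrum `a` is determined by its last row. -/
theorem GZRows.eq_gzBorder {k : ℕ} {a : Fin (k + 1) → ℝ} {b : Fin k → ℝ} (h : GZRows a b)
    {v : Matrix (Fin (k + 1)) (Fin (k + 1)) ℝ} (hv : v.dropLast = Matrix.diagonal b)
    (hdet : ∀ x, (lax v x).det = ∏ j, (x - a j)) :
    (∀ c : Fin k, v (Fin.last k) c.castSucc ≠ 0) ∧
      v = gzBorder a b fun c => v (Fin.last k) c.castSucc := by
  have hv' : ∀ c' c : Fin k, v c'.castSucc c.castSucc = Matrix.diagonal b c' c := fun c' c =>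
    congrFun (congrFun hv c') c
  -- If the entry vanished, column `c` of `b c • 1 - v` would be zero and `b c` would be one of the
  -- eigenvalues `a`.
  have hq : ∀ c : Fin k, v (Fin.last k) c.castSucc ≠ 0 := by
    intro c hc
    have h0 : (lax v (b c)).det = 0 := by
      refine Matrix.det_eq_zero_of_column_eq_zero c.castSucc fun i => ?_
      refine Fin.lastCases ?_ (fun c' => ?_) i
      · simp [lax, hc, Matrix.one_apply_ne (Fin.castSucc_lt_last c).ne']
      · by_cases e : c' = c
        · subst e
          simp [lax, hv']
        · simp [lax, hv', e]
    rw [hdet] at h0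
    obtain ⟨j, _, hj⟩ := Finset.prod_eq_zero_iff.1 h0
    exact h.ne j c (sub_eq_zero.1 hj).symm
  refine ⟨hq, ?_⟩
  set q : Fin k → ℝ := fun c => v (Fin.last k) c.castSucc with hqd
  have key : gzF a b q * v = Matrix.diagonal a * gzF a b q := by
    ext j s
    have h0 : (lax v (a j)).det = 0 := by
      rw [hdet]
      exact Finset.prod_eq_zero (Finset.mem_univ j) (sub_self _)
    obtain ⟨l, hl0, hl⟩ := Matrix.exists_vecMul_eq_zero_iff.2 h0
    have hl1 : ∀ s, ∑ r, l r * v r s = a j * l s := fun s => by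
      have := congrFun hl s
      simp only [Matrix.vecMul, dotProduct, lax, Matrix.sub_apply, Matrix.smul_apply, mul_sub,
        Finset.sum_sub_distrib, Matrix.one_apply, smul_eq_mul, mul_ite, mul_one, mul_zero,
        Finset.sum_ite_eq', Finset.mem_univ, if_true, Pi.zero_apply] at this
      linarith
    -- The eigenvalue equation in column `c` fixes each coordinate of the left eigenvector in terms
    -- of the last one, so `l` is proportional to row `j` of `gzF a b q`.
    have hl2 : ∀ c : Fin k, l c.castSucc = l (Fin.last k) * (q c / (a j - b c)) := fun c => by
      have := hl1 c.castSucc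
      rw [Fin.sum_univ_castSucc] at this
      simp only [hv', Matrix.diagonal_apply, mul_ite, mul_zero, Finset.sum_ite_eq',
        Finset.mem_univ, if_true] at this
      have h2 := h.sub_ne j c
      field_simp
      simp only [hqd]
      linarith
    have hl3 : l (Fin.last k) ≠ 0 := by
      intro h3
      refine hl0 (funext fun i => ?_)
      refine Fin.lastCases h3 (fun c => ?_) i
      rw [hl2, h3, zero_mul, Pi.zero_apply]
    have hF : ∀ r, gzF a b q j r = gzFactor a b j / l (Fin.last k) * l r := fun r => by
      refine Fin.lastCases ?_ (fun c => ?_) r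
      · rw [gzF_last]
        field_simp
      · rw [gzF_castSucc, hl2]
        field_simp
    rw [Matrix.mul_apply, Matrix.diagonal_mul]
    simp only [hF, mul_assoc]
    rw [← Finset.mul_sum, hl1]
    ring
  rw [gzBorder, Matrix.mul_assoc, ← key, ← Matrix.mul_assoc, h.gzFInv_mul_gzF hq, Matrix.one_mul]

/-- Once the leading block is diagonalized by `g'`, conjugation by `g' ⊕ 1` turns `u` into a
bordered diagonal matrix with known spectrum, and its bottom row supplies the last row of `Q`. Only
separation of the roots is needed; diagonalizability of the blocks follows. -/
theorem GZSeparated.exists_gzPoint_eq {m : ℕ} {Γ : GZArray (m + 1)} (h : GZSeparated Γ)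
    {u : Matrix (Fin (m + 1)) (Fin (m + 1)) ℝ}
    (hu : ∀ (n : Fin (m + 1)) (x : ℝ), minorA u (n.1 + 1) n.isLt x = ∏ j, (x - Γ n j)) :
    ∃ Q : GZArray m, GZNondeg Γ Q ∧ gzPoint Γ Q = u := by
  induction m with
  | zero =>
    refine ⟨fun i => i.elim0, ⟨h.same_level, h.consecutive, fun i => i.elim0⟩, ?_⟩
    have h1 := hu (Fin.last 0) 0
    ext i j
    obtain rfl : i = Fin.last 0 := Subsingleton.elim (α := Fin 1) _ _
    obtain rfl : j = Fin.last 0 := Subsingleton.elim (α := Fin 1) _ _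
    rw [gzPoint, gzG_zero, inv_one, Matrix.one_mul, Matrix.mul_one, Matrix.diagonal_apply_eq]
    have e1 : minorA u ((Fin.last 0).1 + 1) (Fin.last 0).isLt 0 = -u (Fin.last 0) (Fin.last 0) := by
      rw [minorA]
      refine (Matrix.det_fin_one _).trans ?_
      simp [corner, lax]
    have e2 : ∏ j, (0 - Γ (Fin.last 0) j) = -Γ (Fin.last 0) (Fin.last 0) :=
      (Fin.prod_univ_one (fun j : Fin 1 => 0 - Γ (Fin.last 0) j)).trans (zero_sub _)
    rw [e1, e2] at h1
    exact (neg_injective h1).symm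
  | succ m ih =>
    have hi : GZSeparated Γ.init :=
      ⟨fun n => h.same_level n.castSucc, fun i => h.consecutive i.castSucc⟩
    obtain ⟨Q, hQ, hQu⟩ := ih hi (u := u.dropLast) fun n x => by
      rw [minorA_dropLast]
      exact hu n.castSucc x
    have hr : GZRows (k := m + 1) (Γ (Fin.last (m + 1))) (Γ (Fin.last m).castSucc) :=
      ⟨h.same_level _, h.same_level _, h.consecutive (Fin.last m)⟩
    set H : Matrix (Fin (m + 2)) (Fin (m + 2)) ℝ := embedCorner (gzG Γ.init Q) with hH
    have hHu : IsUnit H.det := (Matrix.isUnit_iff_isUnit_det _).1 (isUnit_embedCorner hQ.isUnit_gzG)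
    have hgu := hQ.isUnit_det_gzG
    have hHi : H⁻¹ = embedCorner (gzG Γ.init Q)⁻¹ := (embedCorner_inv hQ.isUnit_gzG).symm
    obtain ⟨hq, hv⟩ := hr.eq_gzBorder (v := H * u * H⁻¹) (by
      rw [hHi, hH, Matrix.dropLast_mul_embedCorner, Matrix.dropLast_embedCorner_mul, ← hQu, gzPoint,
        Matrix.mul_assoc, Matrix.mul_assoc, Matrix.mul_assoc, Matrix.mul_nonsing_inv _ hgu,
        Matrix.mul_one, ← Matrix.mul_assoc, Matrix.mul_nonsing_inv _ hgu, Matrix.one_mul]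
      rfl) (fun x => by
      rw [lax_conj hHu, Matrix.det_mul, Matrix.det_mul, mul_right_comm, ← Matrix.det_mul,
        Matrix.mul_nonsing_inv _ hHu, Matrix.det_one, one_mul]
      exact hu (Fin.last (m + 1)) x)
    set q : Fin (m + 1) → ℝ := fun c => (H * u * H⁻¹) (Fin.last (m + 1)) c.castSucc with hqd
    set Q' : GZArray (m + 1) := Fin.snoc (α := fun n : Fin (m + 1) => Fin (n.1 + 1) → ℝ) Q q
    have e1 : Q' (Fin.last m) = q :=
      Fin.snoc_last (α := fun n : Fin (m + 1) => Fin (n.1 + 1) → ℝ) _ _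
    have e2 : GZArray.init Q' = Q := funext fun i =>
      Fin.snoc_castSucc (α := fun n : Fin (m + 1) => Fin (n.1 + 1) → ℝ) _ _ _
    have hQ' : GZNondeg Γ Q' := ⟨h.same_level, h.consecutive, fun i => by
      induction i using Fin.lastCases with
      | last =>
        rw [e1]
        exact hq
      | cast i =>
        have := hQ.Q_ne i
        rwa [← e2] at this⟩
    refine ⟨Q', hQ', ?_⟩
    rw [hQ'.gzPoint_succ, e1, e2, ← hH, ← hHi, ← hv]
    simp only [Matrix.mul_assoc]
    rw [Matrix.nonsing_inv_mul _ hHu, Matrix.mul_one, ← Matrix.mul_assoc,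
      Matrix.nonsing_inv_mul _ hHu, Matrix.one_mul]

/-! ### The orbit and its open part -/

section OpenPart

theorem exists_perm_of_prod_sub_eq {n : ℕ} {d e : Fin n → ℝ} (hd : Function.Injective d)
    (h : ∀ x : ℝ, ∏ j, (x - d j) = ∏ j, (x - e j)) : ∃ σ : Equiv.Perm (Fin n), e = d ∘ σ := by
  have h1 : ∀ j, ∃ i, e j = d i := fun j => by
    have := h (e j)
    rw [Finset.prod_eq_zero (f := fun i => e j - e i) (Finset.mem_univ j) (sub_self _)] at this
    obtain ⟨i, _, hi⟩ := Finset.prod_eq_zero_iff.1 this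
    exact ⟨i, sub_eq_zero.1 hi⟩
  have h2 : ∀ i, ∃ j, d i = e j := fun i => by
    have := h (d i)
    rw [Finset.prod_eq_zero (f := fun j => d i - d j) (Finset.mem_univ i) (sub_self _)] at this
    obtain ⟨j, _, hj⟩ := Finset.prod_eq_zero_iff.1 this.symm
    exact ⟨j, sub_eq_zero.1 hj⟩
  choose s hs using h1
  choose r hr using h2
  -- Injectivity of `e` is not known beforehand: `s` is surjective, hence a permutation of a finite
  -- set.
  have hsr : Function.RightInverse r s := fun i => hd (by rw [← hs, ← hr])
  exact ⟨Equiv.ofBijective s (Finite.injective_iff_bijective.1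
    (Finite.injective_iff_surjective.2 hsr.surjective)), funext hs⟩

theorem DiagonalizableSimple.exists_det_lax {k : ℕ} {A : Matrix (Fin k) (Fin k) ℝ}
    (h : DiagonalizableSimple A) :
    ∃ d : Fin k → ℝ, Function.Injective d ∧ ∀ x, (lax A x).det = ∏ j, (x - d j) := by
  obtain ⟨P, d, hd, rfl⟩ := h
  refine ⟨d, hd, fun x => ?_⟩
  rw [Matrix.coe_units_inv]
  exact det_lax_conj ((Matrix.isUnit_iff_isUnit_det _).1 P.isUnit) d x

theorem det_lax_of_mem_coadjointOrbit {N : ℕ} {lam : Fin N → ℝ} {u : Matrix (Fin N) (Fin N) ℝ}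
    (h : u ∈ coadjointOrbit lam) (x : ℝ) : (lax u x).det = ∏ j, (x - lam j) := by
  obtain ⟨g, rfl⟩ := h
  rw [Matrix.coe_units_inv]
  exact det_lax_conj ((Matrix.isUnit_iff_isUnit_det _).1 g.isUnit) lam x

theorem coadjointOrbit_comp_perm {N : ℕ} (lam : Fin N → ℝ) (τ : Equiv.Perm (Fin N)) :
    coadjointOrbit (lam ∘ τ) = coadjointOrbit lam := by
  have key : ∀ (lam : Fin N → ℝ) (τ : Equiv.Perm (Fin N)),
      coadjointOrbit (lam ∘ τ) ⊆ coadjointOrbit lam := by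
    rintro lam τ u ⟨g, rfl⟩
    have h1 : (1 : Matrix (Fin N) (Fin N) ℝ).submatrix τ id *
        (1 : Matrix (Fin N) (Fin N) ℝ).submatrix id τ = 1 := by
      rw [← Matrix.submatrix_mul _ _ _ _ _ Function.bijective_id, Matrix.mul_one,
        Matrix.submatrix_one_equiv]
    have h2 := mul_eq_one_comm.1 h1
    let P : GL (Fin N) ℝ := ⟨_, _, h1, h2⟩
    refine ⟨P⁻¹ * g, ?_⟩
    have h3 : Matrix.diagonal (lam ∘ τ) = P.1 * Matrix.diagonal lam * (P⁻¹ : GL (Fin N) ℝ).1 := by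
      change _ = (1 : Matrix (Fin N) (Fin N) ℝ).submatrix τ id * Matrix.diagonal lam *
        (1 : Matrix (Fin N) (Fin N) ℝ).submatrix id τ
      have e : Matrix.diagonal lam = (Matrix.diagonal lam).submatrix id id := rfl
      rw [e, ← Matrix.submatrix_mul _ _ _ _ _ Function.bijective_id,
        ← Matrix.submatrix_mul _ _ _ _ _ Function.bijective_id, Matrix.mul_one, Matrix.one_mul,
        Matrix.submatrix_diagonal_equiv]
    rw [h3, mul_inv_rev, inv_inv, Units.val_mul, Units.val_mul]
    simp only [Matrix.mul_assoc]
  refine (key lam τ).antisymm ?_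
  have := key (lam ∘ τ) τ⁻¹
  rwa [Function.comp_assoc, ← Equiv.Perm.coe_mul, mul_inv_cancel, Equiv.Perm.coe_one,
    Function.comp_id] at this

variable {m : ℕ} {lam : Fin (m + 1) → ℝ}

theorem GZNondeg.gzPoint_mem_coadjointOrbit {Γ : GZArray (m + 1)} {Q : GZArray m}
    (h : GZNondeg Γ Q) : gzPoint Γ Q ∈ coadjointOrbit (Γ (Fin.last m)) :=
  ⟨h.isUnit_gzG.unit, by rw [Matrix.coe_units_inv, IsUnit.unit_spec, gzPoint]⟩

theorem separated_of_mem_gzCover {p : Matrix (Fin (m + 1)) (Fin (m + 1)) ℝ × GZArray (m + 1)}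
    (hp : p ∈ gzCover lam) : GZSeparated p.2 where
  same_level n := by
    obtain ⟨d, hd, h⟩ := (hp.1.2.1 n).exists_det_lax
    obtain ⟨σ, hσ⟩ := exists_perm_of_prod_sub_eq (d := d) (e := p.2 n) hd fun x => by
      rw [← h, ← hp.2, minorA_eq_det_lax_corner]
    rw [hσ]
    exact hd.comp σ.injective
  consecutive i j k h := by
    refine hp.1.2.2 i (p.2 i.castSucc k) ⟨?_, ?_⟩
    · refine (hp.2 i.castSucc _).trans ?_
      exact Finset.prod_eq_zero (Finset.mem_univ k) (sub_self _)
    · refine (hp.2 i.succ _).trans ?_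
      exact Finset.prod_eq_zero (Finset.mem_univ j) (sub_eq_zero.2 h.symm)

/-- This replaces diagonalizability and absence of common roots by the open condition `GZSeparated`
on the roots alone; the reconstruction of `u` as a `gzPoint` provides the diagonalizing matrices. -/
theorem mem_gzCover_iff {u : Matrix (Fin (m + 1)) (Fin (m + 1)) ℝ} {Γ : GZArray (m + 1)} :
    (u, Γ) ∈ gzCover lam ↔ u ∈ coadjointOrbit lam ∧ GZSeparated Γ ∧
      ∀ (n : Fin (m + 1)) (x : ℝ), minorA u (n.1 + 1) n.isLt x = ∏ j, (x - Γ n j) := by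
  refine ⟨fun h => ⟨h.1.1, separated_of_mem_gzCover h, h.2⟩, fun ⟨h1, h2, h3⟩ =>
    ⟨⟨h1, ?_, ?_⟩, h3⟩⟩
  · obtain ⟨Q, hQ, rfl⟩ := h2.exists_gzPoint_eq h3
    exact hQ.diagonalizableSimple_corner
  · rintro i x ⟨ha, hb⟩
    obtain ⟨k, _, hk⟩ := Finset.prod_eq_zero_iff.1 ((h3 i.castSucc x).symm.trans ha)
    obtain ⟨j, _, hj⟩ := Finset.prod_eq_zero_iff.1 ((h3 i.succ x).symm.trans hb)
    exact h2.consecutive i j k (by linarith)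

theorem exists_mem_gzCover {u : Matrix (Fin (m + 1)) (Fin (m + 1)) ℝ} (hu : u ∈ openPart lam) :
    ∃ Γ, (u, Γ) ∈ gzCover lam := by
  choose d _ h using fun n => (hu.2.1 n).exists_det_lax
  exact ⟨d, hu, fun n x => by rw [minorA_eq_det_lax_corner]; exact h n x⟩

theorem last_of_mem_gzCover (hlam : Function.Injective lam)
    {u : Matrix (Fin (m + 1)) (Fin (m + 1)) ℝ} {Γ : GZArray (m + 1)} (h : (u, Γ) ∈ gzCover lam) :
    ∃ τ : Equiv.Perm (Fin (m + 1)), Γ (Fin.last m) = lam ∘ τ :=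
  exists_perm_of_prod_sub_eq hlam fun x => by
    rw [← det_lax_of_mem_coadjointOrbit h.1.1]
    exact h.2 (Fin.last m) x

theorem gzPoint_mem_gzCover {Γ : GZArray (m + 1)} {Q : GZArray m} (h : (Γ, Q) ∈ gzCoord lam) :
    (gzPoint Γ Q, Γ) ∈ gzCover lam := by
  obtain ⟨⟨τ, hτ⟩, hn⟩ := h
  change GZNondeg Γ Q at hn
  refine mem_gzCover_iff.2 ⟨?_, hn.separated, hn.minorA_gzPoint⟩
  have := hn.gzPoint_mem_coadjointOrbit
  change Γ (Fin.last m) = lam ∘ τ at hτ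
  rwa [hτ, coadjointOrbit_comp_perm] at this

theorem minorA_ne_zero_of_mem_gzCover {u : Matrix (Fin (m + 1)) (Fin (m + 1)) ℝ}
    {Γ : GZArray (m + 1)} (h : (u, Γ) ∈ gzCover lam) (i : Fin m) (j : Fin (i.1 + 1)) :
    minorA u i.1 (Fin.val_le_succ i) (Γ i.castSucc j) ≠ 0 := by
  obtain ⟨i, hi⟩ := i
  cases i with
  -- At the lowest level the denominator is `a_0 = 1`, the determinant of an empty matrix.
  | zero => simp [minorA]
  | succ i =>
    have h1 := h.2 ⟨i, by omega⟩ (Γ (Fin.castSucc ⟨i + 1, hi⟩) j)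
    refine h1.trans_ne (Finset.prod_ne_zero_iff.2 fun k _ => sub_ne_zero.2 ?_)
    exact (separated_of_mem_gzCover h).consecutive ⟨i, by omega⟩ j k

theorem minorA_succ_ne_zero_of_mem_gzCover {u : Matrix (Fin (m + 1)) (Fin (m + 1)) ℝ}
    {Γ : GZArray (m + 1)} (h : (u, Γ) ∈ gzCover lam) (i : Fin m) (j : Fin (i.1 + 1)) :
    minorA u (i.1 + 2) (by omega) (Γ i.castSucc j) ≠ 0 := by
  refine (h.2 i.succ _).trans_ne (Finset.prod_ne_zero_iff.2 fun k _ => sub_ne_zero.2 ?_)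
  exact ((separated_of_mem_gzCover h).consecutive i k j).symm

end OpenPart

/-! ### Smoothness of the parametrization -/

section Smooth

open scoped ContDiff

variable {E : Type*} [NormedAddCommGroup E] [NormedSpace ℝ E] {r : ℕ∞ω} {z : E}

theorem contDiffAt_matrix {N : ℕ} {f : E → Matrix (Fin N) (Fin N) ℝ} :
    ContDiffAt ℝ r f z ↔ ∀ i j, ContDiffAt ℝ r (fun y => f y i j) z :=
  (contDiffAt_pi (F' := fun _ : Fin N => Fin N → ℝ)).trans
    (forall_congr' fun _ => contDiffAt_pi (F' := fun _ : Fin N => ℝ))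

theorem ContDiffAt.matrixMul {N : ℕ} {f g : E → Matrix (Fin N) (Fin N) ℝ}
    (hf : ContDiffAt ℝ r f z) (hg : ContDiffAt ℝ r g z) :
    ContDiffAt ℝ r (fun y => f y * g y) z := by
  rw [contDiffAt_matrix] at *
  intro i j
  simp only [Matrix.mul_apply]
  exact ContDiffAt.sum fun k _ => (hf i k).mul (hg k j)

theorem ContDiffAt.matrixDet {N : ℕ} {f : E → Matrix (Fin N) (Fin N) ℝ}
    (hf : ContDiffAt ℝ r f z) : ContDiffAt ℝ r (fun y => (f y).det) z := by
  rw [contDiffAt_matrix] at hf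
  simp only [Matrix.det_apply']
  exact ContDiffAt.sum fun σ _ => contDiffAt_const.mul (contDiffAt_prod fun i _ => hf _ _)

theorem ContDiffAt.matrixInv {N : ℕ} {f : E → Matrix (Fin N) (Fin N) ℝ}
    (hf : ContDiffAt ℝ r f z) (hz : IsUnit (f z).det) :
    ContDiffAt ℝ r (fun y => (f y)⁻¹) z := by
  rw [contDiffAt_matrix]
  intro i j
  simp only [Matrix.inv_def, Matrix.smul_apply, Matrix.adjugate_apply, Ring.inverse_eq_inv',
    smul_eq_mul]
  refine (hf.matrixDet.inv hz.ne_zero).mul (ContDiffAt.matrixDet ?_)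
  rw [contDiffAt_matrix] at *
  intro a b
  simp only [Matrix.updateRow_apply]
  split_ifs
  · exact contDiffAt_const
  · exact hf a b

theorem ContDiffAt.gzF {k : ℕ} {a : E → Fin (k + 1) → ℝ} {b q : E → Fin k → ℝ}
    (ha : ContDiffAt ℝ r a z) (hb : ContDiffAt ℝ r b z) (hq : ContDiffAt ℝ r q z)
    (h : GZRows (a z) (b z)) : ContDiffAt ℝ r (fun y => gzF (a y) (b y) (q y)) z := by
  rw [contDiffAt_pi] at ha hb hq
  have ht : ∀ j, ContDiffAt ℝ r (fun y => gzFactor (a y) (b y) j) z := fun j => by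
    simp only [gzFactor]
    exact (contDiffAt_prod fun c _ => (ha j).sub (hb c)).div
      (contDiffAt_prod fun s _ => (ha j).sub (ha s)) (prod_erase_sub_ne_zero h.inj_a j)
  rw [contDiffAt_matrix]
  intro i j
  refine Fin.lastCases ?_ (fun c => ?_) j
  · simpa only [gzF_last] using ht i
  · simp only [gzF_castSucc]
    exact ((hq c).div ((ha i).sub (hb c)) (h.sub_ne i c)).mul (ht i)

theorem ContDiffAt.embedCorner_succ {k : ℕ} {A : E → Matrix (Fin k) (Fin k) ℝ}
    (hA : ContDiffAt ℝ r A z) :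
    ContDiffAt ℝ r (fun y => (embedCorner (A y) : Matrix (Fin (k + 1)) (Fin (k + 1)) ℝ)) z := by
  rw [contDiffAt_matrix] at *
  intro i j
  refine Fin.lastCases ?_ (fun i => ?_) i <;> refine Fin.lastCases ?_ (fun j => ?_) j
  · simpa using contDiffAt_const
  · simpa using contDiffAt_const
  · simpa using contDiffAt_const
  · simpa using hA i j

theorem ContDiffAt.gzG {m : ℕ} {Γ : E → GZArray (m + 1)} {Q : E → GZArray m}
    (hΓ : ContDiffAt ℝ r Γ z) (hQ : ContDiffAt ℝ r Q z) (h : GZNondeg (Γ z) (Q z)) :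
    ContDiffAt ℝ r (fun y => gzG (Γ y) (Q y)) z := by
  induction m with
  | zero => exact contDiffAt_const
  | succ m ih =>
    simp only [gzG_succ]
    rw [contDiffAt_pi] at hΓ hQ
    exact (ContDiffAt.gzF (hΓ _) (hΓ _) (hQ _) h.rows_last).matrixMul
      (ContDiffAt.embedCorner_succ (ih (contDiffAt_pi.2 fun n => hΓ n.castSucc)
        (contDiffAt_pi.2 fun n => hQ n.castSucc) h.init))

theorem ContDiffAt.gzPoint {m : ℕ} {Γ : E → GZArray (m + 1)} {Q : E → GZArray m}
    (hΓ : ContDiffAt ℝ r Γ z) (hQ : ContDiffAt ℝ r Q z) (h : GZNondeg (Γ z) (Q z)) :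
    ContDiffAt ℝ r (fun y => gzPoint (Γ y) (Q y)) z := by
  have hg := hΓ.gzG hQ h
  refine ((hg.matrixInv h.isUnit_det_gzG).matrixMul ?_).matrixMul hg
  rw [contDiffAt_matrix]
  rw [contDiffAt_pi] at hΓ
  intro i j
  by_cases e : i = j
  · subst e
    simpa using contDiffAt_pi.1 (hΓ (Fin.last m)) i
  · simpa [Matrix.diagonal_apply_ne _ e] using contDiffAt_const

end Smooth

open Topology Filter

/-! ### The parametrization is a homeomorphism onto the cover -/

section Homeo

variable {m : ℕ} {lam : Fin (m + 1) → ℝ}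

theorem continuous_minorA {N k : ℕ} (hk : k ≤ N) :
    Continuous fun p : Matrix (Fin N) (Fin N) ℝ × ℝ => minorA p.1 k hk p.2 := by
  unfold minorA corner lax
  fun_prop

theorem continuous_minorC (i : Fin m) :
    Continuous fun p : Matrix (Fin (m + 1)) (Fin (m + 1)) ℝ × ℝ => minorC p.1 i p.2 := by
  unfold minorC corner lax
  fun_prop

/-- `Q_{nj} = -c_n(γ_{nj}) a_{n-1}(γ_{nj})⁻¹`. -/
def gzQ (u : Matrix (Fin (m + 1)) (Fin (m + 1)) ℝ) (Γ : GZArray (m + 1)) : GZArray m :=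
  fun i j => -(minorC u i (Γ i.castSucc j) * (minorA u i.1 (Fin.val_le_succ i) (Γ i.castSucc j))⁻¹)

theorem gzQ_gzPoint {Γ : GZArray (m + 1)} {Q : GZArray m} (h : (Γ, Q) ∈ gzCoord lam) :
    gzQ (gzPoint Γ Q) Γ = Q := by
  have hn : GZNondeg Γ Q := h.2
  funext i j
  have := minorA_ne_zero_of_mem_gzCover (gzPoint_mem_gzCover h) i j
  rw [gzQ, hn.minorC_gzPoint]
  field_simp

/-- Reconstruction yields some `Q`, and the formula with `minorC` forces it to be `gzQ u Γ`. So the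
explicit, visibly continuous expression is the inverse map. -/
theorem gzNondeg_gzQ {u : Matrix (Fin (m + 1)) (Fin (m + 1)) ℝ} {Γ : GZArray (m + 1)}
    (hlam : Function.Injective lam) (h : (u, Γ) ∈ gzCover lam) :
    (Γ, gzQ u Γ) ∈ gzCoord lam ∧ gzPoint Γ (gzQ u Γ) = u := by
  obtain ⟨Q, hQ, e⟩ := (separated_of_mem_gzCover h).exists_gzPoint_eq h.2
  change gzPoint Γ Q = u at e
  subst e
  have hm : (Γ, Q) ∈ gzCoord lam := ⟨last_of_mem_gzCover hlam h, hQ⟩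
  rw [gzQ_gzPoint hm]
  exact ⟨hm, rfl⟩

theorem continuous_gzQ : Continuous fun p : gzCover lam => gzQ p.1.1 p.1.2 := by
  refine continuous_pi fun i => continuous_pi fun j => ?_
  have h1 : Continuous fun p : gzCover lam => (p.1.1, p.1.2 i.castSucc j) := by fun_prop
  exact (((continuous_minorC i).comp h1).mul (((continuous_minorA _).comp h1).inv₀
    fun p => minorA_ne_zero_of_mem_gzCover p.2 i j)).neg

theorem continuous_gzPoint_gzCoord : Continuous fun x : gzCoord lam => gzPoint x.1.1 x.1.2 := by
  rw [continuous_iff_continuousAt]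
  intro x
  have h1 : ContDiffAt ℝ 0 (fun z : GZArray (m + 1) × GZArray m => gzPoint z.1 z.2) x.1 :=
    contDiffAt_fst.gzPoint contDiffAt_snd x.2.2
  exact h1.continuousAt.comp continuous_subtype_val.continuousAt

/-- The parametrization of the cover by the coordinates `(γ, Q)`. -/
def gzHomeo (hlam : Function.Injective lam) : gzCoord lam ≃ₜ gzCover lam where
  toFun x := ⟨(gzPoint x.1.1 x.1.2, x.1.1), gzPoint_mem_gzCover x.2⟩
  invFun p := ⟨(p.1.2, gzQ p.1.1 p.1.2), (gzNondeg_gzQ hlam p.2).1⟩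
  left_inv x := Subtype.ext (Prod.ext rfl (gzQ_gzPoint x.2))
  right_inv p := Subtype.ext (Prod.ext (gzNondeg_gzQ hlam p.2).2 rfl)
  continuous_toFun := (continuous_gzPoint_gzCoord.prodMk
    (continuous_fst.comp continuous_subtype_val)).subtype_mk _
  continuous_invFun := ((continuous_snd.comp continuous_subtype_val).prodMk
    continuous_gzQ).subtype_mk _

theorem minorB_ne_zero_of_mem_gzCover (hlam : Function.Injective lam)
    {u : Matrix (Fin (m + 1)) (Fin (m + 1)) ℝ}
    {Γ : GZArray (m + 1)} (h : (u, Γ) ∈ gzCover lam) (i : Fin m) (j : Fin (i.1 + 1)) :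
    minorB u i (Γ i.castSucc j) ≠ 0 ∧
      gzQ u Γ i j = (minorB u i (Γ i.castSucc j))⁻¹ * minorA u (i.1 + 2) (by omega)
        (Γ i.castSucc j) := by
  have h1 := minorA_succ_ne_zero_of_mem_gzCover h i j
  obtain ⟨h2, h3⟩ := gzNondeg_gzQ hlam h
  have hn : GZNondeg Γ (gzQ u Γ) := h2.2
  have h4 := hn.minorA_gzPoint_eq_mul_minorB i j
  rw [h3] at h4
  have h5 : minorB u i (Γ i.castSucc j) ≠ 0 := fun h0 => h1 (by rw [h4, h0, mul_zero])
  refine ⟨h5, ?_⟩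
  rw [h4]
  field_simp

/-- Sample coordinates show that the open part is not empty. -/
theorem openPart_nonempty (hlam : Function.Injective lam) : (openPart lam).Nonempty := by
  obtain ⟨M, hM⟩ := (Set.finite_range lam).bddAbove
  -- All entries exceed the bound `M` of the eigenvalues, and the pair `(n, j)` is encoded in base
  -- `m + 1`, so they are pairwise distinct.
  let γ : GZArray m := fun n j => M + 1 + (n.1 * (m + 1) + j.1 : ℕ)
  have hinj : ∀ (n n' : Fin m) (j : Fin (n.1 + 1)) (j' : Fin (n'.1 + 1)), γ n j = γ n' j' →
      n.1 = n'.1 ∧ j.1 = j'.1 := by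
    intro n n' j j' h
    have h1 : n.1 * (m + 1) + j.1 = n'.1 * (m + 1) + j'.1 := by
      have := add_left_cancel h
      exact_mod_cast this
    have hj : j.1 < m + 1 := by omega
    have hj' : j'.1 < m + 1 := by omega
    have h2 : n.1 = n'.1 := by
      have e1 : (n.1 * (m + 1) + j.1) / (m + 1) = n.1 := by
        rw [mul_comm, Nat.mul_add_div (by omega), Nat.div_eq_of_lt hj, add_zero]
      have e2 : (n'.1 * (m + 1) + j'.1) / (m + 1) = n'.1 := by
        rw [mul_comm, Nat.mul_add_div (by omega), Nat.div_eq_of_lt hj', add_zero]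
      rw [← e1, h1, e2]
    have h3 : n.1 * (m + 1) = n'.1 * (m + 1) := by rw [h2]
    rw [h3] at h1
    exact ⟨h2, Nat.add_left_cancel h1⟩
  have hgt : ∀ n j k, lam k ≠ γ n j := fun n j k h => by
    have h1 : lam k ≤ M := hM ⟨k, rfl⟩
    have h2 : (0 : ℝ) ≤ (n.1 * (m + 1) + j.1 : ℕ) := Nat.cast_nonneg _
    have h3 : γ n j = M + 1 + (n.1 * (m + 1) + j.1 : ℕ) := rfl
    linarith
  have e1 : GZArray.complete lam γ (Fin.last m) = lam :=
    Fin.snoc_last (α := fun n : Fin (m + 1) => Fin (n.1 + 1) → ℝ) _ _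
  have e2 : ∀ i : Fin m, GZArray.complete lam γ i.castSucc = γ i := fun i =>
    Fin.snoc_castSucc (α := fun n : Fin (m + 1) => Fin (n.1 + 1) → ℝ) _ _ _
  have h : GZNondeg (GZArray.complete lam γ) (fun _ _ => 1) := by
    refine ⟨fun n => ?_, fun i j k => ?_, fun _ _ => one_ne_zero⟩
    · refine Fin.lastCases ?_ (fun n => ?_) n
      · rw [e1]
        exact hlam
      · rw [e2]
        exact fun j j' hj => Fin.ext (hinj _ _ _ _ hj).2
    · rw [e2]
      by_cases hi : i.1 + 1 = m
      · obtain ⟨m, rfl⟩ : ∃ k, m = k + 1 := ⟨_, hi.symm⟩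
        obtain rfl : i = Fin.last m := Fin.ext (Nat.succ_injective hi)
        have : GZArray.complete lam γ (Fin.last m).succ = lam := e1
        rw [this]
        exact hgt _ _ _
      · have : GZArray.complete lam γ i.succ = γ ⟨i.1 + 1, by omega⟩ := e2 ⟨i.1 + 1, by omega⟩
        rw [this]
        intro h
        have := (hinj _ _ _ _ h).1
        simp at this
  exact ⟨_, (gzPoint_mem_gzCover (Q := fun _ _ => 1) ⟨⟨1, e1⟩, h⟩).1⟩

end Homeo

/-! ### Continuity of the roots -/

section Roots

theorem eval_charpoly_eq_det_lax {k : ℕ} (A : Matrix (Fin k) (Fin k) ℝ) (x : ℝ) :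
    A.charpoly.eval x = (lax A x).det := by
  rw [Matrix.eval_charpoly, lax, Matrix.scalar_apply, Matrix.smul_one_eq_diagonal]

theorem det_lax_eq_prod_of_roots {k : ℕ} {A : Matrix (Fin k) (Fin k) ℝ} {γ : Fin k → ℝ}
    (hγ : Function.Injective γ) (h : ∀ j, (lax A (γ j)).det = 0) (x : ℝ) :
    (lax A x).det = ∏ j, (x - γ j) := by
  have e : A.charpoly = Lagrange.nodal Finset.univ γ := by
    refine Polynomial.eq_of_degree_sub_lt_of_eval_index_eq (v := γ) Finset.univ hγ.injOn ?_ ?_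
    · have h1 : A.charpoly.degree = k := by
        rw [Matrix.charpoly_degree_eq_dim, Fintype.card_fin]
      have h2 : (Lagrange.nodal Finset.univ γ).degree = k := by
        rw [Lagrange.degree_nodal]
        simp
      rw [Finset.card_univ, Fintype.card_fin, ← h1]
      exact Polynomial.degree_sub_lt_left (h1.trans h2.symm) A.charpoly_monic.ne_zero
        (A.charpoly_monic.leadingCoeff.trans Lagrange.nodal_monic.leadingCoeff.symm)
    · intro j hj
      rw [eval_charpoly_eq_det_lax, h, Lagrange.eval_nodal_at_node hj]
  rw [← eval_charpoly_eq_det_lax, e, Lagrange.eval_nodal]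

/-- A simple real root is detected by a sign change, which survives small perturbations. The `k`
disjoint intervals around the old roots then contain `k` distinct roots of a monic polynomial of
degree `k`, that is, all of them; in particular they stay real. -/
theorem eventually_exists_roots_near {N k : ℕ} (hk : k ≤ N) {u₀ : Matrix (Fin N) (Fin N) ℝ}
    {γ : Fin k → ℝ} (hγ : Function.Injective γ)
    (h : ∀ x, minorA u₀ k hk x = ∏ j, (x - γ j)) {ε : ℝ} (hε : 0 < ε) :
    ∀ᶠ u in 𝓝 u₀, ∃ γ' : Fin k → ℝ, (∀ j, |γ' j - γ j| < ε) ∧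
      ∀ x, minorA u k hk x = ∏ j, (x - γ' j) := by
  obtain ⟨δ, hδ0, hδε, hδ⟩ : ∃ δ > 0, δ < ε ∧ ∀ i j, i ≠ j → 2 * δ < |γ i - γ j| := by
    have h1 : ∀ᶠ δ in 𝓝[>] (0 : ℝ), ∀ i j, i ≠ j → 2 * δ < |γ i - γ j| := by
      refine eventually_all.2 fun i => eventually_all.2 fun j => ?_
      by_cases hij : i = j
      · simp [hij]
      · have h2 : 0 < |γ i - γ j| := abs_pos.2 (sub_ne_zero.2 (hγ.ne hij))
        have h3 : Tendsto (fun δ : ℝ => 2 * δ) (𝓝[>] 0) (𝓝 0) := by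
          have : Tendsto (fun δ : ℝ => 2 * δ) (𝓝 0) (𝓝 (2 * 0)) := tendsto_id.const_mul 2
          rw [mul_zero] at this
          exact this.mono_left nhdsWithin_le_nhds
        filter_upwards [h3.eventually_lt_const h2] with δ hδ _ using hδ
    have h2 : ∀ᶠ δ in 𝓝[>] (0 : ℝ), δ < ε := nhdsWithin_le_nhds (eventually_lt_nhds hε)
    obtain ⟨δ, ⟨h3, h4⟩, h5⟩ := ((h1.and h2).and self_mem_nhdsWithin).exists
    exact ⟨δ, h5, h4, h3⟩
  -- The product is `∏_s ((γ_j - γ_s)² - δ²)`, in which only the factor `s = j` is negative.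
  have hsign : ∀ j, minorA u₀ k hk (γ j + δ) * minorA u₀ k hk (γ j - δ) < 0 := by
    intro j
    rw [h, h, ← Finset.prod_mul_distrib, ← Finset.mul_prod_erase _ _ (Finset.mem_univ j)]
    refine mul_neg_of_neg_of_pos (by nlinarith) (Finset.prod_pos fun s hs => ?_)
    have h1 := hδ j s (Finset.ne_of_mem_erase hs).symm
    have h2 : δ ^ 2 < |γ j - γ s| ^ 2 := by
      refine pow_lt_pow_left₀ ?_ hδ0.le two_ne_zero
      linarith
    rw [sq_abs] at h2
    nlinarith
  have hc : ∀ x, Continuous fun u : Matrix (Fin N) (Fin N) ℝ => minorA u k hk x := fun x =>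
    (continuous_minorA hk).comp (continuous_id.prodMk continuous_const)
  have hev : ∀ᶠ u in 𝓝 u₀, ∀ j, minorA u k hk (γ j + δ) * minorA u k hk (γ j - δ) < 0 :=
    eventually_all.2 fun j => (((hc _).mul (hc _)).tendsto u₀).eventually_lt_const (hsign j)
  filter_upwards [hev] with u hu
  have hroot : ∀ j, ∃ x, |x - γ j| ≤ δ ∧ minorA u k hk x = 0 := by
    intro j
    have hcx : Continuous fun x : ℝ => minorA u k hk x :=
      (continuous_minorA hk).comp (continuous_const.prodMk continuous_id)
    have h0 : (0 : ℝ) ∈ Set.uIcc (minorA u k hk (γ j - δ)) (minorA u k hk (γ j + δ)) := by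
      rw [Set.mem_uIcc]
      rcases mul_neg_iff.1 (hu j) with h1 | h1
      · exact Or.inl ⟨h1.2.le, h1.1.le⟩
      · exact Or.inr ⟨h1.1.le, h1.2.le⟩
    obtain ⟨x, hx, hx0⟩ := intermediate_value_uIcc hcx.continuousOn h0
    rw [Set.uIcc_of_le (by linarith), Set.mem_Icc] at hx
    exact ⟨x, abs_le.2 ⟨by linarith [hx.1], by linarith [hx.2]⟩, hx0⟩
  choose γ' h1 h2 using hroot
  refine ⟨γ', fun j => (h1 j).trans_lt hδε, fun x => ?_⟩
  have hinj : Function.Injective γ' := by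
    intro i j hij
    by_contra hne
    have h3 := hδ i j hne
    have h4 : |γ i - γ j| ≤ |γ' i - γ i| + |γ' j - γ j| := by
      rw [abs_sub_comm (γ' i)]
      have e : γ i - γ j = (γ i - γ' i) + (γ' j - γ j) := by rw [hij]; ring
      rw [e]
      exact abs_add_le _ _
    linarith [h1 i, h1 j]
  rw [minorA_eq_det_lax_corner]
  refine det_lax_eq_prod_of_roots hinj (fun j => ?_) x
  rw [← minorA_eq_det_lax_corner, h2]

theorem isOpen_setOf_gzSeparated {m : ℕ} : IsOpen {Γ : GZArray (m + 1) | GZSeparated Γ} := by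
  have e : {Γ : GZArray (m + 1) | GZSeparated Γ} =
      (⋂ (n : Fin (m + 1)) (j : Fin (n.1 + 1)) (k : Fin (n.1 + 1)),
        {Γ | j ≠ k → Γ n j ≠ Γ n k}) ∩
      ⋂ (i : Fin m) (j : Fin (i.succ.1 + 1)) (k : Fin (i.castSucc.1 + 1)),
        {Γ | Γ i.succ j ≠ Γ i.castSucc k} := by
    ext Γ
    simp only [Set.mem_inter_iff, Set.mem_iInter, Set.mem_ofPred_eq]
    exact ⟨fun h => ⟨fun n j k hjk => (h.same_level n).ne hjk, h.consecutive⟩,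
      fun h => ⟨fun n j k hjk => not_imp_not.1 (h.1 n j k) hjk, h.2⟩⟩
  rw [e]
  refine IsOpen.inter ?_ ?_
  · refine isOpen_iInter_of_finite fun n => isOpen_iInter_of_finite fun j =>
      isOpen_iInter_of_finite fun k => ?_
    by_cases hjk : j = k
    · simp [hjk]
    · simp only [hjk, ne_eq, not_false_eq_true, forall_const]
      exact isOpen_ne_fun (by fun_prop) (by fun_prop)
  · exact isOpen_iInter_of_finite fun i => isOpen_iInter_of_finite fun j =>
      isOpen_iInter_of_finite fun k => isOpen_ne_fun (by fun_prop) (by fun_prop)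

variable {m : ℕ} {lam : Fin (m + 1) → ℝ}

/-- Near a point of the open part of the orbit, the ordered roots of the principal minors can be
chosen close to the given ones. -/
theorem eventually_exists_mem_gzCover {u₀ : Matrix (Fin (m + 1)) (Fin (m + 1)) ℝ}
    {Γ : GZArray (m + 1)} (h : (u₀, Γ) ∈ gzCover lam) {W : Set (GZArray (m + 1))}
    (hW : W ∈ 𝓝 Γ) :
    ∀ᶠ u in 𝓝 u₀, u ∈ coadjointOrbit lam → ∃ Γ' ∈ W, (u, Γ') ∈ gzCover lam := by
  have hs := separated_of_mem_gzCover h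
  obtain ⟨ε, hε, hball⟩ := Metric.mem_nhds_iff.1
    (Filter.inter_mem hW (isOpen_setOf_gzSeparated.mem_nhds hs))
  have hev : ∀ᶠ u in 𝓝 u₀, ∀ n : Fin (m + 1), ∃ γ' : Fin (n.1 + 1) → ℝ,
      (∀ j, |γ' j - Γ n j| < ε) ∧ ∀ x, minorA u (n.1 + 1) n.isLt x = ∏ j, (x - γ' j) :=
    eventually_all.2 fun n => eventually_exists_roots_near _ (hs.same_level n) (h.2 n) hε
  filter_upwards [hev] with u hu huo
  choose Γ' h1 h2 using hu
  have hmem : Γ' ∈ Metric.ball Γ ε := by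
    rw [Metric.mem_ball, dist_pi_lt_iff hε]
    intro n
    rw [dist_pi_lt_iff hε]
    exact fun j => h1 n j
  exact ⟨Γ', (hball hmem).1, mem_gzCover_iff.2 ⟨huo, (hball hmem).2, h2⟩⟩

theorem isOpen_openPart :
    IsOpen {u : coadjointOrbit lam |
      (u : Matrix (Fin (m + 1)) (Fin (m + 1)) ℝ) ∈ openPart lam} := by
  rw [isOpen_iff_mem_nhds]
  intro u hu
  obtain ⟨Γ, hΓ⟩ := exists_mem_gzCover hu
  have h1 := eventually_exists_mem_gzCover hΓ univ_mem
  have h2 := (continuous_subtype_val (p := (· ∈ coadjointOrbit lam))).continuousAt.eventually h1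
  filter_upwards [h2] with v hv
  obtain ⟨Γ', _, h⟩ := hv v.2
  exact h.1

theorem continuous_proj : Continuous (gzCover.proj lam) :=
  (continuous_fst.comp continuous_subtype_val).subtype_mk _

/-- Nearby points of the open part lift to nearby points of the cover. -/
theorem isOpenMap_proj : IsOpenMap (gzCover.proj lam) := by
  rw [isOpenMap_iff_nhds_le]
  intro p s hs
  rw [mem_map, mem_nhds_induced] at hs
  obtain ⟨t, ht, hts⟩ := hs
  obtain ⟨V, hV, W, hW, hVW⟩ := mem_nhds_prod_iff.1 ht
  have h1 : ∀ᶠ u in 𝓝 p.1.1, u ∈ coadjointOrbit lam → ∃ Γ' ∈ W, (u, Γ') ∈ gzCover lam :=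
    eventually_exists_mem_gzCover p.2 hW
  have h2 := h1.and hV
  have h3 : Tendsto (Subtype.val : openPart lam → _) (𝓝 (gzCover.proj lam p)) (𝓝 p.1.1) :=
    continuous_subtype_val.continuousAt
  filter_upwards [h3.eventually h2] with u hu
  obtain ⟨Γ', hΓ', hm⟩ := hu.1 u.2.1
  exact hts (a := ⟨(u.1, Γ'), hm⟩) (hVW ⟨hu.2, hΓ'⟩)

theorem surjective_proj : Function.Surjective (gzCover.proj lam) := fun u => by
  obtain ⟨Γ, h⟩ := exists_mem_gzCover u.2
  exact ⟨⟨(u.1, Γ), h⟩, rfl⟩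

end Roots

/-! ### Covering maps -/

section Covering

/-- For each `g ≠ 1` the Hausdorff property separates `g • x` from `x`; finiteness of `G` allows
intersecting the resulting neighbourhoods. -/
theorem exists_nhds_disjoint_smul {G X : Type*} [Group G] [Finite G] [TopologicalSpace X]
    [T2Space X] [MulAction G X] (hc : ∀ g : G, Continuous fun x : X => g • x)
    (hfree : ∀ (g : G) (x : X), g • x = x → g = 1) (x : X) :
    ∃ U ∈ 𝓝 x, ∀ g : G, ((g • ·) '' U ∩ U).Nonempty → g = 1 := by
  have h1 : ∀ g : G, ∃ U ∈ 𝓝 x, ((g • ·) '' U ∩ U).Nonempty → g = 1 := by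
    intro g
    by_cases hg : g = 1
    · exact ⟨Set.univ, univ_mem, fun _ => hg⟩
    · obtain ⟨A, B, hA, hB, hxA, hxB, hAB⟩ := t2_separation fun h => hg (hfree g x h)
      refine ⟨(g • ·) ⁻¹' A ∩ B, inter_mem ((hA.preimage (hc g)).mem_nhds hxA)
        (hB.mem_nhds hxB), ?_⟩
      rintro ⟨_, ⟨z, hz, rfl⟩, hz'⟩
      exact (Set.disjoint_left.1 hAB hz.1 hz'.2).elim
  choose U hU h using h1
  refine ⟨⋂ g, U g, iInter_mem.2 hU, fun g hg => h g (hg.mono ?_)⟩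
  exact Set.inter_subset_inter (Set.image_mono (Set.iInter_subset _ _)) (Set.iInter_subset _ _)

instance LevelPerm.instFinite (k : ℕ) : Finite (LevelPerm k) :=
  inferInstanceAs (Finite (∀ n : Fin k, Equiv.Perm (Fin (n.1 + 1))))

theorem continuous_permute {k : ℕ} (σ : LevelPerm k) : Continuous (GZArray.permute σ) := by
  unfold GZArray.permute
  fun_prop

theorem LevelPerm.eq_one_of_permute_eq {k : ℕ} {σ : LevelPerm k} {Γ : GZArray k}
    (hΓ : ∀ n, Function.Injective (Γ n)) (h : GZArray.permute σ Γ = Γ) : σ = 1 := by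
  refine funext fun n => ?_
  have h1 : (σ n)⁻¹ = 1 := Equiv.ext fun j => hΓ n (congrFun (congrFun h n) j)
  exact inv_eq_one.1 h1

variable {m : ℕ} {lam : Fin (m + 1) → ℝ}

theorem gzCover_smul_free (σ : LevelPerm (m + 1)) (p : gzCover lam) (h : σ • p = p) : σ = 1 :=
  LevelPerm.eq_one_of_permute_eq (separated_of_mem_gzCover p.2).same_level
    (congrArg (fun q : gzCover lam => q.1.2) h)

theorem exists_permute_eq_of_mem_gzCover {u : Matrix (Fin (m + 1)) (Fin (m + 1)) ℝ}
    {Γ Γ' : GZArray (m + 1)} (h : (u, Γ) ∈ gzCover lam) (h' : (u, Γ') ∈ gzCover lam) :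
    ∃ σ, GZArray.permute σ Γ = Γ' := by
  have h1 : ∀ n, ∃ σ : Equiv.Perm (Fin (n.1 + 1)), Γ' n = Γ n ∘ σ := fun n =>
    exists_perm_of_prod_sub_eq ((separated_of_mem_gzCover h).same_level n) fun x =>
      (h.2 n x).symm.trans (h'.2 n x)
  choose σ hσ using h1
  refine ⟨fun n => (σ n)⁻¹, funext fun n => ?_⟩
  rw [hσ]
  funext j
  simp [GZArray.permute]

theorem isQuotientCoveringMap_proj :
    IsQuotientCoveringMap (gzCover.proj lam) (LevelPerm (m + 1)) := by
  have hc : ∀ σ : LevelPerm (m + 1), Continuous fun p : gzCover lam => σ • p := fun σ =>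
    ((continuous_fst.comp continuous_subtype_val).prodMk ((continuous_permute σ).comp
      (continuous_snd.comp continuous_subtype_val))).subtype_mk _
  exact
  { isOpenMap_proj.isQuotientMap continuous_proj surjective_proj with
    continuous_const_smul := hc
    apply_eq_iff_mem_orbit := fun {p q} => by
      constructor
      · intro h
        have h1 : p.1.1 = q.1.1 := congrArg Subtype.val h
        have h2 : (q.1.1, p.1.2) ∈ gzCover lam := h1 ▸ p.2
        obtain ⟨σ, hσ⟩ := exists_permute_eq_of_mem_gzCover q.2 h2
        exact ⟨σ, Subtype.ext (Prod.ext h1.symm hσ)⟩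
      · rintro ⟨σ, rfl⟩
        rfl
    disjoint := exists_nhds_disjoint_smul hc gzCover_smul_free }

theorem gzQ_permute (u : Matrix (Fin (m + 1)) (Fin (m + 1)) ℝ) (σ : LevelPerm (m + 1))
    (Γ : GZArray (m + 1)) : gzQ u (GZArray.permute σ Γ) = GZArray.permute σ.init (gzQ u Γ) := rfl

/-- Equivariance is visible on the inverse: `gzQ` attaches to each root a value depending only on
`u` and that root, whereas the product defining `g` depends on the ordering. -/
theorem gzHomeo_smul (hlam : Function.Injective lam) (σ : LevelPerm (m + 1)) (x : gzCoord lam) :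
    gzHomeo hlam (σ • x) = σ • gzHomeo hlam x := by
  rw [← (gzHomeo hlam).symm.injective.eq_iff, Homeomorph.symm_apply_apply]
  refine Subtype.ext (Prod.ext rfl ?_)
  change GZArray.permute σ.init x.1.2 = gzQ (gzPoint x.1.1 x.1.2) (GZArray.permute σ x.1.1)
  rw [gzQ_permute, gzQ_gzPoint x.2]

/-! ### The charts with a fixed ordering of the eigenvalues -/

theorem complete_last (L : Fin (m + 1) → ℝ) (γ : GZArray m) :
    GZArray.complete L γ (Fin.last m) = L :=
  Fin.snoc_last (α := fun n : Fin (m + 1) => Fin (n.1 + 1) → ℝ) _ _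

theorem complete_castSucc (L : Fin (m + 1) → ℝ) (γ : GZArray m) (i : Fin m) :
    GZArray.complete L γ i.castSucc = γ i :=
  Fin.snoc_castSucc (α := fun n : Fin (m + 1) => Fin (n.1 + 1) → ℝ) _ _ _

theorem complete_eq (Γ : GZArray (m + 1)) :
    GZArray.complete (Γ (Fin.last m)) (GZArray.init Γ) = Γ :=
  Fin.snoc_init_self (α := fun n : Fin (m + 1) => Fin (n.1 + 1) → ℝ) Γ

theorem continuous_complete (L : Fin (m + 1) → ℝ) : Continuous (GZArray.complete L) := by
  refine continuous_pi fun n => ?_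
  refine Fin.lastCases ?_ (fun i => ?_) n
  · simpa only [complete_last] using continuous_const
  · simpa only [complete_castSucc] using continuous_apply i

variable {L : Fin (m + 1) → ℝ} (hL : ∃ τ : Equiv.Perm (Fin (m + 1)), L = lam ∘ τ)

/-- The coordinates with the last row fixed. -/
def gzDomainInclusion (y : gzDomain L) : gzCoord lam :=
  ⟨(GZArray.complete L y.1.1, y.1.2), by simpa only [complete_last] using hL, y.2⟩

theorem range_gzDomainInclusion :
    Set.range (gzDomainInclusion hL) = {x | x.1.1 (Fin.last m) = L} := by
  ext x
  constructor
  · rintro ⟨y, rfl⟩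
    exact complete_last L _
  · intro hx
    have e : GZArray.complete L (GZArray.init x.1.1) = x.1.1 := by
      have hx' : x.1.1 (Fin.last m) = L := hx
      rw [← hx', complete_eq]
    have hm : ((GZArray.init x.1.1), x.1.2) ∈ gzDomain L := by
      change GZNondeg (GZArray.complete L (GZArray.init x.1.1)) x.1.2
      rw [e]
      exact x.2.2
    exact ⟨⟨_, hm⟩, Subtype.ext (Prod.ext e rfl)⟩

theorem isOpenEmbedding_gzDomainInclusion : IsOpenEmbedding (gzDomainInclusion hL) := by
  have hcont : Continuous (gzDomainInclusion hL) :=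
    (((continuous_complete L).comp (continuous_fst.comp continuous_subtype_val)).prodMk
      (continuous_snd.comp continuous_subtype_val)).subtype_mk _
  have hr : Continuous fun x : gzCoord lam =>
      ((GZArray.init x.1.1, x.1.2) : GZArray m × GZArray m) := by
    unfold GZArray.init
    fun_prop
  have hcomp : (fun x : gzCoord lam =>
      ((GZArray.init x.1.1, x.1.2) : GZArray m × GZArray m)) ∘ gzDomainInclusion hL =
      Subtype.val := by
    funext y
    refine Prod.ext (funext fun i => ?_) rfl
    exact complete_castSucc L _ i
  have hind : IsInducing (gzDomainInclusion hL) := by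
    refine IsInducing.of_comp hcont hr ?_
    rw [hcomp]
    exact IsInducing.subtypeVal
  have hinj : Function.Injective (gzDomainInclusion hL) := by
    refine Function.Injective.of_comp (f := fun x : gzCoord lam =>
      ((GZArray.init x.1.1, x.1.2) : GZArray m × GZArray m)) ?_
    rw [hcomp]
    exact Subtype.val_injective
  refine ⟨⟨hind, hinj⟩, ?_⟩
  rw [range_gzDomainInclusion]
  -- The last row takes finitely many values on `gzCoord lam`, so fixing it is an open condition:
  -- the other orderings form a closed set.
  have hfin : (Set.range fun τ : Equiv.Perm (Fin (m + 1)) => lam ∘ τ).Finite := Set.finite_range _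
  have hcl : IsClosed ((Set.range fun τ : Equiv.Perm (Fin (m + 1)) => lam ∘ τ) \ {L}) :=
    (hfin.subset Set.sdiff_subset).isClosed
  have hl : Continuous fun x : gzCoord lam => x.1.1 (Fin.last m) := by fun_prop
  convert (hcl.preimage hl).isOpen_compl using 1
  ext x
  obtain ⟨τ, hτ⟩ := x.2.1
  have : x.1.1 (Fin.last m) ∈ Set.range fun τ : Equiv.Perm (Fin (m + 1)) => lam ∘ τ := ⟨τ, hτ.symm⟩
  simp only [Set.mem_ofPred_eq, Set.mem_compl_iff, Set.mem_preimage, Set.mem_sdiff, this,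
    Set.mem_singleton_iff, true_and, not_not]

theorem mapsTo_gzChart (hL : ∃ τ : Equiv.Perm (Fin (m + 1)), L = lam ∘ τ) :
    Set.MapsTo (gzChart L) (gzDomain L) (openPart lam) := fun y hy =>
  (gzPoint_mem_gzCover (gzDomainInclusion hL ⟨y, hy⟩).2).1

theorem surjective_restrict_gzChart (hlam : Function.Injective lam) :
    Function.Surjective ((mapsTo_gzChart hL).restrict (gzChart L) (gzDomain L) (openPart lam)) := by
  rintro ⟨u, hu⟩
  obtain ⟨Γ, hΓ⟩ := exists_mem_gzCover hu
  obtain ⟨τ, hτ⟩ := last_of_mem_gzCover hlam hΓ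
  obtain ⟨τ', hτ'⟩ := hL
  -- Chosen so that reordering the last row `lam ∘ τ` by `ρ` gives `lam ∘ τ' = L`; the other rows
  -- stay as they are.
  let ρ : Equiv.Perm (Fin (m + 1)) := (τ⁻¹ * τ')⁻¹
  let σ : LevelPerm (m + 1) := Fin.snoc (α := fun n : Fin (m + 1) => Equiv.Perm (Fin (n.1 + 1)))
    (fun _ => 1) ρ
  have hσ : σ (Fin.last m) = ρ :=
    Fin.snoc_last (α := fun n : Fin (m + 1) => Equiv.Perm (Fin (n.1 + 1))) _ _
  let p : gzCover lam := σ • ⟨(u, Γ), hΓ⟩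
  have hp : p.1.2 (Fin.last m) = L := by
    have e : p.1.2 (Fin.last m) = Γ (Fin.last m) ∘ ((σ (Fin.last m))⁻¹ : Equiv.Perm _) := rfl
    rw [e, hσ, hτ, hτ']
    funext j
    simp [ρ]
  have hx : (gzHomeo hlam).symm p ∈ Set.range (gzDomainInclusion (lam := lam) ⟨τ', hτ'⟩) := by
    rw [range_gzDomainInclusion]
    exact hp
  obtain ⟨y, hy⟩ := hx
  refine ⟨y, Subtype.ext ?_⟩
  have h1 := congrArg (gzHomeo hlam) hy
  rw [Homeomorph.apply_symm_apply] at h1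
  exact congrArg (fun p : gzCover lam => p.1.1) h1

/-- The chart is the projection of the cover restricted to the open piece with last row `L`. Since
the entries of `L` are distinct, only permutations trivial on the last row can relate two points of
this piece, which leaves the group of the first `m` levels. -/
theorem isQuotientCoveringMap_gzChart (hlam : Function.Injective lam) :
    IsQuotientCoveringMap
      ((mapsTo_gzChart hL).restrict (gzChart L) (gzDomain L) (openPart lam)) (LevelPerm m) := by
  have hf : (mapsTo_gzChart hL).restrict (gzChart L) (gzDomain L) (openPart lam) =
      gzCover.proj lam ∘ gzHomeo hlam ∘ gzDomainInclusion hL := rfl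
  have hopen : IsOpenMap ((mapsTo_gzChart hL).restrict (gzChart L) (gzDomain L)
      (openPart lam)) := by
    rw [hf]
    exact isOpenMap_proj.comp ((gzHomeo hlam).isOpenMap.comp
      (isOpenEmbedding_gzDomainInclusion hL).isOpenMap)
  have hcont : Continuous ((mapsTo_gzChart hL).restrict (gzChart L) (gzDomain L)
      (openPart lam)) := by
    rw [hf]
    exact continuous_proj.comp ((gzHomeo hlam).continuous.comp
      (isOpenEmbedding_gzDomainInclusion hL).continuous)
  have hc : ∀ σ : LevelPerm m, Continuous fun y : gzDomain L => σ • y := fun σ =>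
    (((continuous_permute σ).comp (continuous_fst.comp continuous_subtype_val)).prodMk
      ((continuous_permute σ).comp (continuous_snd.comp continuous_subtype_val))).subtype_mk _
  exact
  { hopen.isQuotientMap hcont (surjective_restrict_gzChart hL hlam) with
    continuous_const_smul := hc
    apply_eq_iff_mem_orbit := fun {y z} => by
      have hsm : ∀ (σ : LevelPerm m) (z : gzDomain L),
          gzDomainInclusion hL (σ • z) = σ.extend • gzDomainInclusion hL z := fun σ z =>
        Subtype.ext (Prod.ext (GZArray.complete_permute L σ z.1.1) (by
          change GZArray.permute σ z.1.2 = GZArray.permute σ.extend.init z.1.2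
          rw [LevelPerm.init_extend]))
      rw [hf]
      simp only [Function.comp_apply]
      rw [isQuotientCoveringMap_proj.apply_eq_iff_mem_orbit]
      constructor
      · rintro ⟨σ, hσ⟩
        have h1 : σ • gzDomainInclusion hL z = gzDomainInclusion hL y :=
          (gzHomeo hlam).injective (by rw [gzHomeo_smul]; exact hσ)
        have hl : σ (Fin.last m) = 1 := by
          have h2 : ∀ j, L ((σ (Fin.last m))⁻¹ j) = L j := fun j => by
            have h3 := congrFun (congrFun (congrArg (fun x : gzCoord lam => x.1.1) h1)
              (Fin.last m)) j
            change GZArray.complete L z.1.1 (Fin.last m) ((σ (Fin.last m))⁻¹ j) =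
              GZArray.complete L y.1.1 (Fin.last m) j at h3
            rwa [complete_last, complete_last] at h3
          have hLi : Function.Injective L := by
            obtain ⟨τ, rfl⟩ := hL
            exact hlam.comp τ.injective
          exact inv_eq_one.1 (Equiv.ext fun j => hLi (h2 j))
        have he : σ.init.extend = σ := by
          funext n
          refine Fin.lastCases ?_ (fun i => ?_) n
          · rw [LevelPerm.extend_last, hl]
          · rw [LevelPerm.extend_castSucc]
            rfl
        refine ⟨σ.init, (isOpenEmbedding_gzDomainInclusion hL).injective ?_⟩
        rw [← h1]
        conv_rhs => rw [← he]
        exact hsm _ _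
      · rintro ⟨σ, rfl⟩
        refine ⟨σ.extend, ?_⟩
        change _ = gzHomeo hlam (gzDomainInclusion hL (σ • z))
        rw [hsm, gzHomeo_smul]
    disjoint := exists_nhds_disjoint_smul hc fun σ y h =>
      LevelPerm.eq_one_of_permute_eq (Γ := y.1.1) (fun n => by
        have := GZNondeg.same_level (Γ := GZArray.complete L y.1.1) y.2 n.castSucc
        rwa [complete_castSucc] at this)
        (congrArg (fun z : gzDomain L => z.1.1) h) }

end Covering

/-! ### Openness of the domain and smoothness of the charts -/

section Chart

open scoped ContDiff

variable {m : ℕ} (L : Fin (m + 1) → ℝ)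

theorem isOpen_gzDomain : IsOpen (gzDomain L) := by
  have e : gzDomain L = (fun y => GZArray.complete L y.1) ⁻¹' {Γ | GZSeparated Γ} ∩
      ⋂ (i : Fin m) (j : Fin (i.1 + 1)), {y | y.2 i j ≠ 0} := by
    ext y
    simp only [Set.mem_inter_iff, Set.mem_iInter]
    exact ⟨fun h => ⟨GZNondeg.separated h, GZNondeg.Q_ne h⟩,
      fun h => ⟨h.1.same_level, h.1.consecutive, h.2⟩⟩
  rw [e]
  refine (isOpen_setOf_gzSeparated.preimage ((continuous_complete L).comp continuous_fst)).inter ?_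
  exact isOpen_iInter_of_finite fun i => isOpen_iInter_of_finite fun j =>
    isOpen_ne_fun (by fun_prop) continuous_const

theorem contDiff_complete {r : ℕ∞ω} :
    ContDiff ℝ r fun y : GZArray m × GZArray m => GZArray.complete L y.1 := by
  refine contDiff_pi.2 fun n => ?_
  refine Fin.lastCases ?_ (fun i => ?_) n
  · simpa only [complete_last] using contDiff_const
  · simp only [complete_castSucc]
    exact contDiff_pi.1 contDiff_fst i

variable {L} {y : GZArray m × GZArray m} {r : ℕ∞ω}

theorem contDiffAt_gzG (hy : y ∈ gzDomain L) :
    ContDiffAt ℝ r (fun y : GZArray m × GZArray m => gzG (GZArray.complete L y.1) y.2) y :=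
  ContDiffAt.gzG (contDiff_complete L).contDiffAt contDiffAt_snd hy

theorem contDiffAt_gzChart (hy : y ∈ gzDomain L) : ContDiffAt ℝ r (gzChart L) y :=
  ContDiffAt.gzPoint (contDiff_complete L).contDiffAt contDiffAt_snd hy

end Chart

/-! ### The one-form `Tr diag(a) df f⁻¹` -/

section OneForm

theorem hasDerivAt_finsetProd_log {ι : Type*} (s : Finset ι) {f : ι → ℝ → ℝ} {f' : ι → ℝ} {x : ℝ}
    (hf : ∀ i ∈ s, HasDerivAt (f i) (f' i) x) (h0 : ∀ i ∈ s, f i x ≠ 0) :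
    HasDerivAt (fun y => ∏ i ∈ s, f i y) ((∏ i ∈ s, f i x) * ∑ i ∈ s, f' i / f i x) x := by
  classical
  induction s using Finset.induction_on with
  | empty => simpa using hasDerivAt_const x (1 : ℝ)
  | insert i s hi ih =>
    have h1 := (hf i (Finset.mem_insert_self i s)).fun_mul
      (ih (fun j hj => hf j (Finset.mem_insert_of_mem hj))
        fun j hj => h0 j (Finset.mem_insert_of_mem hj))
    have h2 := h0 i (Finset.mem_insert_self i s)
    simp only [Finset.prod_insert hi, Finset.sum_insert hi]
    refine h1.congr_deriv ?_
    field_simp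

theorem HasDerivAt.div_log {f g : ℝ → ℝ} {p q x : ℝ} (hf : HasDerivAt f (f x * p) x)
    (hg : HasDerivAt g (g x * q) x) (h0 : g x ≠ 0) :
    HasDerivAt (fun y => f y / g y) (f x / g x * (p - q)) x := by
  refine (hf.fun_div hg h0).congr_deriv ?_
  field_simp

variable {k : ℕ} {a : Fin (k + 1) → ℝ} {b q : Fin k → ℝ}

/-- The derivative of `GZRows.one_add_sum_residue` at `x = a j`, computed from the sum and,
logarithmically, from the product. The right side is the coefficient of `da_j` in the logarithmic
derivative of `gzFactor a b j`. -/
theorem GZRows.factor_mul_sum_residue_cube (h : GZRows a b) (j : Fin (k + 1)) :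
    gzFactor a b j * ∑ c, gzResidue a b c / (a j - b c) ^ 3 =
      ∑ c, 1 / (a j - b c) - ∑ s ∈ Finset.univ.erase j, 1 / (a j - a s) := by
  have h1 : HasDerivAt (fun x => 1 + ∑ c, gzResidue a b c / ((a j - b c) * (x - b c)))
      (-∑ c, gzResidue a b c / (a j - b c) ^ 3) (a j) := by
    rw [← Finset.sum_neg_distrib]
    refine (HasDerivAt.fun_sum fun c _ => ?_).const_add 1
    have h2 := h.sub_ne j c
    have h3 : HasDerivAt (fun x => (a j - b c) * (x - b c)) ((a j - b c) * 1) (a j) :=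
      ((hasDerivAt_id (a j)).sub_const (b c)).const_mul _
    refine ((hasDerivAt_const (a j) (gzResidue a b c)).fun_div h3
      (mul_ne_zero h2 h2)).congr_deriv ?_
    field_simp
    ring
  have h2 : HasDerivAt (fun x => (∏ s ∈ Finset.univ.erase j, (x - a s)) / ∏ r, (x - b r))
      ((∏ s ∈ Finset.univ.erase j, (a j - a s)) / (∏ r, (a j - b r)) *
        (∑ s ∈ Finset.univ.erase j, 1 / (a j - a s) - ∑ c, 1 / (a j - b c))) (a j) := by
    refine HasDerivAt.div_log (hasDerivAt_finsetProd_log _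
      (fun s _ => (hasDerivAt_id (a j)).sub_const (a s)) fun s hs => ?_)
      (hasDerivAt_finsetProd_log _ (fun r _ => (hasDerivAt_id (a j)).sub_const (b r))
        fun r _ => h.sub_ne j r) (Finset.prod_ne_zero_iff.2 fun r _ => h.sub_ne j r)
    exact sub_ne_zero.2 (h.inj_a.ne (Finset.ne_of_mem_erase hs).symm)
  have h3 : ∀ᶠ x in 𝓝 (a j), ∀ c, x ≠ b c :=
    eventually_all.2 fun c => isOpen_ne.mem_nhds (h.ne j c)
  have h4 := h1.unique (h2.congr_of_eventuallyEq (by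
    filter_upwards [h3] with x hx using h.one_add_sum_residue j hx))
  have h5 : ∏ r, (a j - b r) ≠ 0 := Finset.prod_ne_zero_iff.2 fun r _ => h.sub_ne j r
  have h6 := prod_erase_sub_ne_zero h.inj_a j
  rw [neg_eq_iff_eq_neg.1 h4, gzFactor]
  field_simp
  ring

theorem GZRows.residue_mul_eval (h : GZRows a b) (c : Fin k) :
    gzResidue a b c * ((∏ r ∈ Finset.univ.erase c, (b c - b r)) / ∏ j, (b c - a j)) = -1 := by
  have h5 : ∏ j, (b c - a j) ≠ 0 :=
    Finset.prod_ne_zero_iff.2 fun j _ => sub_ne_zero.2 (h.ne j c).symm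
  have h6 := prod_erase_sub_ne_zero h.inj_b c
  rw [gzResidue]
  field_simp

theorem GZRows.residue_mul_sum_factor_sq (h : GZRows a b) (c : Fin k) :
    gzResidue a b c * ∑ j, gzFactor a b j / (a j - b c) ^ 2 = 1 := by
  have h1 := h.sum_factor c fun j => (h.ne j c).symm
  have h2 := h.residue_mul_eval c
  rw [← h1] at h2
  have h3 : ∑ j, gzFactor a b j / (a j - b c) ^ 2 =
      -∑ j, gzFactor a b j / ((a j - b c) * (b c - a j)) := by
    rw [← Finset.sum_neg_distrib]
    refine Finset.sum_congr rfl fun j _ => ?_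
    rw [← neg_sub (a j) (b c), mul_neg, div_neg, neg_neg, sq]
  rw [h3, mul_neg, h2, neg_neg]

/-- The derivative of `GZRows.sum_factor` at `y = b c`, again computed in two ways. -/
theorem GZRows.residue_mul_sum_factor_cube (h : GZRows a b) (c : Fin k) :
    gzResidue a b c * ∑ j, gzFactor a b j / (a j - b c) ^ 3 =
      ∑ r ∈ Finset.univ.erase c, 1 / (b c - b r) + ∑ j, 1 / (a j - b c) := by
  have hne : ∀ j, b c - a j ≠ 0 := fun j => sub_ne_zero.2 (h.ne j c).symm
  have h1 : HasDerivAt (fun y => ∑ j, gzFactor a b j / ((a j - b c) * (y - a j)))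
      (-∑ j, gzFactor a b j / (a j - b c) ^ 3) (b c) := by
    rw [← Finset.sum_neg_distrib]
    refine HasDerivAt.fun_sum fun j _ => ?_
    have h2 := h.sub_ne j c
    have h3 : HasDerivAt (fun y => (a j - b c) * (y - a j)) ((a j - b c) * 1) (b c) :=
      ((hasDerivAt_id (b c)).sub_const (a j)).const_mul _
    refine ((hasDerivAt_const (b c) (gzFactor a b j)).fun_div h3
      (mul_ne_zero h2 (hne j))).congr_deriv ?_
    have e : b c - a j = -(a j - b c) := by ring
    rw [e]
    field_simp
    ring
  have h2 : HasDerivAt (fun y => (∏ r ∈ Finset.univ.erase c, (y - b r)) / ∏ j, (y - a j))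
      ((∏ r ∈ Finset.univ.erase c, (b c - b r)) / (∏ j, (b c - a j)) *
        (∑ r ∈ Finset.univ.erase c, 1 / (b c - b r) - ∑ j, 1 / (b c - a j))) (b c) := by
    refine HasDerivAt.div_log (hasDerivAt_finsetProd_log _
      (fun r _ => (hasDerivAt_id (b c)).sub_const (b r)) fun r hr => ?_)
      (hasDerivAt_finsetProd_log _ (fun j _ => (hasDerivAt_id (b c)).sub_const (a j))
        fun j _ => hne j) (Finset.prod_ne_zero_iff.2 fun j _ => hne j)
    exact sub_ne_zero.2 (h.inj_b.ne (Finset.ne_of_mem_erase hr).symm)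
  have h3 : ∀ᶠ y in 𝓝 (b c), ∀ j, y ≠ a j :=
    eventually_all.2 fun j => isOpen_ne.mem_nhds (h.ne j c).symm
  have h4 := h1.unique (h2.congr_of_eventuallyEq (by
    filter_upwards [h3] with y hy using h.sum_factor c hy))
  have e : ∑ j, 1 / (b c - a j) = -∑ j, 1 / (a j - b c) := by
    rw [← Finset.sum_neg_distrib]
    refine Finset.sum_congr rfl fun j _ => ?_
    rw [← neg_sub (a j) (b c), div_neg]
  rw [neg_eq_iff_eq_neg.1 h4, mul_neg, ← mul_assoc, h.residue_mul_eval, e]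
  ring

theorem hasDerivAt_matrix {N : ℕ} {f : ℝ → Matrix (Fin N) (Fin N) ℝ}
    {f' : Matrix (Fin N) (Fin N) ℝ} {s : ℝ} :
    HasDerivAt f f' s ↔ ∀ i j, HasDerivAt (fun t => f t i j) (f' i j) s :=
  (hasDerivAt_pi (E' := fun _ : Fin N => Fin N → ℝ)).trans
    (forall_congr' fun _ => hasDerivAt_pi (E' := fun _ : Fin N => ℝ))

theorem HasDerivAt.matrixMul {N : ℕ} {f g : ℝ → Matrix (Fin N) (Fin N) ℝ}
    {f' g' : Matrix (Fin N) (Fin N) ℝ} {s : ℝ} (hf : HasDerivAt f f' s) (hg : HasDerivAt g g' s) :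
    HasDerivAt (fun t => f t * g t) (f' * g s + f s * g') s := by
  rw [hasDerivAt_matrix] at *
  intro i j
  simp only [Matrix.mul_apply, Matrix.add_apply, ← Finset.sum_add_distrib]
  exact HasDerivAt.fun_sum fun l _ => (hf i l).mul (hg l j)

/-- The one-form `∑_j ∑_{s ≠ j} a_j da_s / (a_j - a_s)`. -/
def rowForm {n : ℕ} (a a' : Fin n → ℝ) : ℝ :=
  ∑ j, ∑ s ∈ Finset.univ.erase j, a j * a' s / (a j - a s)

theorem hasDerivAt_gzFactor {a : ℝ → Fin (k + 1) → ℝ} {b : ℝ → Fin k → ℝ} {a' : Fin (k + 1) → ℝ}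
    {b' : Fin k → ℝ} {s : ℝ} (ha : HasDerivAt a a' s) (hb : HasDerivAt b b' s)
    (h : GZRows (a s) (b s)) (j : Fin (k + 1)) :
    HasDerivAt (fun t => gzFactor (a t) (b t) j) (gzFactor (a s) (b s) j *
      (∑ c, (a' j - b' c) / (a s j - b s c) -
        ∑ i ∈ Finset.univ.erase j, (a' j - a' i) / (a s j - a s i))) s := by
  rw [hasDerivAt_pi] at ha hb
  refine HasDerivAt.div_log (hasDerivAt_finsetProd_log _ (fun c _ => (ha j).sub (hb c))
    fun c _ => h.sub_ne j c) (hasDerivAt_finsetProd_log _ (fun i _ => (ha j).sub (ha i))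
      fun i hi => ?_) (prod_erase_sub_ne_zero h.inj_a j)
  exact sub_ne_zero.2 (h.inj_a.ne (Finset.ne_of_mem_erase hi).symm)

/-- Each entry of `f` is differentiated logarithmically, so the trace is a combination of the
weights `f_{jc} (f⁻¹)_{cj}`, whose moments over `j` and `c` are the partial-fraction identities. The
term `rowForm` of `b` is kept on the left so that consecutive levels telescope. -/
theorem GZRows.exists_hasDerivAt_gzF {a : ℝ → Fin (k + 1) → ℝ} {b q : ℝ → Fin k → ℝ}
    {a' : Fin (k + 1) → ℝ} {b' q' : Fin k → ℝ} {s : ℝ} (ha : HasDerivAt a a' s)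
    (hb : HasDerivAt b b' s) (hq : HasDerivAt q q' s) (h : GZRows (a s) (b s))
    (hq0 : ∀ c, q s c ≠ 0) :
    ∃ F', HasDerivAt (fun t => gzF (a t) (b t) (q t)) F' s ∧
      Matrix.trace (Matrix.diagonal (a s) * F' * gzFInv (a s) (b s) (q s)) + rowForm (b s) b' =
        rowForm (a s) a' + ∑ c, (b s c * (q' c / q s c) - b' c) := by
  set A := a s with hA
  set B := b s with hB
  set q₀ := q s with hq₀
  -- The logarithmic derivative of `gzFactor`, common to all entries of row `j`.
  let τ : Fin (k + 1) → ℝ := fun j => ∑ c, (a' j - b' c) / (A j - B c) -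
        ∑ i ∈ Finset.univ.erase j, (a' j - a' i) / (A j - A i)
  let F' : Matrix (Fin (k + 1)) (Fin (k + 1)) ℝ := Matrix.of fun j =>
    Fin.snoc (α := fun _ => ℝ) (fun c : Fin k => gzF A B q₀ j c.castSucc *
      (q' c / q₀ c - (a' j - b' c) / (A j - B c) + τ j)) (gzFactor A B j * τ j)
  have hF'c : ∀ j (c : Fin k), F' j c.castSucc = gzF A B q₀ j c.castSucc *
      (q' c / q₀ c - (a' j - b' c) / (A j - B c) + τ j) := fun j c => by simp [F']
  have hF'l : ∀ j, F' j (Fin.last k) = gzFactor A B j * τ j := fun j => by simp [F']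
  refine ⟨F', ?_, ?_⟩
  · rw [hasDerivAt_matrix]
    intro j i
    have ht := hasDerivAt_gzFactor ha hb h j
    rw [hasDerivAt_pi] at ha hb hq
    refine Fin.lastCases ?_ (fun c => ?_) i
    · rw [hF'l]
      simpa only [gzF_last] using ht
    · rw [hF'c]
      have h1 := h.sub_ne j c
      have h2 := hq0 c
      have h3 : HasDerivAt (fun t => q t c / (a t j - b t c)) _ s :=
        (hq c).fun_div ((ha j).fun_sub (hb c)) h1
      simp only [gzF_castSucc]
      refine (h3.fun_mul ht).congr_deriv ?_
      simp only [τ, ← hA, ← hB, ← hq₀]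
      field_simp
  · have hK : ∀ j c, gzF A B q₀ j c.castSucc * gzFInv A B q₀ c.castSucc j =
        gzFactor A B j * gzResidue A B c / (A j - B c) ^ 2 := fun j c => by
      have h1 := h.sub_ne j c
      have h2 := hq0 c
      rw [gzF_castSucc, gzFInv_castSucc]
      field_simp
    have hdiag : ∀ j, ∑ c, gzFactor A B j * gzResidue A B c / (A j - B c) ^ 2 + gzFactor A B j
        = 1 := fun j => by
      have := congrFun (congrFun (h.gzF_mul_gzFInv hq0) j) j
      rw [Matrix.mul_apply, Fin.sum_univ_castSucc, Matrix.one_apply_eq] at this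
      simpa only [hK, gzF_last, gzFInv_last, mul_one] using this
    have hrow : ∀ j, ∑ i, F' j i * gzFInv A B q₀ i j = τ j +
        ∑ c, gzFactor A B j * gzResidue A B c / (A j - B c) ^ 2 *
          (q' c / q₀ c - (a' j - b' c) / (A j - B c)) := fun j => by
      rw [Fin.sum_univ_castSucc]
      simp only [hF'c, hF'l, gzFInv_last, mul_one]
      have e : ∀ c : Fin k, gzF A B q₀ j c.castSucc * (q' c / q₀ c - (a' j - b' c) / (A j - B c) +
          τ j) * gzFInv A B q₀ c.castSucc j =
          gzFactor A B j * gzResidue A B c / (A j - B c) ^ 2 *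
          (q' c / q₀ c - (a' j - b' c) / (A j - B c)) +
          gzFactor A B j * gzResidue A B c / (A j - B c) ^ 2 * τ j := fun c => by
        rw [← hK]
        ring
      simp only [e, Finset.sum_add_distrib]
      rw [← Finset.sum_mul]
      linear_combination τ j * hdiag j
    have htr : Matrix.trace (Matrix.diagonal A * F' * gzFInv A B q₀) =
        ∑ j, A j * (τ j + ∑ c, gzFactor A B j * gzResidue A B c / (A j - B c) ^ 2 *
          (q' c / q₀ c - (a' j - b' c) / (A j - B c))) := by
      rw [Matrix.mul_assoc, Matrix.trace]
      refine Finset.sum_congr rfl fun j _ => ?_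
      rw [Matrix.diag_apply, Matrix.diagonal_mul, Matrix.mul_apply, hrow]
    have hs1 : ∀ j, ∑ c, gzFactor A B j * gzResidue A B c / (A j - B c) ^ 3 =
        ∑ c, 1 / (A j - B c) - ∑ i ∈ Finset.univ.erase j, 1 / (A j - A i) := fun j => by
      rw [← h.factor_mul_sum_residue_cube, Finset.mul_sum]
      simp only [mul_div_assoc]
    have hs2 : ∀ c, ∑ j, gzFactor A B j * gzResidue A B c / (A j - B c) ^ 2 = 1 := fun c => by
      rw [← h.residue_mul_sum_factor_sq c, Finset.mul_sum]
      exact Finset.sum_congr rfl fun j _ => by ring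
    have hs3 : ∀ c, ∑ j, gzFactor A B j * gzResidue A B c / (A j - B c) ^ 3 =
        ∑ r ∈ Finset.univ.erase c, 1 / (B c - B r) + ∑ j, 1 / (A j - B c) := fun c => by
      rw [← h.residue_mul_sum_factor_cube c, Finset.mul_sum]
      exact Finset.sum_congr rfl fun j _ => by ring
    have hs4 : ∀ c, ∑ j, gzFactor A B j * gzResidue A B c / (A j - B c) = 0 := fun c => by
      have := h.sum_factor_div c
      calc _ = gzResidue A B c * ∑ j, gzFactor A B j / (A j - B c) := by
            rw [Finset.mul_sum]
            exact Finset.sum_congr rfl fun j _ => by ring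
        _ = 0 := by rw [this, mul_zero]
    -- This is the coefficient of `dq_c / q_c`, and the source of the term `b dq/q`.
    have hT2 : ∀ c, ∑ j, A j * (gzFactor A B j * gzResidue A B c / (A j - B c) ^ 2) = B c :=
      fun c => by
      have e : ∀ j, A j * (gzFactor A B j * gzResidue A B c / (A j - B c) ^ 2) =
          gzFactor A B j * gzResidue A B c / (A j - B c) +
            B c * (gzFactor A B j * gzResidue A B c / (A j - B c) ^ 2) := fun j => by
        have := h.sub_ne j c
        field_simp
        ring
      simp only [e]
      rw [Finset.sum_add_distrib, ← Finset.mul_sum, hs4, hs2]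
      ring
    have hT4 : ∀ c, ∑ j, A j * (gzFactor A B j * gzResidue A B c / (A j - B c) ^ 3) =
        1 + B c * (∑ r ∈ Finset.univ.erase c, 1 / (B c - B r) + ∑ j, 1 / (A j - B c)) :=
      fun c => by
      have e : ∀ j, A j * (gzFactor A B j * gzResidue A B c / (A j - B c) ^ 3) =
          gzFactor A B j * gzResidue A B c / (A j - B c) ^ 2 +
            B c * (gzFactor A B j * gzResidue A B c / (A j - B c) ^ 3) := fun j => by
        have := h.sub_ne j c
        field_simp
        ring
      simp only [e]
      rw [Finset.sum_add_distrib, ← Finset.mul_sum, hs2, hs3]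
    -- By `hs1` the contributions of `a' j` with its own index `j` cancel; only the terms `a' i`
    -- with `i ≠ j` remain, and these make up `rowForm`.
    have hsplit : ∀ j, A j * (τ j + ∑ c, gzFactor A B j * gzResidue A B c / (A j - B c) ^ 2 *
          (q' c / q₀ c - (a' j - b' c) / (A j - B c))) =
        ∑ c, A j * (gzFactor A B j * gzResidue A B c / (A j - B c) ^ 2) * (q' c / q₀ c) +
        ∑ c, A j * (gzFactor A B j * gzResidue A B c / (A j - B c) ^ 3) * b' c +
        ∑ i ∈ Finset.univ.erase j, A j * a' i / (A j - A i) - ∑ c, A j / (A j - B c) * b' c :=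
      fun j => by
      have e1 : ∑ c, gzFactor A B j * gzResidue A B c / (A j - B c) ^ 2 *
          (q' c / q₀ c - (a' j - b' c) / (A j - B c)) =
          ∑ c, gzFactor A B j * gzResidue A B c / (A j - B c) ^ 2 * (q' c / q₀ c) +
          ∑ c, gzFactor A B j * gzResidue A B c / (A j - B c) ^ 3 * b' c -
          a' j * ∑ c, gzFactor A B j * gzResidue A B c / (A j - B c) ^ 3 := by
        rw [Finset.mul_sum, ← Finset.sum_add_distrib, ← Finset.sum_sub_distrib]
        refine Finset.sum_congr rfl fun c _ => ?_
        have := h.sub_ne j c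
        generalize q' c / q₀ c = z
        field_simp
        ring
      have e2 : τ j = a' j * ∑ c, 1 / (A j - B c) - ∑ c, 1 / (A j - B c) * b' c -
          a' j * ∑ i ∈ Finset.univ.erase j, 1 / (A j - A i) +
          ∑ i ∈ Finset.univ.erase j, a' i / (A j - A i) := by
        simp only [τ, Finset.mul_sum, sub_div, Finset.sum_sub_distrib]
        simp only [mul_one_div, one_div_mul_eq_div]
        ring
      have e3 : ∀ (f g : Fin k → ℝ), ∑ c, A j * f c * g c = A j * ∑ c, f c * g c := fun f g => by
        rw [Finset.mul_sum]
        exact Finset.sum_congr rfl fun c _ => mul_assoc _ _ _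
      have e4 : ∑ c, A j / (A j - B c) * b' c = A j * ∑ c, 1 / (A j - B c) * b' c := by
        rw [← e3]
        simp only [mul_one_div]
      have e5 : ∑ i ∈ Finset.univ.erase j, A j * a' i / (A j - A i) =
          A j * ∑ i ∈ Finset.univ.erase j, a' i / (A j - A i) := by
        rw [Finset.mul_sum]
        simp only [mul_div_assoc]
      rw [e1, e2, hs1, e3, e3, e4, e5]
      ring
    have hB : rowForm B b' = ∑ c, b' c * ∑ r ∈ Finset.univ.erase c, B r / (B r - B c) := by
      rw [rowForm, Finset.sum_comm' (t' := Finset.univ) (s' := fun c => Finset.univ.erase c)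
        (by simp [eq_comm])]
      refine Finset.sum_congr rfl fun c _ => ?_
      rw [Finset.mul_sum]
      exact Finset.sum_congr rfl fun r _ => by ring
    rw [htr, hB]
    simp only [hsplit, Finset.sum_sub_distrib, Finset.sum_add_distrib]
    rw [Finset.sum_comm (f := fun j c => A j * (gzFactor A B j * gzResidue A B c /
        (A j - B c) ^ 2) * (q' c / q₀ c)),
      Finset.sum_comm (f := fun j c => A j * (gzFactor A B j * gzResidue A B c /
        (A j - B c) ^ 3) * b' c), Finset.sum_comm (f := fun j c => A j / (A j - B c) * b' c)]
    simp only [← Finset.sum_mul, hT2, hT4]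
    -- The coefficient of `b' c` is a count of terms: `1 + (k - 1) - (k + 1) = -1`.
    have hc : ∀ c, (1 + B c * (∑ r ∈ Finset.univ.erase c, 1 / (B c - B r) +
        ∑ j, 1 / (A j - B c))) * b' c - (∑ j, A j / (A j - B c)) * b' c +
        b' c * ∑ r ∈ Finset.univ.erase c, B r / (B r - B c) = -b' c := fun c => by
      have e1 : B c * ∑ j, 1 / (A j - B c) - ∑ j, A j / (A j - B c) = -((k : ℝ) + 1) := by
        have : ∀ j, B c * (1 / (A j - B c)) - A j / (A j - B c) = -1 := fun j => by
          have := h.sub_ne j c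
          field_simp
          ring
        rw [Finset.mul_sum, ← Finset.sum_sub_distrib, Finset.sum_congr rfl fun j _ => this j]
        simp
      have e2 : B c * ∑ r ∈ Finset.univ.erase c, 1 / (B c - B r) +
          ∑ r ∈ Finset.univ.erase c, B r / (B r - B c) = (k : ℝ) - 1 := by
        have h1 : ∀ r ∈ Finset.univ.erase c, B c * (1 / (B c - B r)) + B r / (B r - B c) = 1 :=
          fun r hr => by
          have h2 : B c - B r ≠ 0 :=
            sub_ne_zero.2 (h.inj_b.ne (Finset.ne_of_mem_erase hr).symm)
          rw [← neg_sub (B c) (B r), div_neg]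
          field_simp
          ring
        have h2 := Finset.add_sum_erase Finset.univ (fun _ : Fin k => (1 : ℝ)) (Finset.mem_univ c)
        rw [Finset.mul_sum, ← Finset.sum_add_distrib, Finset.sum_congr rfl h1]
        simp only [Finset.sum_const, Finset.card_univ, Fintype.card_fin, nsmul_eq_mul] at h2 ⊢
        linarith
      linear_combination b' c * e1 + b' c * e2
    have hc' := Finset.sum_congr (rfl : (Finset.univ : Finset (Fin k)) = _) fun c _ => hc c
    simp only [Finset.sum_add_distrib, Finset.sum_sub_distrib, Finset.sum_neg_distrib] at hc' ⊢
    rw [rowForm]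
    linear_combination hc'

end OneForm

/-! ### The one-form `Tr diag(γ_N) dg g⁻¹` -/

section OneFormG

/-- The extension of a matrix by a zero row and a zero column. -/
def zeroBorder {k : ℕ} (A : Matrix (Fin k) (Fin k) ℝ) : Matrix (Fin (k + 1)) (Fin (k + 1)) ℝ :=
  embedCorner A - embedCorner (0 : Matrix (Fin k) (Fin k) ℝ)

theorem HasDerivAt.embedCorner_succ {k : ℕ} {A : ℝ → Matrix (Fin k) (Fin k) ℝ}
    {A' : Matrix (Fin k) (Fin k) ℝ} {s : ℝ} (hA : HasDerivAt A A' s) :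
    HasDerivAt (fun t => (embedCorner (A t) : Matrix (Fin (k + 1)) (Fin (k + 1)) ℝ))
      (zeroBorder A') s := by
  rw [hasDerivAt_matrix] at *
  intro i j
  refine Fin.lastCases ?_ (fun i => ?_) i <;> refine Fin.lastCases ?_ (fun j => ?_) j
  · simpa [zeroBorder] using hasDerivAt_const s (1 : ℝ)
  · simpa [zeroBorder] using hasDerivAt_const s (0 : ℝ)
  · simpa [zeroBorder] using hasDerivAt_const s (0 : ℝ)
  · simpa [zeroBorder] using hA i j

theorem trace_mul_zeroBorder {k : ℕ} (B : Matrix (Fin (k + 1)) (Fin (k + 1)) ℝ)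
    (X : Matrix (Fin k) (Fin k) ℝ) :
    Matrix.trace (B * zeroBorder X) = Matrix.trace (B.dropLast * X) := by
  simp [zeroBorder, Matrix.trace, Matrix.mul_apply, Fin.sum_univ_castSucc, Matrix.dropLast_apply]

/-- For `g = f (g' ⊕ 1)`, the trace splits into `Tr diag(a) df f⁻¹` and the trace of `f⁻¹ diag(a) f`
against `dg' g'⁻¹ ⊕ 0`. The latter sees only the corner `diag(b)`, so it is the same one-form one
level down. -/
theorem exists_hasDerivAt_gzG {m : ℕ} {Γ : ℝ → GZArray (m + 1)} {Q : ℝ → GZArray m}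
    {Γ' : GZArray (m + 1)} {Q' : GZArray m} {s : ℝ} (hΓ : HasDerivAt Γ Γ' s)
    (hQ : HasDerivAt Q Q' s) (h : GZNondeg (Γ s) (Q s)) :
    ∃ G', HasDerivAt (fun t => gzG (Γ t) (Q t)) G' s ∧
      Matrix.trace ((Matrix.diagonal (Γ s (Fin.last m)) : Matrix (Fin (m + 1)) (Fin (m + 1)) ℝ) *
        G' * (gzG (Γ s) (Q s))⁻¹) = rowForm (Γ s (Fin.last m)) (Γ' (Fin.last m)) +
        ∑ n : Fin m, ∑ j : Fin (n.1 + 1),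
          (Γ s n.castSucc j * (Q' n j / Q s n j) - Γ' n.castSucc j) := by
  induction m with
  | zero =>
    refine ⟨0, hasDerivAt_const s _, ?_⟩
    rw [Matrix.mul_zero, Matrix.zero_mul, Matrix.trace_zero, Finset.univ_eq_empty,
      Finset.sum_empty, add_zero]
    symm
    refine Finset.sum_eq_zero fun j _ => ?_
    have : Finset.univ.erase j = ∅ := by
      refine Finset.eq_empty_of_forall_notMem fun i hi => Finset.ne_of_mem_erase hi ?_
      exact Subsingleton.elim (α := Fin 1) i j
    rw [this, Finset.sum_empty]
  | succ m ih =>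
    have hΓ2 := hasDerivAt_pi.1 hΓ
    have hQ2 := hasDerivAt_pi.1 hQ
    have hΓi : HasDerivAt (fun t => (Γ t).init) Γ'.init s :=
      hasDerivAt_pi.2 fun n => hΓ2 n.castSucc
    have hQi : HasDerivAt (fun t => (Q t).init) Q'.init s :=
      hasDerivAt_pi.2 fun n => hQ2 n.castSucc
    obtain ⟨G', hG', hG⟩ := ih hΓi hQi h.init
    have hr := h.rows_last
    have hq0 := h.Q_ne (Fin.last m)
    obtain ⟨F', hF', hF⟩ := GZRows.exists_hasDerivAt_gzF (k := m + 1) (hΓ2 (Fin.last (m + 1)))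
      (hΓ2 (Fin.last m).castSucc) (hQ2 (Fin.last m)) hr hq0
    simp only [gzG_succ]
    refine ⟨_, hF'.matrixMul hG'.embedCorner_succ, ?_⟩
    rw [← gzG_succ, h.inv_gzG_succ]
    set a : Fin (m + 2) → ℝ := Γ s (Fin.last (m + 1)) with ha
    set b : Fin (m + 1) → ℝ := Γ s (Fin.last m).castSucc with hb
    set q : Fin (m + 1) → ℝ := Q s (Fin.last m) with hq
    set g := gzG (Γ s).init (Q s).init with hg
    have hgu : IsUnit g.det := h.init.isUnit_det_gzG
    have e1 : (embedCorner g : Matrix (Fin (m + 2)) (Fin (m + 2)) ℝ) * embedCorner g⁻¹ = 1 := by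
      rw [← embedCorner_mul, Matrix.mul_nonsing_inv _ hgu, embedCorner_one]
    have e2 : Matrix.trace (Matrix.diagonal a * (F' * embedCorner g + gzF a b q *
        zeroBorder G') * (embedCorner g⁻¹ * gzFInv a b q)) =
        Matrix.trace (Matrix.diagonal a * F' * gzFInv a b q) +
        Matrix.trace (gzBorder a b q * zeroBorder (G' * g⁻¹)) := by
      have e3 : zeroBorder G' *
          embedCorner g⁻¹ = zeroBorder (G' * g⁻¹) := by
        rw [zeroBorder, zeroBorder, Matrix.sub_mul, ← embedCorner_mul, ← embedCorner_mul, Matrix.zero_mul]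
      have e4 : Matrix.diagonal a * (F' * embedCorner g + gzF a b q *
          zeroBorder G') * (embedCorner g⁻¹ * gzFInv a b q) =
          Matrix.diagonal a * F' * (embedCorner g * embedCorner g⁻¹) * gzFInv a b q +
          Matrix.diagonal a * gzF a b q * (zeroBorder G' * embedCorner g⁻¹) *
            gzFInv a b q := by
        simp only [Matrix.mul_add, Matrix.add_mul, Matrix.mul_assoc]
      rw [e4, e1, e3, Matrix.mul_one, Matrix.trace_add, gzBorder]
      congr 1
      rw [Matrix.trace_mul_comm _ (gzFInv a b q)]
      simp only [Matrix.mul_assoc]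
    have e5 : (gzBorder a b q).dropLast = Matrix.diagonal b := by
      ext i j
      exact hr.gzBorder_castSucc_castSucc hq0 i j
    rw [Fin.sum_univ_castSucc]
    refine e2.trans ?_
    rw [trace_mul_zeroBorder, e5, ← Matrix.mul_assoc]
    have hG2 : Matrix.trace (Matrix.diagonal b * G' * g⁻¹) = rowForm b (Γ' (Fin.last m).castSucc) +
        ∑ n : Fin m, ∑ j : Fin (n.1 + 1),
          (Γ s n.castSucc.castSucc j * (Q' n.castSucc j / Q s n.castSucc j) -
            Γ' n.castSucc.castSucc j) := hG
    rw [hG2]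
    have hF2 : Matrix.trace (Matrix.diagonal a * F' * gzFInv a b q) +
        rowForm b (Γ' (Fin.last m).castSucc) = rowForm a (Γ' (Fin.last (m + 1))) +
        ∑ j : Fin (m + 1), (Γ s (Fin.last m).castSucc j * (Q' (Fin.last m) j / Q s (Fin.last m) j) -
          Γ' (Fin.last m).castSucc j) := hF
    rw [← add_assoc, hF2, add_assoc, add_comm (∑ j : Fin (m + 1), _)]
    rfl

variable {m : ℕ} {L : Fin (m + 1) → ℝ} {y : GZArray m × GZArray m}

/-- The matrix `g` in the coordinates with fixed last row. -/
def gzGChart (L : Fin (m + 1) → ℝ) (y : GZArray m × GZArray m) :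
    Matrix (Fin (m + 1)) (Fin (m + 1)) ℝ :=
  gzG (GZArray.complete L y.1) y.2

theorem contDiffAt_gzGChart {r : WithTop ℕ∞} (hy : y ∈ gzDomain L) :
    ContDiffAt ℝ r (gzGChart L) y := contDiffAt_gzG hy

theorem hasDerivAt_line {E : Type*} [NormedAddCommGroup E] [NormedSpace ℝ E] (y w : E) :
    HasDerivAt (fun t : ℝ => y + t • w) w 0 := by
  simpa using ((hasDerivAt_id (0 : ℝ)).smul_const w).const_add y

theorem HasFDerivAt.hasDerivAt_line {E F : Type*} [NormedAddCommGroup E] [NormedSpace ℝ E]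
    [NormedAddCommGroup F] [NormedSpace ℝ F] {f : E → F} {f' : E →L[ℝ] F} {y : E}
    (hf : HasFDerivAt f f' y) (w : E) : HasDerivAt (fun t : ℝ => f (y + t • w)) (f' w) 0 := by
  have h1 : HasFDerivAt f f' (y + (0 : ℝ) • w) := by simpa using hf
  exact h1.comp_hasDerivAt (0 : ℝ) (_root_.hasDerivAt_line y w)

theorem trace_fderiv_gzGChart (hy : y ∈ gzDomain L) (w : GZArray m × GZArray m) :
    Matrix.trace (Matrix.diagonal L * fderiv ℝ (gzGChart L) y w * (gzGChart L y)⁻¹) =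
      ∑ n : Fin m, ∑ j : Fin (n.1 + 1), (y.1 n j * (w.2 n j / y.2 n j) - w.1 n j) := by
  have h1 := ((contDiffAt_gzGChart (r := 1) hy).differentiableAt one_ne_zero).hasFDerivAt
  have h2 := h1.hasDerivAt_line w
  have hΓ : HasDerivAt (fun t : ℝ => GZArray.complete L (y + t • w).1)
      (GZArray.complete 0 w.1) 0 := by
    refine hasDerivAt_pi.2 fun n => ?_
    refine Fin.lastCases ?_ (fun i => ?_) n
    · simp only [complete_last]
      exact hasDerivAt_const _ _
    · simp only [complete_castSucc]
      exact hasDerivAt_pi.1 (hasDerivAt_line y.1 w.1) i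
  have hQ : HasDerivAt (fun t : ℝ => (y + t • w).2) w.2 0 := hasDerivAt_line y.2 w.2
  have e0 : y + (0 : ℝ) • w = y := by simp
  obtain ⟨G', hG', hG⟩ := exists_hasDerivAt_gzG hΓ hQ (by rw [e0]; exact hy)
  rw [e0] at hG
  have eG : G' = fderiv ℝ (gzGChart L) y w := hG'.unique h2
  rw [← eG]
  rw [complete_last] at hG
  refine hG.trans ?_
  -- The last row is constant along the line, so the one boundary term left by the telescoping
  -- vanishes.
  have e1 : rowForm L ((GZArray.complete 0 w.1 : GZArray (m + 1)) (Fin.last m)) = 0 := by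
    rw [complete_last]
    simp [rowForm]
  rw [e1, zero_add]
  refine Finset.sum_congr rfl fun n _ => Finset.sum_congr rfl fun j _ => ?_
  rw [complete_castSucc, complete_castSucc]

/-! ### Exterior derivative of the one-form -/

theorem ContDiffAt.exists_symm_hasDerivAt_fderiv {E F : Type*} [NormedAddCommGroup E]
    [NormedSpace ℝ E] [NormedAddCommGroup F] [NormedSpace ℝ F] {f : E → F} {y : E}
    (hf : ContDiffAt ℝ 2 f y) :
    ∃ S : E → E → F, (∀ v w, S v w = S w v) ∧
      ∀ v w, HasDerivAt (fun t : ℝ => fderiv ℝ f (y + t • v) w) (S v w) 0 := by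
  have hD : DifferentiableAt ℝ (fderiv ℝ f) y :=
    (hf.fderiv_right (m := 1) (by norm_num)).differentiableAt one_ne_zero
  refine ⟨fun v w => fderiv ℝ (fderiv ℝ f) y v w, fun v w =>
    (hf.isSymmSndFDerivAt (by simp)).eq v w, fun v w => ?_⟩
  exact (ContinuousLinearMap.apply ℝ F w).hasFDerivAt.comp_hasDerivAt (0 : ℝ)
    (hD.hasFDerivAt.hasDerivAt_line v)

theorem hasDerivAt_trace {N : ℕ} {f : ℝ → Matrix (Fin N) (Fin N) ℝ}
    {f' : Matrix (Fin N) (Fin N) ℝ} {s : ℝ} (hf : HasDerivAt f f' s) :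
    HasDerivAt (fun t => Matrix.trace (f t)) (Matrix.trace f') s :=
  HasDerivAt.fun_sum fun i _ => hasDerivAt_matrix.1 hf i i

theorem HasDerivAt.matrixInv {N : ℕ} {g : ℝ → Matrix (Fin N) (Fin N) ℝ}
    {g' : Matrix (Fin N) (Fin N) ℝ} {s : ℝ} (hg : HasDerivAt g g' s) (hs : IsUnit (g s).det)
    (hd : DifferentiableAt ℝ (fun t => (g t)⁻¹) s) :
    HasDerivAt (fun t => (g t)⁻¹) (-((g s)⁻¹ * g' * (g s)⁻¹)) s := by
  obtain ⟨I', hi⟩ : ∃ I', HasDerivAt (fun t => (g t)⁻¹) I' s := ⟨_, hd.hasDerivAt⟩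
  have hdet : ∀ᶠ t in 𝓝 s, IsUnit (g t).det := by
    have hc : ContinuousAt (fun t => (g t).det) s :=
      (Continuous.matrix_det continuous_id).continuousAt.comp hg.continuousAt
    filter_upwards [hc.eventually_ne hs.ne_zero] with t ht using isUnit_iff_ne_zero.2 ht
  have h1 : HasDerivAt (fun t => g t * (g t)⁻¹) 0 s := by
    refine (hasDerivAt_const s (1 : Matrix (Fin N) (Fin N) ℝ)).congr_of_eventuallyEq ?_
    filter_upwards [hdet] with t ht using Matrix.mul_nonsing_inv _ ht
  have h2 := (hg.matrixMul hi).unique h1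
  have h3 : I' = -((g s)⁻¹ * g' * (g s)⁻¹) := by
    have h4 : (g s)⁻¹ * (g' * (g s)⁻¹ + g s * I') = 0 := by rw [h2, Matrix.mul_zero]
    rw [Matrix.mul_add, ← Matrix.mul_assoc, ← Matrix.mul_assoc, Matrix.nonsing_inv_mul _ hs,
      Matrix.one_mul] at h4
    exact eq_neg_of_add_eq_zero_right h4
  rwa [h3] at hi

/-- `θ(v) = dg(v) g⁻¹`. -/
def gzTheta (L : Fin (m + 1) → ℝ) (y v : GZArray m × GZArray m) :
    Matrix (Fin (m + 1)) (Fin (m + 1)) ℝ :=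
  fderiv ℝ (gzGChart L) y v * (gzGChart L y)⁻¹

theorem isUnit_det_gzGChart (hy : y ∈ gzDomain L) : IsUnit (gzGChart L y).det :=
  GZNondeg.isUnit_det_gzG hy

theorem hasDerivAt_gzGChart_line (hy : y ∈ gzDomain L) (v : GZArray m × GZArray m) :
    HasDerivAt (fun t : ℝ => gzGChart L (y + t • v)) (fderiv ℝ (gzGChart L) y v) 0 :=
  ((contDiffAt_gzGChart (r := 1) hy).differentiableAt one_ne_zero).hasFDerivAt.hasDerivAt_line v

theorem hasDerivAt_inv_gzGChart_line (hy : y ∈ gzDomain L) (v : GZArray m × GZArray m) :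
    HasDerivAt (fun t : ℝ => (gzGChart L (y + t • v))⁻¹)
      (-((gzGChart L y)⁻¹ * gzTheta L y v)) 0 := by
  have e0 : y + (0 : ℝ) • v = y := by simp
  have h1 : ContDiffAt ℝ 1 (fun y => (gzGChart L y)⁻¹) y :=
    (contDiffAt_gzGChart hy).matrixInv (isUnit_det_gzGChart hy)
  have h2 := (hasDerivAt_gzGChart_line hy v).matrixInv (by rw [e0]; exact isUnit_det_gzGChart hy)
    (((h1.differentiableAt one_ne_zero).hasFDerivAt.hasDerivAt_line v).differentiableAt)
  rwa [e0, Matrix.mul_assoc] at h2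

/-- Maurer–Cartan: the exterior derivative of `Tr diag(L) dg g⁻¹` is `Tr diag(L) (dg g⁻¹)²`. -/
theorem trace_gzTheta_commutator (hy : y ∈ gzDomain L) (v w : GZArray m × GZArray m) :
    Matrix.trace (Matrix.diagonal L *
      (gzTheta L y v * gzTheta L y w - gzTheta L y w * gzTheta L y v)) = darbouxForm y v w := by
  have e0 : ∀ v : GZArray m × GZArray m, y + (0 : ℝ) • v = y := fun v => by simp
  have h2 : ContDiffAt ℝ 2 (gzGChart L) y := contDiffAt_gzGChart hy
  obtain ⟨S, hS, hW⟩ := h2.exists_symm_hasDerivAt_fderiv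
  -- Derivative along `v` of the one-form evaluated on the constant field `w`. Antisymmetrizing in
  -- `v` and `w` removes the second derivative `S` and the terms with `Q²` in the denominator.
  have key : ∀ v w : GZArray m × GZArray m,
      Matrix.trace (Matrix.diagonal L * S v w *
        (gzGChart L y)⁻¹) - Matrix.trace (Matrix.diagonal L *
          (gzTheta L y w * gzTheta L y v)) =
      ∑ n : Fin m, ∑ j : Fin (n.1 + 1),
        (v.1 n j * (w.2 n j / y.2 n j) - y.1 n j * (w.2 n j * v.2 n j / y.2 n j ^ 2)) := by
    intro v w
    have hev : ∀ᶠ t in 𝓝 (0 : ℝ), y + t • v ∈ gzDomain L := by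
      have hc : Continuous fun t : ℝ => y + t • v := by fun_prop
      exact hc.continuousAt.eventually ((isOpen_gzDomain L).mem_nhds
        (show y + (0 : ℝ) • v ∈ gzDomain L by rw [e0]; exact hy))
    have h3 := hasDerivAt_trace (((hasDerivAt_const (0 : ℝ) (Matrix.diagonal L)).matrixMul
      (hW v w)).matrixMul (hasDerivAt_inv_gzGChart_line hy v))
    have h4 : HasDerivAt (fun t : ℝ => ∑ n : Fin m, ∑ j : Fin (n.1 + 1),
        ((y + t • v).1 n j * (w.2 n j / (y + t • v).2 n j) - w.1 n j))
        (∑ n : Fin m, ∑ j : Fin (n.1 + 1),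
        (v.1 n j * (w.2 n j / y.2 n j) - y.1 n j * (w.2 n j * v.2 n j / y.2 n j ^ 2))) 0 := by
      refine HasDerivAt.fun_sum fun n _ => HasDerivAt.fun_sum fun j _ => ?_
      have hq := GZNondeg.Q_ne hy n j
      have h5 : HasDerivAt (fun t : ℝ => (y + t • v).1 n j) (v.1 n j) 0 :=
        hasDerivAt_pi.1 (hasDerivAt_pi.1 (hasDerivAt_line y.1 v.1) n) j
      have h6 : HasDerivAt (fun t : ℝ => (y + t • v).2 n j) (v.2 n j) 0 :=
        hasDerivAt_pi.1 (hasDerivAt_pi.1 (hasDerivAt_line y.2 v.2) n) j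
      have h7 := (h5.fun_mul ((hasDerivAt_const (0 : ℝ) (w.2 n j)).fun_div h6
        (by rwa [e0]))).sub_const (w.1 n j)
      refine h7.congr_deriv ?_
      rw [e0]
      field_simp
      ring
    have h5 := h3.unique (h4.congr_of_eventuallyEq (by
      filter_upwards [hev] with t ht using trace_fderiv_gzGChart ht w))
    rw [← h5, e0]
    simp only [gzTheta, Matrix.zero_mul, zero_add, Matrix.mul_neg, Matrix.trace_add,
      Matrix.trace_neg, Matrix.mul_assoc]
    exact sub_eq_add_neg _ _
  have h1 := key v w
  have h3 := key w v
  rw [hS] at h1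
  rw [Matrix.mul_sub, Matrix.trace_sub]
  have e : darbouxForm y v w = ∑ n : Fin m, ∑ j : Fin (n.1 + 1),
      (v.1 n j * (w.2 n j / y.2 n j) - y.1 n j * (w.2 n j * v.2 n j / y.2 n j ^ 2)) -
      ∑ n : Fin m, ∑ j : Fin (n.1 + 1),
      (w.1 n j * (v.2 n j / y.2 n j) - y.1 n j * (v.2 n j * w.2 n j / y.2 n j ^ 2)) := by
    rw [darbouxForm, ← Finset.sum_sub_distrib]
    refine Finset.sum_congr rfl fun n _ => ?_
    rw [← Finset.sum_sub_distrib]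
    refine Finset.sum_congr rfl fun j _ => ?_
    ring
  rw [e, ← h1, ← h3]
  ring

end OneFormG

/-! ### The differential of the chart and the Kirillov–Kostant form -/

section Symplectic

variable {m : ℕ} {L : Fin (m + 1) → ℝ} {y : GZArray m × GZArray m}

theorem gzChart_eq (L : Fin (m + 1) → ℝ) (y : GZArray m × GZArray m) :
    gzChart L y = (gzGChart L y)⁻¹ * Matrix.diagonal L * gzGChart L y := by
  rw [gzChart, gzPoint, gzGChart, complete_last]

/-- Differentiating `u = g⁻¹ U g` gives `du = [u, g⁻¹ dg]`, and `g⁻¹ θ g = g⁻¹ dg` for `θ = dg g⁻¹`.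
-/
theorem fderiv_gzChart_apply (hy : y ∈ gzDomain L) (v : GZArray m × GZArray m) :
    fderiv ℝ (gzChart L) y v = commutatorMap (gzChart L y)
      ((gzGChart L y)⁻¹ * gzTheta L y v * gzGChart L y) := by
  have e0 : y + (0 : ℝ) • v = y := by simp
  have hu := isUnit_det_gzGChart hy
  have h1 := (((contDiffAt_gzChart (r := 1) hy).differentiableAt
    one_ne_zero).hasFDerivAt).hasDerivAt_line v
  have h2 := ((hasDerivAt_inv_gzGChart_line hy v).matrixMul
    (hasDerivAt_const (0 : ℝ) (Matrix.diagonal L))).matrixMul (hasDerivAt_gzGChart_line hy v)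
  simp only [← gzChart_eq] at h2
  refine (h1.unique h2).trans ?_
  rw [e0, commutatorMap_apply, gzChart_eq]
  set g := gzGChart L y
  set U := Matrix.diagonal L
  have e1 : fderiv ℝ (gzGChart L) y v = gzTheta L y v * g := by
    rw [gzTheta, Matrix.mul_assoc, Matrix.nonsing_inv_mul _ hu, Matrix.mul_one]
  have e2 : g⁻¹ * U * g * (g⁻¹ * gzTheta L y v * g) = g⁻¹ * U * (gzTheta L y v * g) := by
    calc _ = g⁻¹ * U * (g * g⁻¹) * (gzTheta L y v * g) := by simp only [Matrix.mul_assoc]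
      _ = _ := by rw [Matrix.mul_nonsing_inv _ hu, Matrix.mul_one]
  have e3 : g⁻¹ * gzTheta L y v * g * (g⁻¹ * U * g) = g⁻¹ * gzTheta L y v * U * g := by
    calc _ = g⁻¹ * gzTheta L y v * (g * g⁻¹) * U * g := by simp only [Matrix.mul_assoc]
      _ = _ := by rw [Matrix.mul_nonsing_inv _ hu, Matrix.mul_one]
  rw [e2, e3]
  have e4 : (-(g⁻¹ * gzTheta L y v) * U + g⁻¹ * 0) * g + g⁻¹ * U * (gzTheta L y v * g) =
      g⁻¹ * U * (gzTheta L y v * g) - g⁻¹ * gzTheta L y v * U * g := by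
    rw [Matrix.mul_zero, add_zero, Matrix.neg_mul, Matrix.neg_mul]
    abel
  rw [← e4]
  congr 2

theorem fderiv_gzChart_mem (hy : y ∈ gzDomain L) (v : GZArray m × GZArray m) :
    fderiv ℝ (gzChart L) y v ∈ orbitTangent (gzChart L y) :=
  ⟨_, (fderiv_gzChart_apply hy v).symm⟩

theorem kirillovKostant_fderiv_gzChart (hy : y ∈ gzDomain L) (v w : GZArray m × GZArray m) :
    kirillovKostant (gzChart L y) ⟨fderiv ℝ (gzChart L) y v, fderiv_gzChart_mem hy v⟩
      ⟨fderiv ℝ (gzChart L) y w, fderiv_gzChart_mem hy w⟩ = darbouxForm y v w := by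
  have hu := isUnit_det_gzGChart hy
  rw [← trace_gzTheta_commutator hy]
  rw [kirillovKostant_eq _ _ _ _ _ (fderiv_gzChart_apply hy v).symm
    (fderiv_gzChart_apply hy w).symm, commutatorMap_apply, gzChart_eq]
  set g := gzGChart L y
  have key : ∀ A B : Matrix (Fin (m + 1)) (Fin (m + 1)) ℝ,
      (g⁻¹ * A * g) * (g⁻¹ * B * g) = g⁻¹ * (A * B) * g := fun A B => by
    calc _ = g⁻¹ * A * (g * g⁻¹) * (B * g) := by simp only [Matrix.mul_assoc]
      _ = _ := by
        rw [Matrix.mul_nonsing_inv _ hu, Matrix.mul_one]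
        simp only [Matrix.mul_assoc]
  rw [key, key, ← Matrix.sub_mul, ← Matrix.mul_sub, key, Matrix.trace_mul_comm,
    ← Matrix.mul_assoc, Matrix.mul_nonsing_inv _ hu, Matrix.one_mul]

/-! ### Nondegeneracy and dimension count -/

theorem eq_zero_of_darbouxForm_eq_zero (hy : y ∈ gzDomain L) {v : GZArray m × GZArray m}
    (h : ∀ w, darbouxForm y v w = 0) : v = 0 := by
  classical
  have hq := GZNondeg.Q_ne hy
  -- Test vector obtained by rotating `v` in the coordinates `(γ, log |Q|)`: the form on it is the
  -- sum of the squares of `dγ(v)` and `Q⁻¹ dQ(v)`.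
  have h1 := h (fun n j => -((y.2 n j)⁻¹ * v.2 n j), fun n j => y.2 n j * v.1 n j)
  have h2 : ∀ n j, v.1 n j * ((y.2 n j)⁻¹ * (y.2 n j * v.1 n j)) -
      -((y.2 n j)⁻¹ * v.2 n j) * ((y.2 n j)⁻¹ * v.2 n j) =
      v.1 n j ^ 2 + ((y.2 n j)⁻¹ * v.2 n j) ^ 2 := fun n j => by
    rw [inv_mul_cancel_left₀ (hq n j)]
    ring
  simp only [darbouxForm, h2] at h1
  have h3 : ∀ n j, v.1 n j ^ 2 + ((y.2 n j)⁻¹ * v.2 n j) ^ 2 = 0 := fun n j =>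
    (Finset.sum_eq_zero_iff_of_nonneg fun _ _ => by positivity).1
      ((Finset.sum_eq_zero_iff_of_nonneg fun _ _ => Finset.sum_nonneg fun _ _ => by
        positivity).1 h1 n (Finset.mem_univ n)) j (Finset.mem_univ j)
  have h4 : ∀ n j, v.1 n j = 0 := fun n j => by
    have := h3 n j
    exact pow_eq_zero_iff two_ne_zero |>.1
      (le_antisymm (by nlinarith [sq_nonneg ((y.2 n j)⁻¹ * v.2 n j)]) (sq_nonneg _))
  have h5 : ∀ n j, v.2 n j = 0 := fun n j => by
    have := h3 n j
    rw [h4, zero_pow two_ne_zero, zero_add, pow_eq_zero_iff two_ne_zero] at this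
    exact (mul_eq_zero.1 this).resolve_left (inv_ne_zero (hq n j))
  exact Prod.ext (funext fun n => funext (h4 n)) (funext fun n => funext (h5 n))

/-- A vector killed by the differential lies in the kernel of the pulled-back form, which is
nondegenerate. -/
theorem injective_fderiv_gzChart (hy : y ∈ gzDomain L) :
    Function.Injective (fderiv ℝ (gzChart L) y) := by
  refine (injective_iff_map_eq_zero (fderiv ℝ (gzChart L) y)).2 fun v hv => ?_
  refine eq_zero_of_darbouxForm_eq_zero hy fun w => ?_
  rw [← kirillovKostant_fderiv_gzChart hy,
    kirillovKostant_eq _ 0 _ _ _ (by rw [map_zero]; exact hv.symm)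
      (fderiv_gzChart_apply hy w).symm, commutatorMap_apply]
  simp

/-- The commutant of a diagonalizable matrix contains the conjugated diagonal matrices. -/
theorem finrank_orbitTangent_le {N : ℕ} {g : Matrix (Fin N) (Fin N) ℝ} (hg : IsUnit g.det)
    (d : Fin N → ℝ) :
    Module.finrank ℝ (orbitTangent (g⁻¹ * Matrix.diagonal d * g)) + N ≤ N * N := by
  set u := g⁻¹ * Matrix.diagonal d * g with hu
  let φ : (Fin N → ℝ) →ₗ[ℝ] Matrix (Fin N) (Fin N) ℝ :=
    (LinearMap.mulLeft ℝ g⁻¹ ∘ₗ LinearMap.mulRight ℝ g) ∘ₗ Matrix.diagonalLinearMap (Fin N) ℝ ℝ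
  have hφ : ∀ e, φ e = g⁻¹ * (Matrix.diagonal e * g) := fun _ => rfl
  have hinj : Function.Injective φ := by
    intro e e' h
    rw [hφ, hφ] at h
    have h1 := congrArg (fun M => g * M * g⁻¹) h
    simp only [← Matrix.mul_assoc, Matrix.mul_nonsing_inv _ hg, Matrix.one_mul] at h1
    simp only [Matrix.mul_assoc, Matrix.mul_nonsing_inv _ hg, Matrix.mul_one] at h1
    exact Matrix.diagonal_injective h1
  have hle : LinearMap.range φ ≤ LinearMap.ker (commutatorMap u) := by
    rintro _ ⟨e, rfl⟩
    rw [LinearMap.mem_ker, commutatorMap_apply, hφ, hu, sub_eq_zero,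
      Matrix.mul_assoc g⁻¹ (Matrix.diagonal d) g]
    have e1 : ∀ a b : Fin N → ℝ, g⁻¹ * (Matrix.diagonal a * g) * (g⁻¹ * (Matrix.diagonal b * g)) =
        g⁻¹ * (Matrix.diagonal a * Matrix.diagonal b) * g := fun a b => by
      calc _ = g⁻¹ * Matrix.diagonal a * (g * g⁻¹) * (Matrix.diagonal b * g) := by
            simp only [Matrix.mul_assoc]
        _ = _ := by
          rw [Matrix.mul_nonsing_inv _ hg, Matrix.mul_one]
          simp only [Matrix.mul_assoc]
    rw [e1, e1, Matrix.diagonal_mul_diagonal, Matrix.diagonal_mul_diagonal]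
    simp only [mul_comm]
  have h1 := LinearMap.finrank_range_add_finrank_ker (commutatorMap u)
  have h2 := Submodule.finrank_mono hle
  rw [LinearMap.finrank_range_of_inj hinj, Module.finrank_fin_fun] at h2
  rw [Module.finrank_matrix, Fintype.card_fin, Module.finrank_self, mul_one] at h1
  rw [← h1]
  exact Nat.add_le_add_left h2 _

theorem finrank_gzArray (k : ℕ) : 2 * Module.finrank ℝ (GZArray k) = k * (k + 1) := by
  rw [Module.finrank_pi_fintype]
  simp only [Module.finrank_fin_fun]
  rw [Fin.sum_univ_eq_sum_range (fun i => i + 1)]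
  induction k with
  | zero => simp
  | succ k ih =>
    rw [Finset.sum_range_succ, mul_add, ih]
    ring

/-- The range lies in the tangent space and has dimension `m (m + 1) = N² - N` by injectivity. The
tangent space is no larger, since the commutant of `u` has dimension at least `N`. -/
theorem range_fderiv_gzChart (hy : y ∈ gzDomain L) :
    LinearMap.range (fderiv ℝ (gzChart L) y).toLinearMap = orbitTangent (gzChart L y) := by
  refine Submodule.eq_of_le_of_finrank_le ?_ ?_
  · rintro _ ⟨v, rfl⟩
    exact fderiv_gzChart_mem hy v
  · rw [LinearMap.finrank_range_of_inj (injective_fderiv_gzChart hy), Module.finrank_prod]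
    have h1 := finrank_orbitTangent_le (isUnit_det_gzGChart hy) L
    rw [← gzChart_eq] at h1
    have h2 := finrank_gzArray m
    nlinarith

end Symplectic

end

theorem proposition3p1 (m : ℕ) (lam : Fin (m + 1) → ℝ) (hlam : Function.Injective lam) :
    -- `O⁽⁰⁾` is an open part of the orbit
    IsOpen {u : coadjointOrbit lam | (u : Matrix (Fin (m + 1)) (Fin (m + 1)) ℝ) ∈ openPart lam} ∧
    (openPart lam).Nonempty ∧
    -- `S_1 × ⋯ × S_N` acts freely on the fibres of `π`, and the factor is `O⁽⁰⁾`
    (∀ (σ : LevelPerm (m + 1)) (p : gzCover lam), σ • p = p → σ = 1) ∧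
    IsQuotientCoveringMap (gzCover.proj lam) (LevelPerm (m + 1)) ∧
    -- `(γ, Q)` parametrize the cover
    (∃ Φ : gzCoord lam ≃ₜ gzCover lam,
      (∀ x, IsUnit (gzG x.1.1 x.1.2).det ∧
        (Φ x).1.1 = gzPoint x.1.1 x.1.2 ∧ (Φ x).1.2 = x.1.1) ∧
      (∀ (σ : LevelPerm (m + 1)) (x : gzCoord lam), Φ (σ • x) = σ • Φ x) ∧
      -- the inverse of the parametrization, through minors of `x I - u`
      ∀ (p : gzCover lam) (i : Fin m) (j : Fin (i.1 + 1)),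
        minorB p.1.1 i (p.1.2 i.castSucc j) ≠ 0 ∧
        minorA p.1.1 i.1 (by omega) (p.1.2 i.castSucc j) ≠ 0 ∧
        (Φ.symm p).1.2 i j = (minorB p.1.1 i (p.1.2 i.castSucc j))⁻¹ *
          minorA p.1.1 (i.1 + 2) (by omega) (p.1.2 i.castSucc j) ∧
        (Φ.symm p).1.2 i j = -(minorC p.1.1 i (p.1.2 i.castSucc j) *
          (minorA p.1.1 i.1 (by omega) (p.1.2 i.castSucc j))⁻¹)) ∧
    -- for each fixed ordering `L` of the eigenvalues, `(γ_{nj}, Q_{nj})`, `n ≤ N - 1`, run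
    -- through `ℝ^{N(N-1)} ∖ Δ`
    ∀ L : Fin (m + 1) → ℝ, (∃ τ : Equiv.Perm (Fin (m + 1)), L = lam ∘ τ) →
      (∃ h : Set.MapsTo (gzChart L) (gzDomain L) (openPart lam),
        IsQuotientCoveringMap (h.restrict (gzChart L) (gzDomain L) (openPart lam))
          (LevelPerm m)) ∧
      -- they are smooth coordinates
      IsOpen (gzDomain L) ∧
      ContDiffOn ℝ (⊤ : ℕ∞) (gzChart L) (gzDomain L) ∧
      ∀ y ∈ gzDomain L,
        Function.Injective (fderiv ℝ (gzChart L) y) ∧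
        LinearMap.range (fderiv ℝ (gzChart L) y).toLinearMap = orbitTangent (gzChart L y) ∧
        -- and the lift of the Kirillov–Kostant form is canonical
        ∃ ht : ∀ v, fderiv ℝ (gzChart L) y v ∈ orbitTangent (gzChart L y),
          ∀ v w, kirillovKostant (gzChart L y) ⟨fderiv ℝ (gzChart L) y v, ht v⟩
            ⟨fderiv ℝ (gzChart L) y w, ht w⟩ = darbouxForm y v w := by
  refine ⟨isOpen_openPart, openPart_nonempty hlam, gzCover_smul_free, isQuotientCoveringMap_proj,
    ⟨gzHomeo hlam, fun x => ⟨GZNondeg.isUnit_det_gzG x.2.2, rfl, rfl⟩, gzHomeo_smul hlam,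
      fun p i j => ?_⟩, fun L hL => ?_⟩
  · obtain ⟨h1, h2⟩ := minorB_ne_zero_of_mem_gzCover hlam p.2 i j
    exact ⟨h1, minorA_ne_zero_of_mem_gzCover p.2 i j, h2, rfl⟩
  · exact ⟨⟨mapsTo_gzChart hL, isQuotientCoveringMap_gzChart hL hlam⟩, isOpen_gzDomain L,
      fun y hy => (contDiffAt_gzChart hy).contDiffWithinAt, fun y hy =>
        ⟨injective_fderiv_gzChart hy, range_fderiv_gzChart hy, fderiv_gzChart_mem hy,
          kirillovKostant_fderiv_gzChart hy⟩⟩
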